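/- **Definitions.** Let $A$ be a finite alphabet. For a language $F\subseteq A^*$ the regular realizability problem is $$\mathrm{NRR}(F)=\{\mathcal A \mid \mathcal A \text{ is a nondeterministic finite automaton over } A \text{ and } L(\mathcal A)\cap F\neq\varnothing\},$$ where $L(\mathcal A)$ is the language recognized by $\mathcal A$ and automata are given as binary words in a standard way (number of states in unary, followed by the bit vectors of the initial states, of the accepting states and of the labelled transition relation). A context-free language $L\subseteq A^*$ is called *easy* if $\mathrm{NRR}(L)\in\mathbf{NL}$, where $\mathbf{NL}$ is the class of languages recognized by nondeterministic Turing machines in space $O(\log n)$. For a mapping $a\mapsto L_a$ that assigns to every letter $a\in A$ a language $L_a\subseteq B^*$, the substitution $\sigma$ is the morphism from $A^*$ to the monoid $2^{B^*}$ of languages over $B$ (with concatenation) such that $\sigma(a)=L_a$, that is, $\sigma(a_1a_2\cdots a_k)=L_{a_1}L_{a_2}\cdots L_{a_k}$ and $\sigma(\varepsilon)=\{\varepsilon\}$; for $L\subseteq A^*$ put $\sigma(L)=\bigcup_{w\in L}\sigma(w)$. **Lemma.** Let $A$ and $B$ be finite alphabets, let $L\subseteq A^*$ be an easy language, and for every $a\in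 A$ let $L_a\subseteq B^*$ be an easy language. Then the language $\sigma(L)\subseteq B^*$ is also easy; that is, $\sigma(L)$ is context-free and $\mathrm{NRR}(\sigma(L))\in\mathbf{NL}$. -/

import Mathlib

/-! ### Nondeterministic logarithmic space -/

namespace RegReal

/-- What the input head can see: a letter of the input word or one of the two end markers. -/
inductive InputCell (S : Type*) where
  | leftEnd : InputCell S
  | letter (s : S) : InputCell S
  | rightEnd : InputCell S

/-- Head moves. -/
inductive Move where
  | left : Move
  | stay : Move
  | right : Move

/-- The new position of a head on a one-way infinite tape with cells `0, 1, 2, …`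
(a left move at cell `0` leaves the head where it is). -/
def Move.apply : Move → ℕ → ℕ
  | .left, i => i - 1
  | .stay, i => i
  | .right, i => i + 1

/-- The cell of the read-only input tape `⊢ x₁ x₂ ⋯ xₙ ⊣` at position `i`: the left end marker is
at position `0`, the letters are at positions `1, …, n`, the right end marker at `n + 1`. -/
def readInput {S : Type*} (x : List S) : ℕ → InputCell S
  | 0 => .leftEnd
  | i + 1 => match x[i]? with
    | some s => .letter s
    | none => .rightEnd

/-- A nondeterministic Turing machine with a two-way read-only input tape over the alphabet `S`
and finitely many read-write work tapes, each one-way infinite.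
`trans q s g q' m g' d` says that in state `q`, scanning `s` on the input tape and `g t` on work
tape `t`, the machine may go to state `q'`, move its input head by `m`, write `g' t` on work
tape `t` and then move the head of that tape by `d t`. -/
structure NTM (S : Type*) where
  /-- the finite set of states -/
  State : Type
  finite_state : Finite State
  /-- the finite work alphabet -/
  Sym : Type
  finite_sym : Finite Sym
  /-- the blank symbol of the work alphabet -/
  blank : Sym
  /-- the number of work tapes -/
  tapes : ℕ
  start : State
  accept : State
  trans : State → InputCell S → (Fin tapes → Sym) →
    State → Move → (Fin tapes → Sym) → (Fin tapes → Move) → Prop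

namespace NTM

variable {S : Type*}

/-- A configuration: state, position of the input head, positions of the work heads and contents
of the work tapes. -/
structure Cfg (M : NTM S) where
  state : M.State
  inHead : ℕ
  head : Fin M.tapes → ℕ
  tape : Fin M.tapes → ℕ → M.Sym

/-- The initial configuration: start state, all heads at position `0`, blank work tapes. -/
def init (M : NTM S) : M.Cfg where
  state := M.start
  inHead := 0
  head := fun _ => 0
  tape := fun _ _ => M.blank

/-- One computation step on input `x`. The input head never leaves the positions
`0, …, |x| + 1`: a move beyond an end marker leaves it where it is. -/
def Step (M : NTM S) (x : List S) (c c' : M.Cfg) : Prop :=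
  ∃ (q : M.State) (m : Move) (g : Fin M.tapes → M.Sym) (d : Fin M.tapes → Move),
    M.trans c.state (readInput x c.inHead) (fun t => c.tape t (c.head t)) q m g d ∧
    c' = { state := q
           inHead := min (m.apply c.inHead) (x.length + 1)
           head := fun t => (d t).apply (c.head t)
           tape := fun t => Function.update (c.tape t) (c.head t) (g t) }

/-- The configuration `c` occurs in some computation of `M` on input `x`. -/
def Reachable (M : NTM S) (x : List S) (c : M.Cfg) : Prop :=
  Relation.ReflTransGen (M.Step x) M.init c

/-- Some computation of `M` on input `x` reaches the accepting state. -/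
def Accepts (M : NTM S) (x : List S) : Prop :=
  ∃ c : M.Cfg, M.Reachable x c ∧ c.state = M.accept

/-- On every input, every computation of `M` visits only the first `O(log n)` cells of each work
tape, where `n` is the length of the input (`+ 1` takes care of `n ≤ 1`). -/
def IsLogSpace (M : NTM S) : Prop :=
  ∃ C : ℕ, ∀ (x : List S) (c : M.Cfg), M.Reachable x c →
    ∀ t : Fin M.tapes, c.head t < C * (Nat.log 2 x.length + 1)

end NTM

/-- The complexity class **NL**: the language `X` is accepted by a nondeterministic
logarithmic-space machine. -/
def InNL {S : Type*} (X : Language S) : Prop :=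
  ∃ M : NTM S, M.IsLogSpace ∧ ∀ x : List S, x ∈ X ↔ M.Accepts x

/-! ### Regular realizability, easy languages, substitutions -/

open Classical in
/-- The binary word describing an NFA over a finite alphabet `A` with states `0, …, n - 1`:
the number `n` of states in unary followed by `0`, then the characteristic vectors of the set of
initial states and of the set of accepting states, and then, for every state `q` and every letter
`a` (in a fixed enumeration of the alphabet), the characteristic vector of the set of states `q'`
with a transition `q → q'` labelled by `a`. -/
noncomputable def encodeNFA {A : Type*} [Finite A] {n : ℕ} (M : NFA A (Fin n)) : List Bool :=
  List.replicate n true ++ [false] ++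
  (List.finRange n).map (fun q => decide (q ∈ M.start)) ++
  (List.finRange n).map (fun q => decide (q ∈ M.accept)) ++
  (List.finRange n).flatMap (fun q =>
    (List.finRange (Nat.card A)).flatMap (fun i =>
      (List.finRange n).map (fun q' => decide (q' ∈ M.step q ((Finite.equivFin A).symm i)))))

/-- The regular realizability problem `NRR(F)` with filter `F`: given (the description of) an NFA,
does the language that it recognizes have a word in common with `F`? -/
def NRR {A : Type*} [Finite A] (F : Language A) : Language Bool :=
  {w | ∃ (n : ℕ) (M : NFA A (Fin n)), w = encodeNFA M ∧ ∃ u : List A, u ∈ M.accepts ∧ u ∈ F}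

/-- A context-free language `L` over a finite alphabet is *easy* if `NRR(L)` is in **NL**. -/
def IsEasy {A : Type*} [Finite A] (L : Language A) : Prop :=
  L.IsContextFree ∧ InNL (NRR L)

/-- The value `σ(w) = L_{a₁} L_{a₂} ⋯ L_{aₖ}` on the word `w = a₁ a₂ ⋯ aₖ` of the substitution
`a ↦ L_a`; the product is concatenation, and the empty product is `{ε}`. -/
def substWord {A B : Type*} (σ : A → Language B) (w : List A) : Language B :=
  (w.map σ).prod

/-- The image `σ(L) = ⋃_{w ∈ L} σ(w)` of a language under the substitution `a ↦ L_a`. -/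
def substLanguage {A B : Type*} (σ : A → Language B) (L : Language A) : Language B :=
  {u | ∃ w ∈ L, u ∈ substWord σ w}

end RegReal

/-! ### Regular expressions denote regular languages -/

namespace Language

open scoped Computability

variable {α : Type*}

/-! Context-freeness is the classical construction: in a grammar for `L`, each terminal `a` is
replaced by the start symbol of a grammar for `σ a` (`language_substGrammar`).

For the realizability problem, let an automaton over `B` be given. Keep its states and accepting
sets, and draw an edge `q → q'` labelled `a` whenever some word of `σ a` leads from `q` to `q'`. The
result, `outerNFA`, is an automaton over `A`, and it meets `L` iff the given automaton meets
`substLanguage σ L` (`exists_accepts_subst`). Whether an edge is present is an instance of `NRR (σ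
a)`: make `q` the only initial and `q'` the only accepting state. So one nondeterministic
logarithmic-space machine has to run on an input whose bits are themselves decided in **NL**. Both
values of a bit must be certified, so closure of **NL** under complement is indispensable.

The composition is carried out in logic. `NLDef d` consists of predicates on tuples of numbers below
a polynomial bound, built from successor, input letters, conjunction, disjunction, existential
quantifiers and transitive closure. Four facts carry the argument.

`inNL_of_nlDef`: definable languages are in **NL**. A predicate is turned into a nondeterministic
register program, that is, a regular expression over elementary instructions. A finite automaton for
this expression drives a machine whose memory stores all registers in parallel digit tracks and
which executes an instruction in one sweep over the memory.

`NLDef.not`: definable predicates are closed under negation. This is the Immerman–Szelepcsényi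
theorem: knowing how many vertices lie within distance `i` of the source, one can certify that a
vertex is not within distance `i + 1`, and so count the next ball (`not_reach_iff`).

`exists_nlDef_accepts`: if the letters of a word are definable and the word is short enough, then
acceptance of that word by a fixed logarithmic-space machine is definable. Tape contents are coded
as pairs of numbers (two stacks), and acceptance is reachability between register tuples.

`defWord_encodeNFA`: the encoding of an automaton with definable data is a word with definable
letters.

The third fact is used twice: for the machines of `σ a`, which makes the edges of `outerNFA`
definable, and then for the machine of `L` on the encoding of `outerNFA`. -/

theorem isRegular_of_finite_closed {L : Language α} {F : Set (Language α)} (hF : F.Finite)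
    (hL : L ∈ F) (hd : ∀ X ∈ F, ∀ a, X.leftQuotient [a] ∈ F) : L.IsRegular := by
  refine IsRegular.of_finite_range_leftQuotient (hF.subset ?_)
  rintro _ ⟨x, rfl⟩
  induction x using List.reverseRecOn with
  | nil => simpa using hL
  | append_singleton x a ih => rw [leftQuotient_append]; exact hd _ ih a

theorem IsRegular.exists_finite_closed {L : Language α} (h : L.IsRegular) :
    ∃ F : Set (Language α), F.Finite ∧ L ∈ F ∧ ∀ X ∈ F, ∀ a, X.leftQuotient [a] ∈ F := by
  refine ⟨_, h.finite_range_leftQuotient, ⟨[], by simp⟩, ?_⟩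
  rintro _ ⟨x, rfl⟩ a
  exact ⟨x ++ [a], leftQuotient_append _ _ _⟩

theorem mem_deriv {L : Language α} {a : α} {w : List α} :
    w ∈ L.leftQuotient [a] ↔ a :: w ∈ L := Iff.rfl

theorem cons_mem_mul {L M : Language α} {a : α} {w : List α} :
    a :: w ∈ L * M ↔ w ∈ L.leftQuotient [a] * M ∨ [] ∈ L ∧ w ∈ M.leftQuotient [a] := by
  simp only [mem_mul, mem_deriv]
  constructor
  · rintro ⟨u, hu, v, hv, h⟩
    cases u with
    | nil => right; exact ⟨hu, by simpa using h ▸ hv⟩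
    | cons b u =>
      obtain ⟨rfl, rfl⟩ := by simpa using h
      exact Or.inl ⟨u, hu, v, hv, rfl⟩
  · rintro (⟨u, hu, v, hv, rfl⟩ | ⟨h1, h2⟩)
    · exact ⟨_, hu, v, hv, rfl⟩
    · exact ⟨[], h1, _, h2, rfl⟩

/-- Empty factors may be dropped from a factorization, so the letter `a` begins the first factor. -/
theorem cons_mem_kstar {L : Language α} {a : α} {w : List α} :
    a :: w ∈ L∗ ↔ w ∈ L.leftQuotient [a] * L∗ := by
  constructor
  · intro h
    rw [mem_kstar_iff_exists_nonempty] at h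
    obtain ⟨S, hS, hne⟩ := h
    cases S with
    | nil => simp at hS
    | cons s S =>
      obtain ⟨h1, h2⟩ := hne s (by simp)
      cases s with
      | nil => exact absurd rfl h2
      | cons b s =>
        obtain ⟨rfl, rfl⟩ := by simpa using hS
        exact ⟨s, h1, _, join_mem_kstar fun y hy => (hne y (by simp [hy])).1, rfl⟩
  · rintro ⟨u, hu, v, hv, rfl⟩
    rw [← one_add_self_mul_kstar_eq_kstar]
    exact Or.inr ⟨_, hu, v, hv, rfl⟩

theorem mem_sSup' {S : Set (Language α)} {w : List α} : w ∈ sSup S ↔ ∃ X ∈ S, w ∈ X := Set.mem_sUnion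

/-- Every left quotient of `L * M` has the form `X * M` plus a union of quotients of `M`, where `X`
is a quotient of `L`. The union collects the quotients of `M` started whenever the first factor
could have ended. Only finitely many such pairs exist. -/
theorem IsRegular.mul {L M : Language α} (hL : L.IsRegular) (hM : M.IsRegular) :
    (L * M).IsRegular := by
  obtain ⟨F, hF, hLF, hFd⟩ := hL.exists_finite_closed
  obtain ⟨G, hG, hMG, hGd⟩ := hM.exists_finite_closed
  refine isRegular_of_finite_closed
    (F := (fun p : Language α × Set (Language α) => p.1 * M + sSup p.2) '' (F ×ˢ 𝒫 G))
    ((hF.prod hG.finite_subsets).image _) ⟨(L, ∅), ⟨hLF, by simp⟩, ?_⟩ ?_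
  · ext w; simp
  · rintro _ ⟨⟨X, S⟩, ⟨hX, hS⟩, rfl⟩ a
    refine ⟨(X.leftQuotient [a], {Y | ([] ∈ X ∧ Y = M.leftQuotient [a]) ∨
      ∃ Z ∈ S, Y = Z.leftQuotient [a]}), ⟨hFd X hX a, ?_⟩, ?_⟩
    · rintro Y (⟨-, rfl⟩ | ⟨Z, hZ, rfl⟩)
      exacts [hGd _ hMG a, hGd _ (hS hZ) a]
    · ext w
      simp only [mem_deriv, mem_add, cons_mem_mul, mem_sSup', Set.mem_ofPred_eq]
      constructor
      · rintro (h | ⟨_, (⟨h1, rfl⟩ | ⟨Z, hZ, rfl⟩), h⟩)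
        exacts [.inl (.inl h), .inl (.inr ⟨h1, h⟩), .inr ⟨Z, hZ, h⟩]
      · rintro ((h | h) | ⟨Z, hZ, h⟩)
        exacts [.inl h, .inr ⟨_, .inl ⟨h.1, rfl⟩, h.2⟩, .inr ⟨_, .inr ⟨Z, hZ, rfl⟩, h⟩]

/-- By `key`, a quotient of a member of the finite family `G` by one letter is a union of members of
`G`; hence the finitely many unions of subfamilies of `G` are closed under quotients. -/
theorem IsRegular.kstar {L : Language α} (hL : L.IsRegular) : (L∗).IsRegular := by
  obtain ⟨F, hF, hLF, hFd⟩ := hL.exists_finite_closed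
  set G : Set (Language α) := insert (L∗) ((fun X => X * L∗) '' F) with hG
  have key : ∀ Y ∈ G, ∀ a, ∃ S ⊆ G, ∀ w, a :: w ∈ Y ↔ ∃ Z ∈ S, w ∈ Z := by
    rintro Y (rfl | ⟨X, hX, rfl⟩) a
    · exact ⟨{L.leftQuotient [a] * L∗}, by
        rintro _ rfl; exact .inr ⟨_, hFd _ hLF a, rfl⟩, fun w => by simp [cons_mem_kstar]⟩
    · refine ⟨{Z | Z = X.leftQuotient [a] * L∗ ∨ ([] ∈ X ∧ Z = L.leftQuotient [a] * L∗)}, ?_, ?_⟩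
      · rintro _ (rfl | ⟨-, rfl⟩)
        exacts [.inr ⟨_, hFd _ hX a, rfl⟩, .inr ⟨_, hFd _ hLF a, rfl⟩]
      · intro w
        simp only [cons_mem_mul, mem_deriv, cons_mem_kstar, Set.mem_ofPred_eq]
        constructor
        · rintro (h | ⟨h1, h2⟩)
          exacts [⟨_, .inl rfl, h⟩, ⟨_, .inr ⟨h1, rfl⟩, h2⟩]
        · rintro ⟨_, (rfl | ⟨h1, rfl⟩), h⟩
          exacts [.inl h, .inr ⟨h1, h⟩]
  refine isRegular_of_finite_closed (F := sSup '' 𝒫 G)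
    ((((hF.image _).insert _).finite_subsets).image _) ⟨{L∗}, by simp [hG], by simp⟩ ?_
  rintro _ ⟨S, hS, rfl⟩ a
  choose! T hT hT' using key
  refine ⟨⋃ Y ∈ S, T Y a, Set.iUnion₂_subset fun Y hY => hT Y (hS hY) a, ?_⟩
  ext w
  simp only [mem_deriv, mem_sSup', Set.mem_iUnion]
  constructor
  · rintro ⟨Z, ⟨Y, hY, hZ⟩, h⟩
    exact ⟨Y, hY, (hT' Y (hS hY) a w).2 ⟨Z, hZ, h⟩⟩
  · rintro ⟨Y, hY, h⟩
    obtain ⟨Z, hZ, h⟩ := (hT' Y (hS hY) a w).1 h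
    exact ⟨Z, ⟨Y, hY, hZ⟩, h⟩

theorem isRegular_zero : (0 : Language α).IsRegular :=
  isRegular_of_finite_closed (Set.finite_singleton 0) rfl
    (by rintro _ rfl a; ext w; exact Iff.rfl)

theorem isRegular_one : (1 : Language α).IsRegular :=
  isRegular_of_finite_closed (F := {0, 1}) (by simp) (by simp) (by
    rintro _ (rfl | rfl) a
    · left; ext w; exact Iff.rfl
    · left; ext w; simp [mem_one, notMem_zero])

theorem isRegular_singleton (b : α) : ({[b]} : Language α).IsRegular :=
  isRegular_of_finite_closed (F := {0, 1, {[b]}}) (by simp) (by simp) (by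
    rintro _ (rfl | rfl | rfl) a
    · left; ext w; exact Iff.rfl
    · left; ext w; simp [mem_one, notMem_zero]
    · by_cases h : a = b
      · right; left; ext w; simp only [mem_deriv, mem_one, h]
        exact ⟨fun h => by simpa using Set.mem_singleton_iff.1 h, fun h => by subst h; rfl⟩
      · left; ext w; simp only [mem_deriv, notMem_zero, iff_false]
        exact fun h' => h (by simpa using congrArg List.head? (Set.mem_singleton_iff.1 h')))

end Language

theorem RegularExpression.isRegular_matches' {α : Type*} (p : RegularExpression α) :
    p.matches'.IsRegular := by
  induction p with
  | zero => exact Language.isRegular_zero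
  | epsilon => exact Language.isRegular_one
  | char a => exact Language.isRegular_singleton a
  | plus p q hp hq => exact hp.add hq
  | comp p q hp hq => exact hp.mul hq
  | star p hp => exact hp.kstar

/-! ### Sweep machines -/

namespace RegReal

instance : Finite Move :=
  Finite.of_injective (β := Fin 3) (fun m => match m with | .left => 0 | .stay => 1 | .right => 2)
    (by intro a b; cases a <;> cases b <;> simp)

instance {S : Type*} [Finite S] : Finite (InputCell S) :=
  Finite.of_injective (β := Option (Option S))
    (fun m => match m with | .leftEnd => none | .rightEnd => some none | .letter s => some (some s))
    (by intro a b; cases a <;> cases b <;> simp)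

/-- `Sweep R k l k' l'`: a finite-state transducer with transitions `R` passes over the word `l`
from left to right, changing its state from `k` to `k'` and rewriting `l` to `l'`. -/
inductive Sweep {K Γ : Type*} (R : K → Γ → K → Γ → Prop) : K → List Γ → K → List Γ → Prop
  | nil (k : K) : Sweep R k [] k []
  | cons {k k' k'' : K} {a a' : Γ} {l l' : List Γ} (h : R k a k' a') (hs : Sweep R k' l k'' l') :
      Sweep R k (a :: l) k'' (a' :: l')

theorem Sweep.length_eq {K Γ : Type*} {R : K → Γ → K → Γ → Prop} {k k' : K} {l l' : List Γ}
    (h : Sweep R k l k' l') : l'.length = l.length := by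
  induction h with
  | nil => rfl
  | cons _ _ ih => simp [ih]

theorem Sweep.snoc {K Γ : Type*} {R : K → Γ → K → Γ → Prop} {k k' k'' : K} {l l' : List Γ}
    {a a' : Γ} (h : Sweep R k l k' l') (ha : R k' a k'' a') :
    Sweep R k (l ++ [a]) k'' (l' ++ [a']) := by
  induction h with
  | nil => exact .cons ha (.nil _)
  | cons h _ ih => exact .cons h (ih ha)

/-- A machine that works on a word (its memory) by sweeping over the whole word with a finite
transducer; at the end of every sweep it reads the input letter below the input head, moves the
input head and possibly appends one cell to the memory. -/
structure SweepMachine (S : Type*) where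
  K : Type
  Γ : Type
  finite_K : Finite K
  finite_Γ : Finite Γ
  start : K
  accept : K
  start_ne : start ≠ accept
  pass : K → Γ → K → Γ → Prop
  turn : K → InputCell S → K → Move → Option Γ → Prop

namespace SweepMachine

variable {S : Type*} (P : SweepMachine S)

/-- One full sweep; a configuration consists of the state, the position of the input head and the
memory word. -/
def Step (x : List S) (c c' : P.K × ℕ × List P.Γ) : Prop :=
  ∃ k o m a, Sweep P.pass c.1 c.2.2 k o ∧ P.turn k (readInput x c.2.1) c'.1 m a ∧
    c'.2.1 = min (m.apply c.2.1) (x.length + 1) ∧ c'.2.2 = o ++ a.toList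

def Reach (x : List S) (c : P.K × ℕ × List P.Γ) : Prop :=
  Relation.ReflTransGen (P.Step x) (P.start, 0, []) c

/-- The transitions of a Turing machine simulating a sweep machine: state `some (.inl k)` sweeps to
the right, state `some (.inr k)` rewinds. The symbol `some none` marks the left end. -/
inductive Trans : Option (P.K ⊕ P.K) → InputCell S → (Fin 1 → Option (Option P.Γ)) →
    Option (P.K ⊕ P.K) → Move → (Fin 1 → Option (Option P.Γ)) → (Fin 1 → Move) → Prop
  | init (s g) : Trans none s g (some (.inl P.start)) .stay (fun _ => some none) (fun _ => .right)
  | pass {k k' a a'} (s) (h : P.pass k a k' a') : Trans (some (.inl k)) s (fun _ => some (some a))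
      (some (.inl k')) .stay (fun _ => some (some a')) (fun _ => .right)
  | turn {k s k' m a} (h : P.turn k s k' m a) : Trans (some (.inl k)) s (fun _ => none)
      (some (.inr k')) m (fun _ => a.map some) (fun _ => .stay)
  | back (k s) {a} (h : a ≠ some none) :
      Trans (some (.inr k)) s (fun _ => a) (some (.inr k)) .stay (fun _ => a) (fun _ => .left)
  | restart (k s) : Trans (some (.inr k)) s (fun _ => some none) (some (.inl k)) .stay
      (fun _ => some none) (fun _ => .right)

/-- Acceptance is recognized in the rewinding state entered by a turn, so the accepting state of the
sweep machine must be reached by at least one sweep; `start_ne` guarantees this. -/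
def toNTM : NTM S where
  State := Option (P.K ⊕ P.K)
  finite_state := by have := P.finite_K; infer_instance
  Sym := Option (Option P.Γ)
  finite_sym := by have := P.finite_Γ; infer_instance
  blank := none
  tapes := 1
  start := none
  accept := some (.inr P.accept)
  trans := P.Trans

/-- The configuration with tape contents `L`. -/
def cfg (q : Option (P.K ⊕ P.K)) (h j : ℕ) (L : List (Option P.Γ)) : P.toNTM.Cfg where
  state := q
  inHead := h
  head := fun _ => j
  tape := fun _ i => L[i]?

/-- The tape holding the memory word `l`. -/
def memo (l : List P.Γ) : List (Option P.Γ) := none :: l.map some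

theorem step_cfg {x : List S} {q q' : Option (P.K ⊕ P.K)} {h j : ℕ} {L L' : List (Option P.Γ)}
    {m d : Move} {a : Option (Option P.Γ)}
    (ht : P.Trans q (readInput x h) (fun _ => L[j]?) q' m (fun _ => a) (fun _ => d))
    (hL : Function.update (fun i => L[i]?) j a = fun i => L'[i]?) :
    P.toNTM.Step x (P.cfg q h j L) (P.cfg q' (min (m.apply h) (x.length + 1)) (d.apply j) L') :=
  ⟨q', m, fun _ => a, fun _ => d, ht, by simp only [cfg, ← hL]; rfl⟩

theorem eq_cfg {c : P.toNTM.Cfg} {q : Option (P.K ⊕ P.K)} {h j : ℕ} {L : List (Option P.Γ)}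
    (h1 : c.state = q) (h2 : c.inHead = h) (h3 : ∀ t, c.head t = j)
    (h4 : ∀ t, c.tape t = fun i => L[i]?) : c = P.cfg q h j L := by
  cases c
  simp only at h1 h2 h3 h4
  subst h1 h2
  obtain rfl := funext h3
  obtain rfl := funext h4
  rfl

theorem update_append {α : Type*} (l₁ l₂ : List α) (a a' : α) :
    Function.update (fun i => (l₁ ++ a :: l₂)[i]?) l₁.length (some a') =
      fun i => (l₁ ++ a' :: l₂)[i]? := by
  funext i
  rcases lt_trichotomy i l₁.length with h | rfl | h
  · simp [Function.update_of_ne h.ne, List.getElem?_append_left h]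
  · simp
  · obtain ⟨k, rfl⟩ := Nat.exists_eq_add_of_lt h
    rw [Function.update_of_ne h.ne']
    simp [List.getElem?_append_right, add_assoc]

/-- The blank is `none`, the value read behind the list. Writing `none` there changes nothing, so an
optional append is a single uniform write. -/
theorem update_end {α : Type*} (l : List α) (a : Option α) :
    Function.update (fun i => l[i]?) l.length a = fun i => (l ++ a.toList)[i]? := by
  funext i
  rcases lt_trichotomy i l.length with h | rfl | h
  · simp [Function.update_of_ne h.ne, List.getElem?_append_left h]
  · cases a <;> simp
  · rw [Function.update_of_ne h.ne', List.getElem?_eq_none h.le, List.getElem?_eq_none]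
    cases a <;> simp <;> omega

theorem update_same {α : Type*} (l : List α) (j : ℕ) :
    Function.update (fun i => l[i]?) j l[j]? = fun i => l[i]? :=
  Function.update_eq_self j _

theorem memo_append (l₁ l₂ : List P.Γ) : P.memo (l₁ ++ l₂) = P.memo l₁ ++ l₂.map some := by
  simp [memo]

theorem length_memo (l : List P.Γ) : (P.memo l).length = l.length + 1 := by simp [memo]

theorem memo_getElem? (l₁ l₂ : List P.Γ) (a : P.Γ) :
    (P.memo (l₁ ++ a :: l₂))[l₁.length + 1]? = some (some a) := by
  simp [memo]

theorem update_memo (l₁ l₂ : List P.Γ) (a a' : P.Γ) :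
    Function.update (fun i => (P.memo (l₁ ++ a :: l₂))[i]?) (l₁.length + 1) (some (some a')) =
      fun i => (P.memo (l₁ ++ a' :: l₂))[i]? := by
  have := update_append (P.memo l₁) (l₂.map some) (some a) (some a')
  simpa [memo_append, length_memo] using this

theorem update_memo_end (l : List P.Γ) (a : Option P.Γ) :
    Function.update (fun i => (P.memo l)[i]?) (l.length + 1) (a.map some) =
      fun i => (P.memo (l ++ a.toList))[i]? := by
  have := update_end (P.memo l) (a.map some)
  rw [length_memo] at this
  rw [this]
  cases a <;> simp [memo]

theorem init_eq : P.toNTM.init = P.cfg none 0 0 [] := by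
  simp [NTM.init, cfg, toNTM]

theorem min_stay {x : List S} {h : ℕ} (hh : h ≤ x.length + 1) :
    min (Move.stay.apply h) (x.length + 1) = h := min_eq_left hh

theorem reach_fwd {x : List S} {h : ℕ} (hh : h ≤ x.length + 1) {k k' : P.K} {l l' : List P.Γ}
    (hs : Sweep P.pass k l k' l') (p : List P.Γ) :
    Relation.ReflTransGen (P.toNTM.Step x) (P.cfg (some (.inl k)) h (p.length + 1) (P.memo (p ++ l)))
      (P.cfg (some (.inl k')) h ((p ++ l').length + 1) (P.memo (p ++ l'))) := by
  induction hs generalizing p with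
  | nil => simpa using Relation.ReflTransGen.refl
  | @cons k k₁ k₂ a a' l l' hr _ ih =>
    have := ih (p ++ [a'])
    simp only [List.append_assoc, List.singleton_append] at this
    refine .head ?_ this
    have := P.step_cfg (x := x) (h := h) (j := p.length + 1) (L := P.memo (p ++ a :: l))
      (by rw [memo_getElem?]; exact Trans.pass _ hr) (P.update_memo _ _ _ _)
    rw [min_stay hh] at this
    simpa [Move.apply] using this

/-- The mark `some none` occurs only in cell `0`, so the leftward run cannot stop early, wherever it
begins. -/
theorem reach_rew {x : List S} {h : ℕ} (hh : h ≤ x.length + 1) (k : P.K) (l : List P.Γ) (j : ℕ) :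
    Relation.ReflTransGen (P.toNTM.Step x) (P.cfg (some (.inr k)) h j (P.memo l))
      (P.cfg (some (.inl k)) h 1 (P.memo l)) := by
  induction j with
  | zero =>
    have := P.step_cfg (x := x) (h := h) (j := 0) (L := P.memo l)
      (Trans.restart k _) (P.memo l |> update_same <| 0)
    rw [min_stay hh] at this
    exact .single this
  | succ j ih =>
    refine .head ?_ ih
    have := P.step_cfg (x := x) (h := h) (j := j + 1) (L := P.memo l)
      (Trans.back k _ (by
        intro h
        simp [memo] at h))
      (update_same _ _)
    rw [min_stay hh] at this
    exact this

theorem head_le {x : List S} {c : P.K × ℕ × List P.Γ} (hc : P.Reach x c) :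
    c.2.1 ≤ x.length + 1 := by
  induction hc with
  | refl => simp
  | tail _ h _ =>
    obtain ⟨_, _, _, _, _, _, h, _⟩ := h
    rw [h]; exact min_le_right _ _

theorem reach_step {x : List S} {c c' : P.K × ℕ × List P.Γ} (hc : c.2.1 ≤ x.length + 1)
    (h : P.Step x c c') : ∃ j,
    Relation.ReflTransGen (P.toNTM.Step x) (P.cfg (some (.inl c.1)) c.2.1 1 (P.memo c.2.2))
      (P.cfg (some (.inr c'.1)) c'.2.1 j (P.memo c'.2.2)) := by
  obtain ⟨k, o, m, a, h1, h2, h3, h4⟩ := h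
  have := P.reach_fwd hc h1 []
  refine ⟨o.length + 1, this.tail ?_⟩
  have := P.step_cfg (x := x) (h := c.2.1) (j := o.length + 1) (L := P.memo o)
    (q := some (.inl k)) (by
      rw [List.getElem?_eq_none (P.length_memo o).le]
      exact Trans.turn h2) (P.update_memo_end o a)
  rw [← h3, ← h4] at this
  exact this

theorem reach_toNTM {x : List S} {c : P.K × ℕ × List P.Γ} (hc : P.Reach x c) :
    P.toNTM.Reachable x (P.cfg (some (.inl c.1)) c.2.1 1 (P.memo c.2.2)) := by
  induction hc with
  | refl =>
    rw [NTM.Reachable, init_eq]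
    exact .single (P.step_cfg (L' := P.memo []) (Trans.init _ _) (update_end [] (some none)))
  | tail h1 h2 ih =>
    obtain ⟨j, hj⟩ := P.reach_step (P.head_le h1) h2
    exact (ih.trans hj).trans (P.reach_rew (P.head_le (h1.tail h2)) _ _ _)

/-- The configurations of the simulating Turing machine. -/
def Inv (x : List S) (c : P.toNTM.Cfg) : Prop :=
  c = P.toNTM.init ∨
  (∃ k₀ h k l₁ l₂ o, P.Reach x (k₀, h, l₁ ++ l₂) ∧ Sweep P.pass k₀ l₁ k o ∧
    c = P.cfg (some (.inl k)) h (o.length + 1) (P.memo (o ++ l₂))) ∨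
  ∃ k h l j, P.Reach x (k, h, l) ∧ j ≤ l.length + 1 ∧ c = P.cfg (some (.inr k)) h j (P.memo l)

/-- The scanned symbol determines the phase: a memory symbol continues the sweep, the blank behind
the memory completes one step of the sweep machine, and the mark ends the rewinding. All reachable
configurations must be covered, since the space bound speaks about every computation. -/
theorem inv_step {x : List S} {c c' : P.toNTM.Cfg} (hc : P.Inv x c) (h : P.toNTM.Step x c c') :
    P.Inv x c' := by
  obtain ⟨q, m, g, d, ht, rfl⟩ := h
  change P.Trans _ _ _ _ _ _ _ at ht
  rcases hc with rfl | ⟨k₀, h, k, l₁, l₂, o, hr, hs, rfl⟩ | ⟨k, h, l, j, hr, hj, rfl⟩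
  · generalize hc : (fun t => P.toNTM.init.tape t (P.toNTM.init.head t)) = g₀ at ht
    change P.Trans none _ _ _ _ _ _ at ht
    cases ht
    right; left
    refine ⟨P.start, 0, P.start, [], [], [], .refl, .nil _, ?_⟩
    exact P.eq_cfg rfl (by simp [Move.apply, NTM.init]) (fun _ => by simp [Move.apply, NTM.init])
      fun _ => update_end ([] : List (Option P.Γ)) (some none)
  · have hh := P.head_le hr
    generalize hc : (fun t => (P.cfg (some (.inl k)) h (o.length + 1) (P.memo (o ++ l₂))).tape t
      ((P.cfg (some (.inl k)) h (o.length + 1) (P.memo (o ++ l₂))).head t)) = g₀ at ht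
    change P.Trans (some (.inl k)) (readInput x h) _ _ _ _ _ at ht
    have hc : (P.memo (o ++ l₂))[o.length + 1]? = g₀ (0 : Fin 1) := congrFun hc (0 : Fin 1)
    cases ht with
    | @pass _ k' a a' _ hp =>
      right; left
      cases l₂ with
      | nil => simp [memo] at hc
      | cons b l₂ =>
        obtain rfl : b = a := by rw [memo_getElem?] at hc; simpa using hc
        refine ⟨k₀, h, k', l₁ ++ [b], l₂, o ++ [a'], by simpa using hr, hs.snoc hp, ?_⟩
        have := P.update_memo o l₂ b a'
        exact P.eq_cfg rfl (min_eq_left hh) (fun _ => by simp [cfg, Move.apply])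
          fun _ => by rw [List.append_assoc]; exact this
    | @turn _ _ k' m a hp =>
      right; right
      cases l₂ with
      | cons b l₂ => rw [memo_getElem?] at hc; simp at hc
      | nil =>
        refine ⟨k', _, o ++ a.toList, o.length + 1, hr.tail
          ⟨k, o, m, a, by simpa using hs, hp, rfl, rfl⟩, by simp, ?_⟩
        have := P.update_memo_end o a
        exact P.eq_cfg rfl rfl (fun _ => rfl) fun _ => by simp only [List.append_nil]; exact this
  · have hh := P.head_le hr
    generalize hc : (fun t => (P.cfg (some (.inr k)) h j (P.memo l)).tape t
      ((P.cfg (some (.inr k)) h j (P.memo l)).head t)) = g₀ at ht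
    change P.Trans (some (.inr k)) (readInput x h) _ _ _ _ _ at ht
    have hc : (P.memo l)[j]? = g₀ (0 : Fin 1) := congrFun hc (0 : Fin 1)
    have hu := update_same (P.memo l) j
    rw [hc] at hu
    cases ht with
    | back _ _ ha =>
      right; right
      refine ⟨k, h, l, j - 1, hr, by omega, ?_⟩
      exact P.eq_cfg rfl (min_eq_left hh) (fun _ => rfl) fun _ => hu
    | restart _ _ =>
      right; left
      refine ⟨k, h, k, [], l, [], hr, .nil _, ?_⟩
      have : j = 0 := by
        cases j with
        | zero => rfl
        | succ j => simp [memo] at hc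
      subst this
      exact P.eq_cfg rfl (min_eq_left hh) (fun _ => by simp [cfg, Move.apply]) fun _ => hu

theorem inv_of_reachable {x : List S} {c : P.toNTM.Cfg} (hc : P.toNTM.Reachable x c) :
    P.Inv x c := by
  induction hc with
  | refl => exact .inl rfl
  | tail _ h ih => exact P.inv_step ih h

theorem accepts_toNTM (x : List S) :
    P.toNTM.Accepts x ↔ ∃ h l, P.Reach x (P.accept, h, l) := by
  constructor
  · rintro ⟨c, hc, hq⟩
    rcases P.inv_of_reachable hc with rfl | ⟨k₀, h, k, l₁, l₂, o, -, -, rfl⟩ | ⟨k, h, l, j, hr, -, rfl⟩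
    · simp [NTM.init, toNTM] at hq
    · simp [cfg, toNTM] at hq
    · obtain rfl : k = P.accept := by simpa [cfg, toNTM] using hq
      exact ⟨h, l, hr⟩
  · rintro ⟨h, l, hr⟩
    obtain h0 | ⟨c, h1, h2⟩ := Relation.ReflTransGen.cases_tail hr
    -- An accepting run of length zero would identify the start and accepting states; otherwise the
    -- last sweep ends in the accepting rewinding state.
    · exact absurd (congrArg Prod.fst h0).symm P.start_ne
    · obtain ⟨j, hj⟩ := P.reach_step (P.head_le h1) h2
      exact ⟨_, (P.reach_toNTM h1).trans hj, rfl⟩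

theorem inNL_of_length_le (C : ℕ)
    (hC : ∀ x c, P.Reach x c → c.2.2.length ≤ C * (Nat.log 2 x.length + 1)) :
    InNL {x : List S | ∃ h l, P.Reach x (P.accept, h, l)} := by
  -- Besides the memory, the head visits the mark and the blank cell behind the memory.
  refine ⟨P.toNTM, ⟨C + 2, fun x c hc t => ?_⟩, fun x => (P.accepts_toNTM x).symm⟩
  rcases P.inv_of_reachable hc with rfl | ⟨k₀, h, k, l₁, l₂, o, hr, hs, rfl⟩ | ⟨k, h, l, j, hr, hj, rfl⟩
  · simp [NTM.init]
  · have := hC _ _ hr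
    have h2 := hs.length_eq
    simp only [cfg, List.length_append] at *
    nlinarith
  · have := hC _ _ hr
    simp only [cfg] at *
    nlinarith

end SweepMachine

end RegReal

/-! ### Register programs -/

namespace RegReal

/-- The registers of a program running on input `x` hold numbers below `bound d x`. -/
def bound (d : ℕ) (x : List Bool) : ℕ := (d + 2) ^ (x.length + 2).size

/-- The universe of register values. -/
abbrev U (d : ℕ) (x : List Bool) : Type := Fin (bound d x)

theorem bound_pos (d : ℕ) (x : List Bool) : 0 < bound d x := by unfold bound; positivity

instance (d : ℕ) (x : List Bool) : NeZero (bound d x) := ⟨(bound_pos d x).ne'⟩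

/-- Elementary instructions: tests on registers, guessing a register, moving the input head and
testing the letter below it. -/
inductive Atom (ρ : Type) : Type
  | zero (i : ρ)
  | top (i : ρ)
  | eq (i j : ρ)
  | succ (i j : ρ)
  | guess (i : ρ)
  | move (m : Move)
  | read (s : InputCell Bool)

instance {ρ : Type} [Finite ρ] : Finite (Atom ρ) :=
  Finite.of_injective
    (β := Fin 7 × Option ρ × Option ρ × Option Move × Option (InputCell Bool))
    (fun a => match a with
      | .zero i => (0, some i, none, none, none)
      | .top i => (1, some i, none, none, none)
      | .eq i j => (2, some i, some j, none, none)
      | .succ i j => (3, some i, some j, none, none)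
      | .guess i => (4, some i, none, none, none)
      | .move m => (5, none, none, some m, none)
      | .read s => (6, none, none, none, some s))
    (by intro a b; cases a <;> cases b <;> simp)

namespace Atom

variable {ρ : Type} {d : ℕ} {x : List Bool}

/-- The effect of an instruction on the input head and the registers. -/
def Sem (x : List Bool) : Atom ρ → ℕ × (ρ → U d x) → ℕ × (ρ → U d x) → Prop
  | zero i, s, s' => s' = s ∧ (s.2 i : ℕ) = 0
  | top i, s, s' => s' = s ∧ (s.2 i : ℕ) + 1 = bound d x
  | eq i j, s, s' => s' = s ∧ (s.2 i : ℕ) = s.2 j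
  | succ i j, s, s' => s' = s ∧ (s.2 i : ℕ) + 1 = s.2 j
  | guess i, s, s' => s'.1 = s.1 ∧ ∀ r, r ≠ i → s'.2 r = s.2 r
  | move m, s, s' => s'.1 = min (m.apply s.1) (x.length + 1) ∧ s'.2 = s.2
  | read c, s, s' => s' = s ∧ readInput x s.1 = c

/-- The finite transducer performing an instruction on the digits of the registers. The Boolean
state is a carry. -/
def pass (d : ℕ) : Atom ρ → Bool → (ρ → Fin (d + 2)) → Bool → (ρ → Fin (d + 2)) → Prop
  | zero i, c, g, c', g' => c' = c ∧ g' = g ∧ (g i : ℕ) = 0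
  | top i, c, g, c', g' => c' = c ∧ g' = g ∧ (g i : ℕ) = d + 1
  | eq i j, c, g, c', g' => c' = c ∧ g' = g ∧ (g i : ℕ) = g j
  | succ i j, c, g, c', g' => g' = g ∧ (g i : ℕ) + c.toNat = g j + (d + 2) * c'.toNat
  | guess i, c, g, c', g' => c' = c ∧ ∀ r, r ≠ i → g' r = g r
  | _, c, g, c', g' => c' = c ∧ g' = g

/-- The carries with which the pass may end. -/
def Final : Atom ρ → Bool → Prop
  | succ _ _, c => c = false
  | _, _ => True

/-- The move of the input head. -/
def inMove : Atom ρ → Move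
  | move m => m
  | _ => .stay

/-- The condition on the input letter. -/
def InOk : Atom ρ → InputCell Bool → Prop
  | read s, s' => s' = s
  | _, _ => True

end Atom

/-- The number held by register `r`, least significant digit first. -/
def val {ρ : Type} {d : ℕ} (r : ρ) : List (ρ → Fin (d + 2)) → ℕ
  | [] => 0
  | g :: l => g r + (d + 2) * val r l

/-! ### Numbers as digit strings and the effect of a sweep on them. -/

section Val

variable {ρ : Type} {d : ℕ}

theorem val_lt (r : ρ) (l : List (ρ → Fin (d + 2))) : val r l < (d + 2) ^ l.length := by
  induction l with
  | nil => simp [val]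
  | cons g l ih =>
    simp only [val, List.length_cons, pow_succ]
    have := (g r).2
    nlinarith

theorem digit_ext {m a b a' b' : ℕ} (ha : a < m) (ha' : a' < m) :
    a + m * b = a' + m * b' ↔ a = a' ∧ b = b' := by
  refine ⟨fun h => ?_, by rintro ⟨rfl, rfl⟩; rfl⟩
  have hb : b = b' := by
    have := congrArg (· / m) h
    simpa [Nat.add_mul_div_left _ _ (by omega : 0 < m), Nat.div_eq_of_lt ha,
      Nat.div_eq_of_lt ha'] using this
  subst hb
  exact ⟨by omega, rfl⟩

theorem val_cons_inj {r s : ρ} {g g' : ρ → Fin (d + 2)} {l l' : List (ρ → Fin (d + 2))} :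
    val r (g :: l) = val s (g' :: l') ↔ (g r : ℕ) = g' s ∧ val r l = val s l' :=
  digit_ext (g r).2 (g' s).2

theorem ext_of_val {l l' : List (ρ → Fin (d + 2))} (hl : l.length = l'.length)
    (h : ∀ r, val r l = val r l') : l = l' := by
  induction l generalizing l' with
  | nil => exact (List.length_eq_zero_iff.1 hl.symm).symm
  | cons g l ih =>
    cases l' with
    | nil => simp at hl
    | cons g' l' =>
      simp only [val_cons_inj] at h
      rw [ih (by simpa using hl) fun r => (h r).2, funext fun r => Fin.ext (h r).1]

theorem exists_val (w : ℕ) (v : ρ → ℕ) (hv : ∀ r, v r < (d + 2) ^ w) :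
    ∃ l : List (ρ → Fin (d + 2)), l.length = w ∧ ∀ r, val r l = v r := by
  induction w generalizing v with
  | zero => exact ⟨[], rfl, fun r => by have := hv r; simp [val] at *; omega⟩
  | succ w ih =>
    obtain ⟨l, hl, h⟩ := ih (fun r => v r / (d + 2)) fun r => by
      rw [Nat.div_lt_iff_lt_mul (by omega)]; exact hv r
    refine ⟨(fun r => ⟨v r % (d + 2), Nat.mod_lt _ (by omega)⟩) :: l, by simp [hl], fun r => ?_⟩
    simp only [val, h]
    exact Nat.mod_add_div _ _

theorem val_add_one_eq (r : ρ) (l : List (ρ → Fin (d + 2))) :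
    val r l + 1 = (d + 2) ^ l.length ↔ ∀ g ∈ l, (g r : ℕ) = d + 1 := by
  induction l with
  | nil => simp [val]
  | cons g l ih =>
    have h1 := (g r).2
    have h2 := val_lt r l
    simp only [val, List.length_cons, List.forall_mem_cons, ← ih]
    rw [pow_succ, mul_comm _ (d + 2)]
    generalize (d + 2) ^ l.length = N at *
    obtain ⟨N, rfl⟩ : ∃ M, N = M + 1 := ⟨N - 1, by omega⟩
    have := digit_ext (m := d + 2) (a := g r) (b := val r l) (a' := d + 1) (b' := N) h1 (by omega)
    rw [Nat.add_right_cancel_iff, ← this]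
    constructor <;> intro h <;> nlinarith

theorem val_eq_zero (r : ρ) (l : List (ρ → Fin (d + 2))) :
    val r l = 0 ↔ ∀ g ∈ l, (g r : ℕ) = 0 := by
  induction l with
  | nil => simp [val]
  | cons g l ih => simp [val, ih]

theorem val_eq_val (r s : ρ) (l : List (ρ → Fin (d + 2))) :
    val r l = val s l ↔ ∀ g ∈ l, (g r : ℕ) = g s := by
  induction l with
  | nil => simp [val]
  | cons g l ih => rw [val_cons_inj, ih, List.forall_mem_cons]

/-- Common treatment of the instructions that only check a condition digit by digit. -/
theorem sweep_test {p : Bool → (ρ → Fin (d + 2)) → Bool → (ρ → Fin (d + 2)) → Prop}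
    {q : (ρ → Fin (d + 2)) → Prop} (hp : ∀ c g c' g', p c g c' g' ↔ c' = c ∧ g' = g ∧ q g)
    {c c' : Bool} {l o : List (ρ → Fin (d + 2))} :
    Sweep p c l c' o ↔ c' = c ∧ o = l ∧ ∀ g ∈ l, q g := by
  induction l generalizing c o with
  | nil =>
    refine ⟨by rintro ⟨⟩; simp, ?_⟩
    rintro ⟨rfl, rfl, -⟩
    exact .nil _
  | cons g l ih =>
    constructor
    · rintro (_ | ⟨h, hs⟩)
      obtain ⟨rfl, rfl, hq⟩ := (hp _ _ _ _).1 h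
      obtain ⟨rfl, rfl, h'⟩ := ih.1 hs
      exact ⟨rfl, rfl, List.forall_mem_cons.2 ⟨hq, h'⟩⟩
    · rintro ⟨rfl, rfl, h⟩
      exact .cons ((hp _ _ _ _).2 ⟨rfl, rfl, h g (by simp)⟩)
        (ih.2 ⟨rfl, rfl, fun g hg => h g (by simp [hg])⟩)

/-- Addition with carry, verified without rewriting. With incoming carry `true` and outgoing carry
`false` the equation says that `j` holds the successor of `i`. -/
theorem sweep_succ {i j : ρ} {c c' : Bool} {l o : List (ρ → Fin (d + 2))} :
    Sweep (Atom.pass d (.succ i j)) c l c' o ↔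
      o = l ∧ val i l + c.toNat = val j l + (d + 2) ^ l.length * c'.toNat := by
  induction l generalizing c o with
  | nil =>
    constructor
    · rintro ⟨⟩; simp [val]
    · rintro ⟨rfl, h⟩
      obtain rfl : c = c' := by cases c <;> cases c' <;> simp [val] at *
      exact .nil _
  | cons g l ih =>
    have hi := (g i).2
    have hj := (g j).2
    constructor
    · rintro (_ | ⟨⟨rfl, h⟩, hs⟩)
      obtain ⟨rfl, h'⟩ := ih.1 hs
      refine ⟨rfl, ?_⟩
      simp only [val, List.length_cons, pow_succ]
      linear_combination h + (d + 2) * h'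
    · rintro ⟨rfl, h⟩
      simp only [val, List.length_cons, pow_succ] at h
      by_cases hc : (g i : ℕ) + c.toNat < d + 2
      · have h2 : ((g i : ℕ) + c.toNat) + (d + 2) * val i l =
          g j + (d + 2) * (val j l + (d + 2) ^ l.length * c'.toNat) := by linear_combination h
        obtain ⟨h3, h4⟩ := (digit_ext hc hj).1 h2
        exact .cons (k' := false) ⟨rfl, by simpa using h3⟩ (ih.2 ⟨rfl, by simpa using h4⟩)
      -- A digit is at most `d + 1` and the carry at most one, so an overflow leaves exactly the
      -- digit zero and a carry.
      · have hc' : (g i : ℕ) + c.toNat = d + 2 := by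
          have := c.toNat_le
          have := (g i).2
          omega
        have h2 : 0 + (d + 2) * (val i l + 1) =
          g j + (d + 2) * (val j l + (d + 2) ^ l.length * c'.toNat) := by
            linear_combination h - hc'
        obtain ⟨h3, h4⟩ := (digit_ext (by omega) hj).1 h2
        exact .cons (k' := true) ⟨rfl, by simp; omega⟩ (ih.2 ⟨rfl, by simpa using h4⟩)

theorem sweep_guess {i : ρ} {c c' : Bool} {l o : List (ρ → Fin (d + 2))} :
    Sweep (Atom.pass d (.guess i)) c l c' o ↔
      c' = c ∧ o.length = l.length ∧ ∀ r, r ≠ i → val r o = val r l := by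
  induction l generalizing c o with
  | nil =>
    constructor
    · rintro ⟨⟩; simp
    · rintro ⟨rfl, h, -⟩
      obtain rfl := List.length_eq_zero_iff.1 h
      exact .nil _
  | cons g l ih =>
    constructor
    · rintro (_ | ⟨⟨rfl, h⟩, hs⟩)
      obtain ⟨rfl, h1, h2⟩ := ih.1 hs
      exact ⟨rfl, by simp [h1], fun r hr => by simp [val, h r hr, h2 r hr]⟩
    · rintro ⟨rfl, h1, h2⟩
      cases o with
      | nil => simp at h1
      | cons g' o =>
        simp only [val_cons_inj] at h2
        exact .cons ⟨rfl, fun r hr => Fin.ext (h2 r hr).1⟩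
          (ih.2 ⟨rfl, by simpa using h1, fun r hr => (h2 r hr).2⟩)

end Val

/-! ### Digit strings as representations of register contents. -/

section Rep

variable {ρ : Type} {d : ℕ} {x : List Bool}

/-- The word `l` of digits represents the register contents `v`. -/
def Rep (v : ρ → U d x) (l : List (ρ → Fin (d + 2))) : Prop :=
  l.length = (x.length + 2).size ∧ ∀ r, val r l = v r

theorem Rep.exists_list (v : ρ → U d x) : ∃ l, Rep v l := exists_val _ _ fun r => (v r).2

theorem Rep.exists_val {l : List (ρ → Fin (d + 2))} (hl : l.length = (x.length + 2).size) :
    ∃ v : ρ → U d x, Rep v l :=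
  ⟨fun r => ⟨val r l, by rw [bound, ← hl]; exact val_lt r l⟩, hl, fun _ => rfl⟩

theorem Rep.unique {v v' : ρ → U d x} {l : List (ρ → Fin (d + 2))} (h : Rep v l) (h' : Rep v' l) :
    v' = v := funext fun r => Fin.ext ((h'.2 r).symm.trans (h.2 r))

theorem Rep.unique_list {v : ρ → U d x} {l l' : List (ρ → Fin (d + 2))} (h : Rep v l)
    (h' : Rep v l') : l' = l :=
  ext_of_val (h'.1.trans h.1.symm) fun r => (h'.2 r).trans (h.2 r).symm

/-- Every instruction starts with carry `true`; only `succ` uses it. The bound on `h` makes the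
clipped `stay` move harmless. -/
theorem Atom.sem_iff (a : Atom ρ) {h h' : ℕ} {v v' : ρ → U d x} {l o : List (ρ → Fin (d + 2))}
    (hh : h ≤ x.length + 1) (hv : Rep v l) (ho : Rep v' o) :
    a.Sem x (h, v) (h', v') ↔ (∃ c, Sweep (a.pass d) true l c o ∧ a.Final c) ∧
      a.InOk (readInput x h) ∧ h' = min (a.inMove.apply h) (x.length + 1) := by
  have key : v' = v ↔ o = l :=
    ⟨fun e => hv.unique_list (e ▸ ho), fun e => hv.unique (e ▸ ho)⟩
  have hstay : min (Move.stay.apply h) (x.length + 1) = h := min_eq_left hh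
  cases a with
  | zero i =>
    have hs := @sweep_test ρ d (pass d (zero i)) (fun g => (g i : ℕ) = 0)
      (fun _ _ _ _ => Iff.rfl) true
    simp only [Sem, Final, InOk, inMove, hs, ← hv.2, val_eq_zero, key, hstay, Prod.mk.injEq]
    simp
    tauto
  | top i =>
    have hs := @sweep_test ρ d (pass d (top i)) (fun g => (g i : ℕ) = d + 1)
      (fun _ _ _ _ => Iff.rfl) true
    simp [Sem, Final, InOk, inMove, bound, ← hv.1, ← hv.2, val_add_one_eq, hs, key, hstay]
    tauto
  | eq i j =>
    have hs := @sweep_test ρ d (pass d (eq i j)) (fun g => (g i : ℕ) = g j)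
      (fun _ _ _ _ => Iff.rfl) true
    simp only [Sem, Final, InOk, inMove, hs, ← hv.2, val_eq_val, key, hstay, Prod.mk.injEq]
    simp
    tauto
  | succ i j =>
    simp [Sem, Final, InOk, inMove, ← hv.2, sweep_succ, key, hstay]
    tauto
  | guess i =>
    have : (∀ r, r ≠ i → v' r = v r) ↔ ∀ r, r ≠ i → val r o = val r l := by
      simp only [hv.2, ho.2, Fin.val_inj]
    simp only [Sem, Final, InOk, inMove, sweep_guess, this, hstay, hv.1, ho.1]
    simp
    tauto
  | move m =>
    have hs := @sweep_test ρ d (pass d (move m)) (fun _ => True)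
      (fun _ _ _ _ => by simp [pass]) true
    simp [Sem, Final, InOk, inMove, hs, key]
    tauto
  | read s =>
    have hs := @sweep_test ρ d (pass d (read s)) (fun _ => True)
      (fun _ _ _ _ => by simp [pass]) true
    simp [Sem, Final, InOk, inMove, hs, key, hstay]
    tauto

end Rep

/-! ### Running programs on sweep machines -/

/-- The effect of a sequence of instructions. -/
def Run {ρ : Type} {d : ℕ} (x : List Bool) :
    List (Atom ρ) → ℕ × (ρ → U d x) → ℕ × (ρ → U d x) → Prop
  | [], s, s' => s = s'
  | a :: w, s, s' => ∃ t, a.Sem x s t ∧ Run x w t s'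

theorem run_append {ρ : Type} {d : ℕ} {x : List Bool} {w w' : List (Atom ρ)}
    {s s' : ℕ × (ρ → U d x)} :
    Run x (w ++ w') s s' ↔ ∃ t, Run x w s t ∧ Run x w' t s' := by
  induction w generalizing s with
  | nil => simp [Run]
  | cons a w ih =>
    simp only [List.cons_append, Run, ih]
    exact ⟨fun ⟨t, h, u, h1, h2⟩ => ⟨u, ⟨t, h, h1⟩, h2⟩, fun ⟨u, ⟨t, h, h1⟩, h2⟩ => ⟨t, h, u, h1, h2⟩⟩

theorem Atom.Sem.head_le {ρ : Type} {d : ℕ} {x : List Bool} {a : Atom ρ} {s s' : ℕ × (ρ → U d x)}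
    (h : a.Sem x s s') (hs : s.1 ≤ x.length + 1) : s'.1 ≤ x.length + 1 := by
  cases a with
  | guess i => exact h.1.le.trans hs
  | move m => rw [h.1]; exact min_le_right _ _
  | _ => rw [h.1]; exact hs

/-- The binary increment, least significant digit first. -/
def incr : List Bool → List Bool
  | [] => [true]
  | false :: l => true :: l
  | true :: l => false :: incr l

/-- The machine increments a binary counter at each input position, markers included. The counter
ends at `x.length + 2`, and its length is the number of digits allotted to the registers; this is
how the logarithmic space is laid out. -/
theorem incr_bits (n : ℕ) : incr n.bits = (n + 1).bits := by
  induction n using Nat.binaryRec' with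
  | zero => simp [incr]
  | bit b n hb ih =>
    cases b with
    | false =>
      have hn : n ≠ 0 := fun h => by simpa using hb h
      simp only [Nat.bit_false]
      rw [Nat.bit0_bits n hn, Nat.bit1_bits]; rfl
    | true =>
      simp only [Nat.bit_true]
      rw [Nat.bit1_bits, incr, ih, ← Nat.bit0_bits _ (by omega)]
      congr 1

section RunMachine

variable {ρ σ : Type}

/-- The digits used while counting the input length. -/
def bitCell (d : ℕ) (b : Bool) : ρ → Fin (d + 2) := fun _ => if b then 1 else 0

theorem bitCell_inj [Nonempty ρ] {d : ℕ} {b b' : Bool} :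
    (bitCell d b : ρ → Fin (d + 2)) = bitCell d b' ↔ b = b' := by
  constructor
  · intro h
    have := congrFun h (Classical.arbitrary ρ)
    cases b <;> cases b' <;> simp [bitCell] at *
  · rintro rfl; rfl

/-- The states of the machine running a program: `none` accepts, `inl c` counts the input
length with carry `c`, and `inr (q, a, c)` executes instruction `a` with carry `c`, where the
control automaton is in state `q`. -/
abbrev RunState (ρ σ : Type) : Type := Option (Bool ⊕ σ × Atom ρ × Bool)

inductive RunPass (d : ℕ) : RunState ρ σ → (ρ → Fin (d + 2)) → RunState ρ σ →
    (ρ → Fin (d + 2)) → Prop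
  | flip : RunPass d (some (.inl true)) (bitCell d true) (some (.inl true)) (bitCell d false)
  | halt : RunPass d (some (.inl true)) (bitCell d false) (some (.inl false)) (bitCell d true)
  | skip (g) : RunPass d (some (.inl false)) g (some (.inl false)) g
  | atom (q) {a : Atom ρ} {c c' g g'} (h : a.pass d c g c' g') :
      RunPass d (some (.inr (q, a, c))) g (some (.inr (q, a, c'))) g'

inductive RunTurn (d : ℕ) (M : DFA (Atom ρ) σ) : RunState ρ σ → InputCell Bool → RunState ρ σ →
    Move → Option (ρ → Fin (d + 2)) → Prop
  | count (c s) (h : s ≠ .rightEnd) : RunTurn d M (some (.inl c)) s (some (.inl true)) .right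
      (if c then some (bitCell d true) else none)
  | run (c a) : RunTurn d M (some (.inl c)) .rightEnd (some (.inr (M.start, a, true))) .stay
      (if c then some (bitCell d true) else none)
  | atom {q a c s} (a') (hc : a.Final c) (hs : a.InOk s) :
      RunTurn d M (some (.inr (q, a, c))) s (some (.inr (M.step q a, a', true))) a.inMove none
  | accept {q} (a c s) (h : q ∈ M.accept) :
      RunTurn d M (some (.inr (q, a, c))) s none .stay none

variable {d : ℕ}

theorem sweep_skip {l o : List (ρ → Fin (d + 2))} {k : RunState ρ σ} :
    Sweep (RunPass d) (some (.inl false)) l k o ↔ k = some (.inl false) ∧ o = l := by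
  induction l generalizing o with
  | nil =>
    refine ⟨by rintro ⟨⟩; simp, ?_⟩
    rintro ⟨rfl, rfl⟩; exact .nil _
  | cons g l ih =>
    constructor
    · rintro (_ | ⟨⟨⟩, hs⟩)
      obtain ⟨rfl, rfl⟩ := ih.1 hs
      simp
    · rintro ⟨rfl, rfl⟩
      exact .cons (.skip g) (ih.2 ⟨rfl, rfl⟩)

theorem sweep_incr [Nonempty ρ] {l : List Bool} {o : List (ρ → Fin (d + 2))} {k : RunState ρ σ}
    (h : Sweep (RunPass d) (some (.inl true)) (l.map (bitCell d)) k o) :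
    ∃ c, k = some (.inl c) ∧
      o ++ (if c then some (bitCell d true) else none).toList = (incr l).map (bitCell d) := by
  induction l generalizing o with
  | nil => cases h; exact ⟨true, rfl, rfl⟩
  | cons b l ih =>
    rw [List.map_cons] at h
    generalize hb : (bitCell d b : ρ → Fin (d + 2)) = g at h
    obtain _ | ⟨h, hs⟩ := h
    cases h with
    | flip =>
      obtain rfl := bitCell_inj.1 hb
      obtain ⟨c, rfl, h⟩ := ih hs
      exact ⟨c, rfl, by simp [incr, ← h]⟩
    | halt =>
      obtain rfl := bitCell_inj.1 hb
      obtain ⟨rfl, rfl⟩ := sweep_skip.1 hs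
      exact ⟨false, rfl, by simp [incr]⟩

theorem exists_sweep_incr (ρ σ : Type) (l : List Bool) :
    ∃ c o, Sweep (RunPass d) (some (.inl true) : RunState ρ σ) (l.map (bitCell d))
      (some (.inl c)) o := by
  induction l with
  | nil => exact ⟨_, _, .nil _⟩
  | cons b l ih =>
    cases b with
    | false => exact ⟨_, _, .cons .halt (sweep_skip.2 ⟨rfl, rfl⟩)⟩
    | true =>
      obtain ⟨c, o, h⟩ := ih
      exact ⟨_, _, .cons .flip h⟩

theorem sweep_atom {q : σ} {a : Atom ρ} {c : Bool} {l o : List (ρ → Fin (d + 2))}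
    {k : RunState ρ σ} :
    Sweep (RunPass d) (some (.inr (q, a, c))) l k o ↔
      ∃ c', k = some (.inr (q, a, c')) ∧ Sweep (a.pass d) c l c' o := by
  induction l generalizing c o with
  | nil =>
    constructor
    · rintro ⟨⟩; exact ⟨_, rfl, .nil _⟩
    · rintro ⟨c', rfl, h⟩; cases h; exact .nil _
  | cons g l ih =>
    constructor
    · intro h
      cases h with
      | cons hr hs =>
        obtain _ | _ | _ | @⟨_, _, _, c₁, _, _, hp⟩ := hr
        obtain ⟨c', rfl, hs'⟩ := ih.1 hs
        exact ⟨c', rfl, .cons hp hs'⟩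
    · rintro ⟨c', rfl, h⟩
      cases h with
      | cons hp hs => exact .cons (.atom _ hp) (ih.2 ⟨_, rfl, hs⟩)

variable [Finite ρ] [Finite σ]

/-- The sweep machine that counts the input length and then runs the program whose set of
instruction sequences is accepted by `M`. -/
def runMachine (d : ℕ) (M : DFA (Atom ρ) σ) : SweepMachine Bool where
  K := RunState ρ σ
  Γ := ρ → Fin (d + 2)
  finite_K := inferInstance
  finite_Γ := inferInstance
  start := some (.inl true)
  accept := none
  start_ne := by simp
  pass := RunPass d
  turn := RunTurn d M

theorem readInput_eq_rightEnd {S : Type*} {x : List S} {i : ℕ} :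
    readInput x i = .rightEnd ↔ x.length < i := by
  cases i with
  | zero => simp [readInput]
  | succ i =>
    simp only [readInput]
    cases h : x[i]? with
    | none => simpa [Nat.lt_succ_iff] using List.getElem?_eq_none_iff.1 h
    | some s => simpa using Nat.succ_le_of_lt (List.getElem?_eq_some_iff.1 h).1

theorem step_runMachine {M : DFA (Atom ρ) σ} {x : List Bool} {k k' : RunState ρ σ} {h h' : ℕ}
    {l l' : List (ρ → Fin (d + 2))} :
    (runMachine d M).Step x (k, h, l) (k', h', l') ↔
      ∃ (k₁ : RunState ρ σ) (o : List (ρ → Fin (d + 2))) (m : Move)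
        (a : Option (ρ → Fin (d + 2))), Sweep (RunPass d) k l k₁ o ∧
        RunTurn d M k₁ (readInput x h) k' m a ∧ h' = min (m.apply h) (x.length + 1) ∧
        l' = o ++ a.toList := Iff.rfl

/-- The configurations of the machine running a program. -/
def RunInv (d : ℕ) (M : DFA (Atom ρ) σ) (x : List Bool) :
    RunState ρ σ × ℕ × List (ρ → Fin (d + 2)) → Prop
  | (none, _, l) => l.length = (x.length + 2).size ∧ ∃ w ∈ M.accepts,
      ∃ (v : ρ → U d x) (s : _), Run x w (x.length + 1, v) s
  | (some (.inl c), h, l) => c = true ∧ h ≤ x.length + 1 ∧ l = h.bits.map (bitCell d)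
  | (some (.inr (q, _, c)), h, l) => c = true ∧ h ≤ x.length + 1 ∧
      ∃ w, M.eval w = q ∧ ∃ v v' : ρ → U d x, Run x w (x.length + 1, v) (h, v') ∧ Rep v' l

/-- Soundness of the simulation. The digits left by the counter become the initial register
contents, which is why the invariant quantifies existentially over them. -/
theorem runInv_of_reach [Nonempty ρ] (M : DFA (Atom ρ) σ) (x : List Bool)
    {c : RunState ρ σ × ℕ × List (ρ → Fin (d + 2))} (hc : (runMachine d M).Reach x c) :
    RunInv d M x c := by
  induction hc with
  | refl => exact ⟨rfl, by simp, by rw [Nat.zero_bits]; rfl⟩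
  | @tail c c' _ hs ih =>
    obtain ⟨k₀, h, l⟩ := c
    obtain ⟨k', h', l'⟩ := c'
    obtain ⟨k, o, m, a, h1, h2, h3, h4⟩ := step_runMachine.1 hs
    clear hs
    match k₀, ih with
    | none, ih =>
      cases l with
      | nil => cases h1; cases h2
      | cons g l => obtain _ | ⟨⟨⟩, _⟩ := h1
    | some (.inl c), ⟨hc, hh, hl⟩ =>
      subst hc hl
      obtain ⟨c, rfl, ho⟩ := sweep_incr h1
      rw [incr_bits] at ho
      generalize hr : readInput x h = s at h2
      cases h2 with
      | count _ _ hs =>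
        rw [ho] at h4
        have : h ≤ x.length := by
          rw [← hr, Ne, readInput_eq_rightEnd] at hs; omega
        have h3 : h' = h + 1 := by simp [h3, Move.apply]; omega
        exact ⟨rfl, by omega, by rw [h4, h3]⟩
      | run _ a =>
        rw [ho] at h4
        rw [readInput_eq_rightEnd] at hr
        obtain rfl : h = x.length + 1 := by omega
        have h3 : h' = x.length + 1 := by simp [h3, Move.apply]
        have hl : l'.length = (x.length + 2).size := by
          rw [h4, List.length_map, Nat.size_eq_bits_len]
        obtain ⟨v, hv⟩ := Rep.exists_val hl
        exact ⟨rfl, h3.le, [], rfl, v, v, by rw [h3]; rfl, hv⟩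
    | some (.inr (q, a, c)), ⟨hc, hh, w, hw, v, v', hr, hv⟩ =>
      subst hc
      obtain ⟨c', rfl, hs⟩ := sweep_atom.1 h1
      have ho : o.length = (x.length + 2).size := hs.length_eq.trans hv.1
      cases h2 with
      | atom a' hc hi =>
        obtain rfl : l' = o := by simpa using h4
        obtain ⟨v₂, hv₂⟩ := Rep.exists_val ho
        have hsem := (a.sem_iff hh hv hv₂).2 ⟨⟨c', hs, hc⟩, hi, h3⟩
        refine ⟨rfl, by rw [h3]; exact min_le_right _ _, w ++ [a], ?_, v, v₂, ?_, hv₂⟩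
        · rw [DFA.eval_append_singleton, hw]
        · exact run_append.2 ⟨_, hr, _, hsem, rfl⟩
      | accept _ _ _ hq =>
        obtain rfl : l' = o := by simpa using h4
        exact ⟨ho, w, by rw [DFA.mem_accepts, hw]; exact hq, v, _, hr⟩

theorem reach_count (M : DFA (Atom ρ) σ) [Nonempty ρ] (x : List Bool) {h : ℕ}
    (hh : h ≤ x.length + 1) :
    (runMachine d M).Reach x (some (.inl true), h, h.bits.map (bitCell d)) := by
  induction h with
  | zero => exact .refl
  | succ h ih =>
    refine (ih (by omega)).tail ?_
    obtain ⟨c, o, hs⟩ := exists_sweep_incr (d := d) ρ σ h.bits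
    obtain ⟨c', hc, ho⟩ := sweep_incr hs
    obtain rfl : c = c' := by simpa using hc
    rw [incr_bits] at ho
    refine step_runMachine.2 ⟨_, o, _, _, hs, .count c _ ?_, ?_, ho.symm⟩
    · rw [Ne, readInput_eq_rightEnd]; omega
    · simp only [Move.apply]; omega

theorem reach_run (M : DFA (Atom ρ) σ) [Nonempty ρ] (x : List Bool) (a : Atom ρ)
    {l : List (ρ → Fin (d + 2))} (hl : l = (x.length + 2).bits.map (bitCell d)) :
    (runMachine d M).Reach x (some (.inr (M.start, a, true)), x.length + 1, l) := by
  refine (reach_count M x le_rfl).tail ?_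
  obtain ⟨c, o, hs⟩ := exists_sweep_incr (d := d) ρ σ (x.length + 1).bits
  obtain ⟨c', hc, ho⟩ := sweep_incr hs
  obtain rfl : c = c' := by simpa using hc
  rw [incr_bits] at ho
  refine step_runMachine.2 ⟨_, o, .stay, _, hs, ?_, by simp [Move.apply], hl.trans ho.symm⟩
  rw [readInput_eq_rightEnd.2 (Nat.lt_succ_self _)]
  exact RunTurn.run c a

/-- The next instruction is guessed at the end of the preceding sweep, so hypothesis and conclusion
allow any pending instruction. -/
theorem reach_atoms (M : DFA (Atom ρ) σ) (x : List Bool) {w : List (Atom ρ)}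
    {s s' : ℕ × (ρ → U d x)} (hr : Run x w s s') (hs : s.1 ≤ x.length + 1) (q : σ)
    {l : List (ρ → Fin (d + 2))} (hl : Rep s.2 l)
    (hq : ∀ a, (runMachine d M).Reach x (some (.inr (q, a, true)), s.1, l)) (a : Atom ρ) :
    ∃ l', (runMachine d M).Reach x (some (.inr (M.evalFrom q w, a, true)), s'.1, l') ∧
      Rep s'.2 l' := by
  induction w generalizing s q l with
  | nil =>
    obtain rfl : s = s' := hr
    exact ⟨l, hq a, hl⟩
  | cons b w ih =>
    obtain ⟨t, h1, h2⟩ := hr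
    obtain ⟨o, ho⟩ := Rep.exists_list t.2
    obtain ⟨⟨c, hc, hf⟩, hi, hm⟩ := (b.sem_iff (v := s.2) (v' := t.2) hs hl ho).1 h1
    exact ih h2 (h1.head_le hs) (M.step q b) ho fun a => (hq b).tail
      (step_runMachine.2 ⟨_, o, _, _, sweep_atom.2 ⟨c, rfl, hc⟩, .atom a hf hi, hm, by simp⟩)

theorem size_add_two_le (n : ℕ) : (n + 2).size ≤ 3 * (Nat.log 2 n + 1) := by
  have h : (n + 2).size ≤ Nat.log 2 n + 3 := by
    rw [Nat.size_le]
    have := Nat.lt_pow_succ_log_self (b := 2) (by norm_num) n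
    have h1 : 1 ≤ 2 ^ Nat.log 2 n := Nat.one_le_two_pow
    simp only [pow_succ] at *
    omega
  omega

/-- If acceptance does not depend on the initial contents of the registers, then the inputs
on which a program can be executed form a language in **NL**. -/
theorem inNL_of_program [Nonempty ρ] (d : ℕ) (p : RegularExpression (Atom ρ)) (X : Language Bool)
    (hX : ∀ x (v : ρ → U d x), x ∈ X ↔ ∃ w ∈ p.matches', ∃ s, Run x w (x.length + 1, v) s) :
    InNL X := by
  obtain ⟨σ, _, M, hM⟩ := p.isRegular_matches'
  have h := (runMachine d M).inNL_of_length_le 3 (by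
    rintro x ⟨k, h, (l : List (ρ → Fin (d + 2)))⟩ hc
    refine le_trans ?_ (size_add_two_le _)
    have := runInv_of_reach M x hc
    clear hc
    change l.length ≤ _
    match k, this with
    | none, ⟨hl, _⟩ => exact hl.le
    | some (.inl c), ⟨_, hh, hl⟩ =>
      rw [hl]
      rw [List.length_map, Nat.size_eq_bits_len]
      exact Nat.size_le_size (by omega)
    | some (.inr (q, a, c)), ⟨_, _, _, _, _, _, _, hv⟩ => exact hv.1.le)
  suffices hX' : X = _ by rw [hX']; exact h
  ext x
  rw [← hM] at hX
  constructor
  · intro hx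
    set l := (x.length + 2).bits.map (bitCell d : Bool → ρ → Fin (d + 2)) with hl
    obtain ⟨v, hv⟩ := Rep.exists_val (ρ := ρ) (x := x) (l := l) (by
      rw [hl, List.length_map, Nat.size_eq_bits_len])
    obtain ⟨w, hw, s, hr⟩ := (hX x v).1 hx
    -- The state always carries a pending instruction, even when the run is about to accept. `move
    -- .stay` is chosen because its sweep succeeds on every memory word.
    obtain ⟨l', h1, h2⟩ := reach_atoms M x hr le_rfl M.start hv (fun a => reach_run M x a hl)
      (.move .stay)
    refine ⟨s.1, l', h1.tail ?_⟩
    refine step_runMachine.2 ⟨_, l', .stay, none, sweep_atom.2 ⟨true, rfl, ?_⟩, .accept _ _ _ hw, ?_,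
      (List.append_nil l').symm⟩
    · exact (sweep_test (q := fun _ => True) (fun _ _ _ _ => by simp [Atom.pass])).2
        ⟨rfl, rfl, by simp⟩
    · exact (min_eq_left (runInv_of_reach M x h1).2.1).symm
  · rintro ⟨h, l, hr⟩
    obtain ⟨_, w, hw, v, s, hs⟩ := runInv_of_reach M x hr
    exact (hX x v).2 ⟨w, hw, s, hs⟩

end RunMachine
end RegReal

/-! ### Executing regular programs -/

namespace RegReal

section Exec

variable {ρ ρ' : Type} {d : ℕ} {x : List Bool}

/-- The input-output relation of a program. -/
def Exec (x : List Bool) (p : RegularExpression (Atom ρ)) (s s' : ℕ × (ρ → U d x)) : Prop :=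
  ∃ w ∈ p.matches', Run x w s s'

theorem exec_char {a : Atom ρ} {s s' : ℕ × (ρ → U d x)} :
    Exec x (.char a) s s' ↔ a.Sem x s s' := by
  constructor
  · rintro ⟨w, hw, h⟩
    obtain rfl : w = [a] := hw
    obtain ⟨t, h, rfl⟩ := h
    exact h
  · exact fun h => ⟨[a], rfl, s', h, rfl⟩

theorem exec_mul {p q : RegularExpression (Atom ρ)} {s s' : ℕ × (ρ → U d x)} :
    Exec x (p * q) s s' ↔ ∃ t, Exec x p s t ∧ Exec x q t s' := by
  constructor
  · rintro ⟨_, ⟨u, hu, v, hv, rfl⟩, h⟩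
    obtain ⟨t, h1, h2⟩ := run_append.1 h
    exact ⟨t, ⟨u, hu, h1⟩, v, hv, h2⟩
  · rintro ⟨t, ⟨u, hu, h1⟩, v, hv, h2⟩
    exact ⟨u ++ v, ⟨u, hu, v, hv, rfl⟩, run_append.2 ⟨t, h1, h2⟩⟩

theorem exec_add {p q : RegularExpression (Atom ρ)} {s s' : ℕ × (ρ → U d x)} :
    Exec x (p + q) s s' ↔ Exec x p s s' ∨ Exec x q s s' := by
  constructor
  · rintro ⟨w, hw | hw, h⟩
    exacts [.inl ⟨w, hw, h⟩, .inr ⟨w, hw, h⟩]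
  · rintro (⟨w, hw, h⟩ | ⟨w, hw, h⟩)
    exacts [⟨w, .inl hw, h⟩, ⟨w, .inr hw, h⟩]

theorem exec_one {s s' : ℕ × (ρ → U d x)} :
    Exec x (1 : RegularExpression (Atom ρ)) s s' ↔ s' = s := by
  constructor
  · rintro ⟨w, hw, h⟩
    obtain rfl : w = [] := hw
    exact h.symm
  · rintro rfl; exact ⟨[], rfl, rfl⟩

theorem exec_star {p : RegularExpression (Atom ρ)} {s s' : ℕ × (ρ → U d x)} :
    Exec x p.star s s' ↔ Relation.ReflTransGen (Exec x p) s s' := by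
  constructor
  · rintro ⟨w, hw, h⟩
    obtain ⟨L, rfl, hL⟩ := Language.mem_kstar.1 hw
    clear hw
    induction L generalizing s with
    | nil => obtain rfl : s = s' := h; exact .refl
    | cons u L ih =>
      obtain ⟨t, h1, h2⟩ := run_append.1 h
      exact .head ⟨u, hL u (by simp), h1⟩ (ih (fun y hy => hL y (by simp [hy])) h2)
  · intro h
    suffices ∃ L : List (List (Atom ρ)), (∀ y ∈ L, y ∈ p.matches') ∧ Run x L.flatten s s' by
      obtain ⟨L, h1, h2⟩ := this
      exact ⟨_, Language.mem_kstar.2 ⟨L, rfl, h1⟩, h2⟩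
    induction h using Relation.ReflTransGen.head_induction_on with
    | refl => exact ⟨[], by simp, rfl⟩
    | head h _ ih =>
      obtain ⟨u, hu, hr⟩ := h
      obtain ⟨L, h1, h2⟩ := ih
      exact ⟨u :: L, by simpa using ⟨hu, h1⟩, run_append.2 ⟨_, hr, h2⟩⟩

/-- Renaming of registers. -/
def Atom.map (g : ρ → ρ') : Atom ρ → Atom ρ'
  | zero i => zero (g i)
  | top i => top (g i)
  | eq i j => eq (g i) (g j)
  | succ i j => succ (g i) (g j)
  | guess i => guess (g i)
  | move m => move m
  | read s => read s

theorem extend_comp_self {α β γ : Type*} {g : α → β} (hg : g.Injective) (u : α → γ) (v : β → γ) :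
    Function.extend g u v ∘ g = u := funext fun _ => hg.extend_apply _ _ _

theorem state_eq_iff {g : ρ → ρ'} {s s' : ℕ × (ρ' → U d x)} :
    s' = s ↔ (s'.1, s'.2 ∘ g) = (s.1, s.2 ∘ g) ∧ ∀ r ∉ Set.range g, s'.2 r = s.2 r := by
  constructor
  · rintro rfl; simp
  · rintro ⟨h1, h2⟩
    obtain ⟨h0, h1⟩ := Prod.mk.inj h1
    refine Prod.ext h0 (funext fun r => ?_)
    by_cases hr : r ∈ Set.range g
    · obtain ⟨i, rfl⟩ := hr; exact congrFun h1 i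
    · exact h2 r hr

theorem Atom.sem_map {g : ρ → ρ'} (hg : g.Injective) (a : Atom ρ) {s s' : ℕ × (ρ' → U d x)} :
    (a.map g).Sem x s s' ↔ a.Sem x (s.1, s.2 ∘ g) (s'.1, s'.2 ∘ g) ∧
      ∀ r ∉ Set.range g, s'.2 r = s.2 r := by
  cases a with
  | guess i =>
    simp only [map, Sem, Function.comp]
    constructor
    · rintro ⟨h1, h2⟩
      exact ⟨⟨h1, fun r hr => h2 _ (hg.ne hr)⟩, fun r hr => h2 r fun h => hr ⟨i, h.symm⟩⟩
    · rintro ⟨⟨h1, h2⟩, h3⟩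
      refine ⟨h1, fun r hr => ?_⟩
      by_cases h : r ∈ Set.range g
      · obtain ⟨j, rfl⟩ := h
        exact h2 j fun h => hr (h ▸ rfl)
      · exact h3 r h
  | move m =>
    have := state_eq_iff (g := g) (s := (0, s.2)) (s' := (0, s'.2))
    simp only [Prod.mk.injEq, true_and] at this
    simp only [map, Sem, this]
    tauto
  | _ =>
    simp only [map, Sem, Function.comp_apply]
    rw [state_eq_iff (g := g)]
    tauto

/-- A renamed program lives in the image of `g` and respects everything outside; this frame property
lets programs be called as subroutines. -/
theorem run_map {g : ρ → ρ'} (hg : g.Injective) {w : List (Atom ρ)} {s s' : ℕ × (ρ' → U d x)} :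
    Run x (w.map (Atom.map g)) s s' ↔ Run x w (s.1, s.2 ∘ g) (s'.1, s'.2 ∘ g) ∧
      ∀ r ∉ Set.range g, s'.2 r = s.2 r := by
  induction w generalizing s with
  | nil =>
    simp only [List.map_nil, Run]
    rw [eq_comm, state_eq_iff (g := g), eq_comm (a := (s'.1, _))]
  | cons a w ih =>
    simp only [List.map_cons, Run, ih, a.sem_map hg]
    constructor
    · rintro ⟨t, ⟨h1, h2⟩, h3, h4⟩
      exact ⟨⟨_, h1, h3⟩, fun r hr => (h4 r hr).trans (h2 r hr)⟩
    · rintro ⟨⟨t, h1, h3⟩, h4⟩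
      classical
      refine ⟨(t.1, Function.extend g t.2 s.2), ⟨?_, fun r hr => ?_⟩, ?_, fun r hr => ?_⟩
      · simpa [extend_comp_self hg] using h1
      · exact Function.extend_apply' _ _ _ hr
      · simpa [extend_comp_self hg] using h3
      · rw [h4 r hr]; exact (Function.extend_apply' _ _ _ hr).symm

theorem exec_map {g : ρ → ρ'} (hg : g.Injective) {p : RegularExpression (Atom ρ)}
    {s s' : ℕ × (ρ' → U d x)} :
    Exec x (p.map (Atom.map g)) s s' ↔ Exec x p (s.1, s.2 ∘ g) (s'.1, s'.2 ∘ g) ∧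
      ∀ r ∉ Set.range g, s'.2 r = s.2 r := by
  simp only [Exec, RegularExpression.matches'_map]
  constructor
  · rintro ⟨_, ⟨w, hw, rfl⟩, h⟩
    obtain ⟨h1, h2⟩ := (run_map hg).1 h
    exact ⟨⟨w, hw, h1⟩, h2⟩
  · rintro ⟨⟨w, hw, h1⟩, h2⟩
    exact ⟨_, ⟨w, hw, rfl⟩, (run_map hg).2 ⟨h1, h2⟩⟩

/-- Guessing is the only way to write a register: guess the target, then test it against the source.
Disjointness of sources and targets keeps the sources intact meanwhile. -/
theorem exists_copy {ι : Type} [Finite ι] (src dst : ι → ρ) (hd : dst.Injective)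
    (h : ∀ i j, src i ≠ dst j) : ∃ p : RegularExpression (Atom ρ), ∀ {d : ℕ} {x : List Bool}
      {s s' : ℕ × (ρ → U d x)}, Exec x p s s' ↔
        s'.1 = s.1 ∧ (∀ i, s'.2 (dst i) = s.2 (src i)) ∧ ∀ r ∉ Set.range dst, s'.2 r = s.2 r := by
  classical
  have key : ∀ L : List ι, ∃ p : RegularExpression (Atom ρ), ∀ {d : ℕ} {x : List Bool}
      {s s' : ℕ × (ρ → U d x)}, Exec x p s s' ↔ s'.1 = s.1 ∧
        (∀ i ∈ L, s'.2 (dst i) = s.2 (src i)) ∧ ∀ r, (∀ i ∈ L, r ≠ dst i) → s'.2 r = s.2 r := by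
    intro L
    induction L with
    | nil =>
      refine ⟨1, fun {d x s s'} => ?_⟩
      rw [exec_one]
      simp [Prod.ext_iff, funext_iff]
    | cons i L ih =>
      obtain ⟨p, hp⟩ := ih
      refine ⟨.char (.guess (dst i)) * .char (.eq (src i) (dst i)) * p, fun {d x s s'} => ?_⟩
      simp only [exec_mul, exec_char, hp, Atom.Sem]
      constructor
      · rintro ⟨t, ⟨u, ⟨h1, h2⟩, rfl, h3⟩, h4, h5, h6⟩
        have hsrc : ∀ j, t.2 (src j) = s.2 (src j) := fun j => h2 _ (h j i)
        refine ⟨h4.trans h1, fun j hj => ?_, fun r hr => ?_⟩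
        · by_cases hjL : j ∈ L
          · rw [h5 j hjL, hsrc]
          · obtain rfl : j = i := by simpa [hjL] using hj
            rw [h6 _ fun k hk => hd.ne (by rintro rfl; exact hjL hk), ← hsrc]
            exact (Fin.ext h3).symm
        · rw [h6 r fun k hk => hr k (by simp [hk]), h2 r (hr i (by simp))]
      · rintro ⟨h1, h2, h3⟩
        let t : ℕ × (ρ → U d x) := (s.1, Function.update s.2 (dst i) (s.2 (src i)))
        have ht : ∀ r, r ≠ dst i → t.2 r = s.2 r := fun r hr => Function.update_of_ne hr _ _
        have hti : t.2 (dst i) = s.2 (src i) := by simp [t]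
        refine ⟨t, ⟨t, ⟨rfl, ht⟩, rfl, by rw [hti, ht _ (h _ _)]⟩, h1, fun j hj => ?_, fun r hr => ?_⟩
        · rw [ht _ (h _ _)]; exact h2 j (by simp [hj])
        · by_cases hri : r = dst i
          · rw [hri, hti]; exact h2 i (by simp)
          · rw [ht r hri]
            exact h3 r fun k hk => by
              rcases List.mem_cons.1 hk with rfl | hk
              exacts [hri, hr k hk]
  have := Fintype.ofFinite ι
  obtain ⟨p, hp⟩ := key Finset.univ.toList
  refine ⟨p, fun {d x s s'} => ?_⟩
  rw [hp]
  simp [eq_comm]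

theorem exists_guess {ι : Type} [Finite ι] (dst : ι → ρ) :
    ∃ p : RegularExpression (Atom ρ), ∀ {d : ℕ} {x : List Bool} {s s' : ℕ × (ρ → U d x)},
      Exec x p s s' ↔ s'.1 = s.1 ∧ ∀ r ∉ Set.range dst, s'.2 r = s.2 r := by
  classical
  have key : ∀ L : List ι, ∃ p : RegularExpression (Atom ρ), ∀ {d : ℕ} {x : List Bool}
      {s s' : ℕ × (ρ → U d x)}, Exec x p s s' ↔ s'.1 = s.1 ∧
        ∀ r, (∀ i ∈ L, r ≠ dst i) → s'.2 r = s.2 r := by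
    intro L
    induction L with
    | nil =>
      refine ⟨1, fun {d x s s'} => ?_⟩
      rw [exec_one]
      simp [Prod.ext_iff, funext_iff]
    | cons i L ih =>
      obtain ⟨p, hp⟩ := ih
      refine ⟨.char (.guess (dst i)) * p, fun {d x s s'} => ?_⟩
      simp only [exec_mul, exec_char, hp, Atom.Sem]
      constructor
      · rintro ⟨t, ⟨h1, h2⟩, h4, h6⟩
        exact ⟨h4.trans h1, fun r hr =>
          (h6 r fun k hk => hr k (by simp [hk])).trans (h2 r (hr i (by simp)))⟩
      · rintro ⟨h1, h3⟩
        refine ⟨(s.1, Function.update s.2 (dst i) (s'.2 (dst i))),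
          ⟨rfl, fun r hr => Function.update_of_ne hr _ _⟩, h1, fun r hr => ?_⟩
        by_cases hri : r = dst i
        · simp [hri]
        · simp only [Function.update_of_ne hri]
          exact h3 r fun k hk => by
            rcases List.mem_cons.1 hk with rfl | hk
            exacts [hri, hr k hk]
  have := Fintype.ofFinite ι
  obtain ⟨p, hp⟩ := key Finset.univ.toList
  refine ⟨p, fun {d x s s'} => ?_⟩
  rw [hp]
  simp [eq_comm]

theorem exists_test {ι : Type} [Finite ι] (a b : ι → ρ) :
    ∃ p : RegularExpression (Atom ρ), ∀ {d : ℕ} {x : List Bool} {s s' : ℕ × (ρ → U d x)},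
      Exec x p s s' ↔ s' = s ∧ ∀ i, s.2 (a i) = s.2 (b i) := by
  have key : ∀ L : List ι, ∃ p : RegularExpression (Atom ρ), ∀ {d : ℕ} {x : List Bool}
      {s s' : ℕ × (ρ → U d x)}, Exec x p s s' ↔ s' = s ∧ ∀ i ∈ L, s.2 (a i) = s.2 (b i) := by
    intro L
    induction L with
    | nil => exact ⟨1, by simp [exec_one]⟩
    | cons i L ih =>
      obtain ⟨p, hp⟩ := ih
      refine ⟨.char (.eq (a i) (b i)) * p, fun {d x s s'} => ?_⟩
      simp only [exec_mul, exec_char, hp, Atom.Sem, Fin.val_inj, List.forall_mem_cons]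
      constructor
      · rintro ⟨t, ⟨rfl, h⟩, rfl, h'⟩; exact ⟨rfl, h, h'⟩
      · rintro ⟨rfl, h, h'⟩; exact ⟨_, ⟨rfl, h⟩, rfl, h'⟩
  have := Fintype.ofFinite ι
  obtain ⟨p, hp⟩ := key Finset.univ.toList
  exact ⟨p, fun {d x s s'} => by rw [hp]; simp⟩

end Exec

/-- The program `p` with local registers `τ` decides the predicate `P` nondeterministically. -/
def Computes {ι τ : Type} {d : ℕ} (p : RegularExpression (Atom (ι ⊕ τ)))
    (P : ∀ x, (ι → U d x) → Prop) : Prop :=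
  ∀ (x : List Bool) (s : ℕ × (ι ⊕ τ → U d x)), (∃ s', Exec x p s s') ↔ P x (s.2 ∘ Sum.inl)

/-- Call by value: the arguments are copied into a private frame, the image of `g`, and the program
runs there. The caller's other registers survive, so calls can be sequenced and iterated. -/
theorem Computes.exists_call {ι τ ρ : Type} [Finite ι] {d : ℕ}
    {p : RegularExpression (Atom (ι ⊕ τ))} {P : ∀ x, (ι → U d x) → Prop} (hp : Computes p P)
    (f : ι → ρ) (g : ι ⊕ τ → ρ) (hg : g.Injective) (hfg : ∀ i j, f i ≠ g j) :
    ∃ c : RegularExpression (Atom ρ), ∀ x (s : ℕ × (ρ → U d x)),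
      ((∃ s', Exec x c s s') ↔ P x (s.2 ∘ f)) ∧
      ∀ s', Exec x c s s' → ∀ r ∉ Set.range g, s'.2 r = s.2 r := by
  obtain ⟨c, hc⟩ := exists_copy f (g ∘ Sum.inl) (hg.comp Sum.inl_injective) fun i j => hfg _ _
  have hsub : ∀ r, r ∉ Set.range g → r ∉ Set.range (g ∘ Sum.inl) := by
    rintro r hr ⟨i, rfl⟩; exact hr ⟨_, rfl⟩
  refine ⟨c * p.map (Atom.map g), fun x s => ⟨?_, ?_⟩⟩
  · simp only [exec_mul, hc, exec_map hg]
    constructor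
    · rintro ⟨s', t, ⟨-, h1, -⟩, h2, -⟩
      have := (hp x _).1 ⟨_, h2⟩
      convert this using 1
      funext i; exact (h1 i).symm
    · intro h
      classical
      let t : ℕ × (ρ → U d x) := (s.1, Function.extend (g ∘ Sum.inl) (s.2 ∘ f) s.2)
      have ht : t.2 ∘ g ∘ Sum.inl = s.2 ∘ f :=
        extend_comp_self (hg.comp Sum.inl_injective) _ _
      obtain ⟨s', hs'⟩ := (hp x (t.1, t.2 ∘ g)).2 (by
        rw [show (t.1, t.2 ∘ g).2 ∘ Sum.inl = s.2 ∘ f from ht]; exact h)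
      refine ⟨(s'.1, Function.extend g s'.2 t.2), t, ⟨rfl, congrFun ht, fun r hr =>
        Function.extend_apply' _ _ _ hr⟩, ?_, fun r hr => Function.extend_apply' _ _ _ hr⟩
      simpa [extend_comp_self hg] using hs'
  · simp only [exec_mul, hc, exec_map hg]
    rintro s' ⟨t, ⟨-, -, h1⟩, -, h2⟩ r hr
    rw [h2 r hr, h1 r (hsub r hr)]

/-! ### Definable predicates -/

/-- The predicates on tuples of numbers that are definable by transitive closure logic without
negation over the input word. -/
inductive NLDef (d : ℕ) : ∀ {ι : Type}, (∀ x, (ι → U d x) → Prop) → Prop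
  | zero {ι : Type} (i : ι) : NLDef d (fun _ (v : ι → _) => (v i : ℕ) = 0)
  | top {ι : Type} (i : ι) : NLDef d (fun x (v : ι → _) => (v i : ℕ) + 1 = bound d x)
  | eq {ι : Type} (i j : ι) : NLDef d (fun _ (v : ι → _) => v i = v j)
  | succ {ι : Type} (i j : ι) : NLDef d (fun _ (v : ι → _) => (v i : ℕ) + 1 = v j)
  | letter {ι : Type} (i : ι) (s : InputCell Bool) :
      NLDef d (fun x (v : ι → _) => readInput x (v i) = s)
  | and {ι : Type} {P Q : ∀ x, (ι → U d x) → Prop} (hP : NLDef d P) (hQ : NLDef d Q) :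
      NLDef d (fun x v => P x v ∧ Q x v)
  | or {ι : Type} {P Q : ∀ x, (ι → U d x) → Prop} (hP : NLDef d P) (hQ : NLDef d Q) :
      NLDef d (fun x v => P x v ∨ Q x v)
  | ex {ι κ : Type} [Finite κ] {P : ∀ x, (ι ⊕ κ → U d x) → Prop} (hP : NLDef d P) :
      NLDef d (fun x v => ∃ w : κ → U d x, P x (Sum.elim v w))
  | tc {ι κ : Type} [Finite κ] {P : ∀ x, (ι ⊕ (κ ⊕ κ) → U d x) → Prop} (hP : NLDef d P) :
      NLDef d (fun x (v : ι ⊕ (κ ⊕ κ) → U d x) => Relation.ReflTransGen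
        (fun a b : κ → U d x => P x (Sum.elim (fun i => v (.inl i)) (Sum.elim a b)))
        (fun k => v (.inr (.inl k))) (fun k => v (.inr (.inr k))))
  | subst {ι κ : Type} [Finite ι] {P : ∀ x, (ι → U d x) → Prop} (f : ι → κ) (hP : NLDef d P) :
      NLDef d (fun x v => P x (fun i => v (f i)))

/-! ### Programs for all definable predicates. -/

section Programs

variable {d : ℕ} {ι κ : Type}

/-- There is a program deciding `P`. -/
def HasProgram (P : ∀ x, (ι → U d x) → Prop) : Prop :=
  ∃ τ : Type, Finite τ ∧ ∃ p : RegularExpression (Atom (ι ⊕ τ)), Computes p P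

theorem HasProgram.test (a : Atom (ι ⊕ Empty)) {P : ∀ x, (ι → U d x) → Prop}
    (h : ∀ x (s s' : ℕ × (ι ⊕ Empty → U d x)), a.Sem x s s' ↔ s' = s ∧ P x (s.2 ∘ Sum.inl)) :
    HasProgram P :=
  ⟨Empty, inferInstance, .char a, fun x s => by simp [exec_char, h]⟩

theorem readInput_eq_leftEnd {S : Type*} {x : List S} {i : ℕ} :
    readInput x i = .leftEnd ↔ i = 0 := by
  cases i with
  | zero => simp [readInput]
  | succ i => simp only [readInput]; cases x[i]? <;> simp

theorem readInput_min {S : Type*} (x : List S) (i : ℕ) :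
    readInput x (min i (x.length + 1)) = readInput x i := by
  rcases le_total i (x.length + 1) with h | h
  · rw [min_eq_left h]
  · rw [min_eq_right h, readInput_eq_rightEnd.2 (by omega), readInput_eq_rightEnd.2 (by omega)]

/-- Rewind the input head to the left marker, then advance it while counting in `a` until the count
equals the argument. The head saturates at the right marker, but so does `readInput`. -/
theorem HasProgram.letter (i : ι) (c : InputCell Bool) :
    HasProgram (d := d) (fun x (v : ι → _) => readInput x (v i) = c) := by
  let a : ι ⊕ Bool := .inr false
  let b : ι ⊕ Bool := .inr true
  let body : RegularExpression (Atom (ι ⊕ Bool)) := .char (.move .right) * .char (.guess b) *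
    .char (.succ a b) * .char (.guess a) * .char (.eq a b)
  have hbody : ∀ x (s s' : ℕ × (ι ⊕ Bool → U d x)), Exec x body s s' ↔
      s'.1 = min (s.1 + 1) (x.length + 1) ∧ (s.2 a : ℕ) + 1 = s'.2 a ∧ s'.2 b = s'.2 a ∧
        ∀ j, s'.2 (.inl j) = s.2 (.inl j) := by
    intro x s s'
    simp only [body, exec_mul, exec_char, Atom.Sem]
    constructor
    · rintro ⟨t, ⟨t1, ⟨t2, ⟨t3, ⟨h1, h2⟩, h3, h4⟩, rfl, h5⟩, h6, h7⟩, rfl, h8⟩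
      rw [Fin.val_inj] at h8
      have e1 : t1.2 b = s'.2 b := (h7 b (by simp [a, b])).symm
      have e2 : t1.2 a = s.2 a := by rw [h4 a (by simp [a, b]), h2]
      rw [e2, e1, ← h8] at h5
      refine ⟨by rw [h6, h3, h1]; rfl, h5, h8.symm, fun j => ?_⟩
      rw [h7 _ (by simp [a]), h4 _ (by simp [b]), h2]
    · rintro ⟨h1, h2, h3, h4⟩
      classical
      refine ⟨s', ⟨(s'.1, Function.update s.2 b (s'.2 b)), ⟨(s'.1, Function.update s.2 b (s'.2 b)),
        ⟨(s'.1, s.2), ⟨h1, rfl⟩, rfl, fun r hr => Function.update_of_ne hr _ _⟩, rfl, ?_⟩,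
        rfl, ?_⟩, rfl, by rw [h3]⟩
      · simp only [Function.update_self]
        rw [Function.update_of_ne (by simp [a, b]), h2, h3]
      · rintro (j | _ | _) hr
        · simp [b, h4]
        · exact absurd rfl hr
        · exact (Function.update_self (f := s.2) b (s'.2 b)).symm
  refine ⟨Bool, inferInstance, .char (.guess a) * .char (.zero a) * (RegularExpression.char (.move .left)).star *
    .char (.read .leftEnd) * body.star * .char (.eq (.inl i) a) * .char (.read c), fun x s => ?_⟩
  simp only [exec_mul, exec_char, Atom.Sem, exec_star]
  constructor
  · rintro ⟨s', t, ⟨t1, ⟨t2, ⟨t3, ⟨t4, ⟨t5, ⟨h1, h2⟩, rfl, h3⟩, h4⟩, rfl, h5⟩, h6⟩, rfl, h7⟩, rfl, h8⟩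
    have e1 : t2.2 = t4.2 := by
      clear h5 h6
      induction h4 with
      | refl => rfl
      | tail _ h ih => rw [(exec_char.1 h).2, ih]
    rw [readInput_eq_leftEnd] at h5
    have e2 : s'.1 = min (s'.2 a : ℕ) (x.length + 1) ∧ ∀ j, s'.2 (.inl j) = t2.2 (.inl j) := by
      clear h7 h8
      induction h6 with
      | refl => rw [e1, h3, h5]; simp
      | tail _ h ih =>
        obtain ⟨g1, g2, g3, g4⟩ := (hbody _ _ _).1 h
        refine ⟨?_, fun j => by rw [g4, ih.2]⟩
        rw [g1, ih.1, ← g2]; omega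
    rw [e2.1, readInput_min, ← h7, e2.2, e1, h2 _ (by simp [a])] at h8
    exact h8
  · intro h
    classical
    let v (m : U d x) : ι ⊕ Bool → U d x := Sum.elim (s.2 ∘ Sum.inl) fun _ => m
    -- Before the first round `b` still has its old value; afterwards `a` and `b` agree. Hence the
    -- case distinction on `m = 0`.
    have key : ∀ m : ℕ, (hm : m < bound d x) → Relation.ReflTransGen (Exec x body)
        (0, Function.update s.2 a 0) (min m (x.length + 1), if m = 0 then Function.update s.2 a 0 else v ⟨m, hm⟩) := by
      intro m
      induction m with
      | zero => intro _; simp; exact .refl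
      | succ m ih =>
        intro hm
        refine (ih (by omega)).tail ((hbody _ _ _).2 ⟨?_, ?_, ?_, ?_⟩)
        · simp only; omega
        · by_cases hm0 : m = 0 <;> simp [hm0, v, a]
        · simp [v, a, b]
        · by_cases hm0 : m = 0 <;> simp [hm0, v, a]
    have h0 : ∀ k, Relation.ReflTransGen (Exec x (RegularExpression.char (.move .left)))
        (k, Function.update s.2 a 0) (0, Function.update s.2 a 0) := by
      intro k
      induction k using Nat.strong_induction_on with
      | _ k ih =>
        rcases Nat.eq_zero_or_pos k with rfl | hk
        · exact .refl
        · exact .head (b := (min (k - 1) (x.length + 1), _)) (exec_char.2 ⟨rfl, rfl⟩)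
            (ih _ (by omega))
    refine ⟨_, _, ⟨_, ⟨_, ⟨_, ⟨_, ⟨(s.1, Function.update s.2 a 0), ⟨rfl, fun r hr =>
      Function.update_of_ne hr _ _⟩, rfl, by simp⟩, h0 _⟩, rfl, by simp [readInput]⟩,
      key (s.2 (.inl i)) (s.2 (.inl i)).2⟩, rfl, ?_⟩, rfl, ?_⟩
    · split_ifs with hi
      · simp [hi, a]
      · simp [v, a]
    · rw [readInput_min]; exact h

theorem HasProgram.and [Finite ι] {P Q : ∀ x, (ι → U d x) → Prop} (hP : HasProgram P)
    (hQ : HasProgram Q) : HasProgram (fun x v => P x v ∧ Q x v) := by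
  obtain ⟨τ₁, _, p, hp⟩ := hP
  obtain ⟨τ₂, _, q, hq⟩ := hQ
  obtain ⟨c₁, h₁⟩ := hp.exists_call (ρ := ι ⊕ ((ι ⊕ τ₁) ⊕ (ι ⊕ τ₂))) Sum.inl
    (fun i => .inr (.inl i)) (fun _ _ h => by simpa using h) (by simp)
  obtain ⟨c₂, h₂⟩ := hq.exists_call (ρ := ι ⊕ ((ι ⊕ τ₁) ⊕ (ι ⊕ τ₂))) Sum.inl
    (fun i => .inr (.inr i)) (fun _ _ h => by simpa using h) (by simp)
  refine ⟨_, inferInstance, c₁ * c₂, fun x s => ?_⟩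
  simp only [exec_mul]
  have key : ∀ t, Exec x c₁ s t → t.2 ∘ Sum.inl = s.2 ∘ Sum.inl := fun t h =>
    funext fun i => (h₁ x s).2 t h _ (by simp)
  constructor
  · rintro ⟨s', t, h1, h2⟩
    have := (h₂ x t).1.1 ⟨_, h2⟩
    rw [key t h1] at this
    exact ⟨(h₁ x s).1.1 ⟨_, h1⟩, this⟩
  · rintro ⟨h1, h2⟩
    obtain ⟨t, ht⟩ := (h₁ x s).1.2 h1
    rw [← key t ht] at h2
    obtain ⟨s', hs'⟩ := (h₂ x t).1.2 h2
    exact ⟨s', t, ht, hs'⟩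

theorem HasProgram.or [Finite ι] {P Q : ∀ x, (ι → U d x) → Prop} (hP : HasProgram P)
    (hQ : HasProgram Q) : HasProgram (fun x v => P x v ∨ Q x v) := by
  obtain ⟨τ₁, _, p, hp⟩ := hP
  obtain ⟨τ₂, _, q, hq⟩ := hQ
  obtain ⟨c₁, h₁⟩ := hp.exists_call (ρ := ι ⊕ ((ι ⊕ τ₁) ⊕ (ι ⊕ τ₂))) Sum.inl
    (fun i => .inr (.inl i)) (fun _ _ h => by simpa using h) (by simp)
  obtain ⟨c₂, h₂⟩ := hq.exists_call (ρ := ι ⊕ ((ι ⊕ τ₁) ⊕ (ι ⊕ τ₂))) Sum.inl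
    (fun i => .inr (.inr i)) (fun _ _ h => by simpa using h) (by simp)
  refine ⟨_, inferInstance, c₁ + c₂, fun x s => ?_⟩
  simp only [exec_add, exists_or, (h₁ x s).1, (h₂ x s).1]

theorem HasProgram.subst [Finite ι] {P : ∀ x, (ι → U d x) → Prop} (f : ι → κ)
    (hP : HasProgram P) : HasProgram (fun x v => P x (fun i => v (f i))) := by
  obtain ⟨τ, _, p, hp⟩ := hP
  obtain ⟨c, h⟩ := hp.exists_call (ρ := κ ⊕ (ι ⊕ τ)) (fun i => .inl (f i)) .inr
    Sum.inr_injective (by simp)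
  exact ⟨_, inferInstance, c, fun x s => (h x s).1⟩

/-- The existential quantifier is nondeterminism: the witness is guessed into local registers. -/
theorem HasProgram.ex [Finite ι] [Finite κ] {P : ∀ x, (ι ⊕ κ → U d x) → Prop}
    (hP : HasProgram P) : HasProgram (fun x v => ∃ w : κ → U d x, P x (Sum.elim v w)) := by
  obtain ⟨τ, _, p, hp⟩ := hP
  obtain ⟨c, hc⟩ := hp.exists_call (ρ := ι ⊕ (κ ⊕ ((ι ⊕ κ) ⊕ τ)))
    (Sum.elim .inl fun k => .inr (.inl k)) (fun i => .inr (.inr i))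
    (fun _ _ h => by simpa using h) (by rintro (i | i) j <;> simp)
  obtain ⟨g, hg⟩ := exists_guess (fun k : κ => (.inr (.inl k) : ι ⊕ (κ ⊕ ((ι ⊕ κ) ⊕ τ))))
  refine ⟨_, inferInstance, g * c, fun x s => ?_⟩
  simp only [exec_mul, hg]
  constructor
  · rintro ⟨s', t, ⟨-, h1⟩, h2⟩
    refine ⟨fun k => t.2 (.inr (.inl k)), ?_⟩
    have := (hc x t).1.1 ⟨_, h2⟩
    convert this using 1
    funext i
    rcases i with i | i
    · exact (h1 (.inl i) (by simp)).symm
    · rfl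
  · rintro ⟨w, hw⟩
    let t : ℕ × (ι ⊕ (κ ⊕ ((ι ⊕ κ) ⊕ τ)) → U d x) :=
      (s.1, Sum.elim (s.2 ∘ Sum.inl) (Sum.elim w fun i => s.2 (.inr (.inr i))))
    obtain ⟨s', hs'⟩ := (hc x t).1.2 (by
      convert hw using 1
      funext i; rcases i with i | i <;> rfl)
    refine ⟨s', t, ⟨rfl, ?_⟩, hs'⟩
    rintro (r | r | r) hr
    · rfl
    · exact absurd ⟨r, rfl⟩ hr
    · rfl

/-- The registers of the program computing a transitive closure. -/
abbrev TCReg (ι κ τ : Type) : Type := (ι ⊕ (κ ⊕ κ)) ⊕ ((κ ⊕ κ) ⊕ ((ι ⊕ (κ ⊕ κ)) ⊕ τ))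

/-- A path is guessed vertex by vertex, with only the current and the next vertex in memory: guess
`nxt`, check the edge, copy `nxt` to `cur`, and finally compare `cur` with the target. -/
theorem HasProgram.tc [Finite ι] [Finite κ] {P : ∀ x, (ι ⊕ (κ ⊕ κ) → U d x) → Prop}
    (hP : HasProgram P) :
    HasProgram (fun x (v : ι ⊕ (κ ⊕ κ) → U d x) => Relation.ReflTransGen
      (fun a b : κ → U d x => P x (Sum.elim (fun i => v (.inl i)) (Sum.elim a b)))
      (fun k => v (.inr (.inl k))) (fun k => v (.inr (.inr k)))) := by
  obtain ⟨τ, _, p, hp⟩ := hP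
  let par : ι → TCReg ι κ τ := fun i => .inl (.inl i)
  let src : κ → TCReg ι κ τ := fun k => .inl (.inr (.inl k))
  let dst : κ → TCReg ι κ τ := fun k => .inl (.inr (.inr k))
  let cur : κ → TCReg ι κ τ := fun k => .inr (.inl (.inl k))
  let nxt : κ → TCReg ι κ τ := fun k => .inr (.inl (.inr k))
  obtain ⟨c, hc⟩ := hp.exists_call (ρ := TCReg ι κ τ) (Sum.elim par (Sum.elim cur nxt))
    (fun i => .inr (.inr i)) (fun _ _ h => by simpa using h) (by rintro (i | i | i) j <;> simp [par, cur, nxt])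
  obtain ⟨g, hg⟩ := exists_guess nxt
  obtain ⟨c₁, h₁⟩ := exists_copy src cur (fun _ _ h => by simpa [cur] using h) (by simp [src, cur])
  obtain ⟨c₂, h₂⟩ := exists_copy nxt cur (fun _ _ h => by simpa [cur] using h) (by simp [nxt, cur])
  obtain ⟨e, he⟩ := exists_test cur dst
  refine ⟨_, inferInstance, c₁ * (g * c * c₂).star * e, fun x s => ?_⟩
  simp only [exec_mul, exec_star, h₁, he]
  set R := fun a b : κ → U d x =>
    P x (Sum.elim (fun i => (s.2 ∘ Sum.inl) (.inl i)) (Sum.elim a b)) with hR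
  have hbody : ∀ t t' : ℕ × (TCReg ι κ τ → U d x), (∀ i, t.2 (par i) = s.2 (par i)) →
      Exec x (g * c * c₂) t t' → R (t.2 ∘ cur) (t'.2 ∘ cur) ∧ ∀ r, t'.2 (.inl r) = t.2 (.inl r) := by
    intro t t' hpar h
    simp only [exec_mul, hg, h₂] at h
    obtain ⟨t₂, ⟨t₁, ⟨-, g1⟩, g2⟩, -, g3, g4⟩ := h
    have g5 := (hc x t₁).2 _ g2
    have g6 := (hc x t₁).1.1 ⟨_, g2⟩
    refine ⟨?_, fun r => ?_⟩
    · convert g6 using 1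
      funext i
      rcases i with i | k | k
      · exact (hpar i).symm.trans (g1 _ (by simp [nxt, par])).symm
      · exact (g1 _ (by simp [nxt, cur])).symm
      · exact (g3 k).trans (g5 _ (by simp [nxt]))
    · rw [g4 _ (by simp [cur]), g5 _ (by simp), g1 _ (by simp [nxt])]
  have hbody' : ∀ (t : ℕ × (TCReg ι κ τ → U d x)) (b : κ → U d x), (∀ i, t.2 (par i) = s.2 (par i)) →
      R (t.2 ∘ cur) b → ∃ t', Exec x (g * c * c₂) t t' ∧ t'.2 ∘ cur = b := by
    intro t b hpar h
    let t₁ : ℕ × (TCReg ι κ τ → U d x) := (t.1, Sum.elim (fun i => t.2 (.inl i))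
      (Sum.elim (Sum.elim (t.2 ∘ cur) b) fun i => t.2 (.inr (.inr i))))
    obtain ⟨t₂, ht₂⟩ := (hc x t₁).1.2 (by
      convert h using 1
      funext i
      rcases i with i | k | k
      · exact hpar i
      · rfl
      · rfl)
    let t₃ : ℕ × (TCReg ι κ τ → U d x) := (t₂.1, Sum.elim (fun i => t₂.2 (.inl i))
      (Sum.elim (Sum.elim (t₂.2 ∘ nxt) (t₂.2 ∘ nxt)) fun i => t₂.2 (.inr (.inr i))))
    have h5 := (hc x t₁).2 _ ht₂
    simp only [exec_mul, hg, h₂]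
    refine ⟨t₃, ⟨t₂, ⟨t₁, ⟨rfl, ?_⟩, ht₂⟩, rfl, fun k => rfl, ?_⟩, ?_⟩
    · rintro (r | (r | r) | r) hr
      · rfl
      · rfl
      · exact absurd ⟨r, rfl⟩ hr
      · rfl
    · rintro (r | (r | r) | r) hr
      · rfl
      · exact absurd ⟨r, rfl⟩ hr
      · rfl
      · rfl
    · funext k
      exact h5 (nxt k) (by simp [nxt])
  constructor
  · rintro ⟨s', t, ⟨u, ⟨-, g1, g2⟩, g3⟩, ht, g4⟩
    subst ht
    have g2' : ∀ r, u.2 (.inl r) = s.2 (.inl r) := fun r => g2 _ (by simp [cur])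
    have : Relation.ReflTransGen R (u.2 ∘ cur) (s'.2 ∘ cur) ∧ ∀ r, s'.2 (.inl r) = s.2 (.inl r) := by
      clear g4
      induction g3 with
      | refl => exact ⟨.refl, g2'⟩
      | tail _ h ih =>
        obtain ⟨k1, k2⟩ := hbody _ _ (fun i => ih.2 _) h
        exact ⟨ih.1.tail k1, fun r => (k2 r).trans (ih.2 r)⟩
    convert this.1 using 1
    · funext k; exact (g1 k).symm
    · funext k; exact ((g4 k).trans (this.2 _)).symm
  · intro h
    let u : ℕ × (TCReg ι κ τ → U d x) := (s.1, Sum.elim (fun i => s.2 (.inl i))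
      (Sum.elim (Sum.elim (s.2 ∘ src) (s.2 ∘ nxt)) fun i => s.2 (.inr (.inr i))))
    have : ∀ b, Relation.ReflTransGen R (s.2 ∘ src) b → ∃ t, Relation.ReflTransGen
        (Exec x (g * c * c₂)) u t ∧ t.2 ∘ cur = b ∧ ∀ r, t.2 (.inl r) = s.2 (.inl r) := by
      intro b hb
      induction hb with
      | refl => exact ⟨u, .refl, rfl, fun _ => rfl⟩
      | tail _ hR ih =>
        obtain ⟨t, k1, rfl, k3⟩ := ih
        obtain ⟨t', k4, k5⟩ := hbody' t _ (fun i => k3 _) hR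
        exact ⟨t', k1.tail k4, k5, fun r =>
          ((hbody t t' (fun i => k3 _) k4).2 r).trans (k3 r)⟩
    obtain ⟨t, k1, k2, k3⟩ := this _ h
    refine ⟨t, t, ⟨u, ⟨rfl, fun _ => rfl, ?_⟩, k1⟩, rfl, fun k => (congrFun k2 k).trans (k3 _).symm⟩
    rintro (r | (r | r) | r) hr
    · rfl
    · exact absurd ⟨r, rfl⟩ hr
    · rfl
    · rfl

theorem NLDef.hasProgram {P : ∀ x, (ι → U d x) → Prop} (h : NLDef d P) :
    ∀ [Finite ι], HasProgram P := by
  induction h with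
  | zero i => intro _; exact .test (.zero (.inl i)) fun _ _ _ => Iff.rfl
  | top i => intro _; exact .test (.top (.inl i)) fun _ _ _ => Iff.rfl
  | eq i j => intro _; exact .test (.eq (.inl i) (.inl j)) fun _ _ _ => by simp [Atom.Sem, Fin.val_inj]
  | succ i j => intro _; exact .test (.succ (.inl i) (.inl j)) fun _ _ _ => Iff.rfl
  | letter i s => intro _; exact .letter i s
  | and _ _ h1 h2 => intro _; exact h1.and h2
  | or _ _ h1 h2 => intro _; exact h1.or h2
  | ex _ h => intro _; exact h.ex
  | @tc ι κ _ P _ h =>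
    intro _
    have : Finite ι := Finite.of_injective (fun i => (.inl i : ι ⊕ (κ ⊕ κ))) Sum.inl_injective
    exact h.tc
  | subst f _ h => intro _; exact h.subst f

/-- The predicate ignores its variable, so the program's success does not depend on the initial
registers, as `inNL_of_program` demands. -/
theorem inNL_of_nlDef (d : ℕ) (X : Language Bool)
    (h : NLDef d (fun x (_ : Unit → U d x) => x ∈ X)) : InNL X := by
  obtain ⟨τ, _, p, hp⟩ := h.hasProgram
  exact inNL_of_program d p X fun x v => by
    exact (hp x (x.length + 1, v)).symm.trans ⟨fun ⟨s, w, hw, hs⟩ => ⟨w, hw, s, hs⟩, fun ⟨w, hw, s, hs⟩ => ⟨s, w, hw, hs⟩⟩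

end Programs

end RegReal

/-! ### Closure properties of definable predicates -/

namespace RegReal

section Basic

variable {d : ℕ} {ι κ μ : Type}

/-- `t` maps a tuple of variables to a tuple consisting of some of these variables. -/
def IsVars (t : ∀ x, (κ → U d x) → ι → U d x) : Prop := ∃ f : ι → κ, ∀ x v i, t x v i = v (f i)

theorem IsVars.var (f : ι → κ) : IsVars (fun x (v : κ → U d x) i => v (f i)) :=
  ⟨f, fun _ _ _ => rfl⟩

theorem IsVars.elim {t : ∀ x, (κ → U d x) → ι → U d x} {u : ∀ x, (κ → U d x) → μ → U d x}
    (ht : IsVars t) (hu : IsVars u) : IsVars (fun x v => Sum.elim (t x v) (u x v)) := by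
  obtain ⟨f, hf⟩ := ht
  obtain ⟨g, hg⟩ := hu
  exact ⟨Sum.elim f g, by rintro x v (i | i) <;> simp [hf, hg]⟩

theorem NLDef.comp [Finite ι] {P : ∀ x, (ι → U d x) → Prop} (hP : NLDef d P)
    {t : ∀ x, (κ → U d x) → ι → U d x} (ht : IsVars t) : NLDef d (fun x v => P x (t x v)) := by
  obtain ⟨f, hf⟩ := ht
  have : (fun x v => P x (t x v)) = fun x (v : κ → U d x) => P x (fun i => v (f i)) := by
    funext x v; congr 1; funext i; exact hf x v i
  rw [this]
  exact hP.subst f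

theorem NLDef.exists [Finite κ] {Q : ∀ x, (ι → U d x) → (κ → U d x) → Prop}
    (h : NLDef d (fun x (v : ι ⊕ κ → U d x) => Q x (fun i => v (.inl i)) (fun k => v (.inr k)))) :
    NLDef d (fun x v => ∃ w, Q x v w) := h.ex

theorem NLDef.exists₁ {Q : ∀ x, (ι → U d x) → U d x → Prop}
    (h : NLDef d (fun x (v : ι ⊕ Unit → U d x) => Q x (fun i => v (.inl i)) (v (.inr ())))) :
    NLDef d (fun x v => ∃ u, Q x v u) := by
  have : (fun x v => ∃ u, Q x v u) = fun x v => ∃ w : Unit → U d x, Q x v (w ()) := by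
    funext x v
    exact propext ⟨fun ⟨u, h⟩ => ⟨fun _ => u, h⟩, fun ⟨w, h⟩ => ⟨_, h⟩⟩
  rw [this]
  exact h.ex

theorem NLDef.path [Finite κ] {Q : ∀ x, (ι → U d x) → (κ → U d x) → (κ → U d x) → Prop}
    (h : NLDef d (fun x (v : ι ⊕ (κ ⊕ κ) → U d x) =>
      Q x (fun i => v (.inl i)) (fun k => v (.inr (.inl k))) (fun k => v (.inr (.inr k))))) :
    NLDef d (fun x (v : ι ⊕ (κ ⊕ κ) → U d x) => Relation.ReflTransGen (Q x (fun i => v (.inl i)))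
      (fun k => v (.inr (.inl k))) (fun k => v (.inr (.inr k)))) := h.tc

theorem NLDef.verum : NLDef d (fun x (_ : ι → U d x) => True) := by
  have : (fun x (_ : ι → U d x) => True) = fun x _ => ∃ u : U d x, (u : ℕ) = 0 := by
    funext x v; simp
  rw [this]
  exact .exists₁ (.zero _)

theorem NLDef.falsum : NLDef d (fun x (_ : ι → U d x) => False) := by
  have : (fun x (_ : ι → U d x) => False) = fun x _ => ∃ u : U d x, (u : ℕ) + 1 = u := by
    funext x v; simp
  rw [this]
  exact .exists₁ (.succ _ _)

theorem NLDef.const (p : Prop) : NLDef d (fun x (_ : ι → U d x) => p) := by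
  by_cases h : p
  · simpa [h] using NLDef.verum
  · simpa [h] using NLDef.falsum

theorem NLDef.finset_or {J : Type*} (s : Finset J) {P : J → ∀ x, (ι → U d x) → Prop}
    (h : ∀ j ∈ s, NLDef d (P j)) : NLDef d (fun x v => ∃ j ∈ s, P j x v) := by
  classical
  induction s using Finset.induction_on with
  | empty => simpa using NLDef.falsum
  | insert a s ha ih =>
    have := (h a (by simp)).or (ih fun j hj => h j (by simp [hj]))
    simpa using this

theorem NLDef.finset_and {J : Type*} (s : Finset J) {P : J → ∀ x, (ι → U d x) → Prop}
    (h : ∀ j ∈ s, NLDef d (P j)) : NLDef d (fun x v => ∀ j ∈ s, P j x v) := by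
  classical
  induction s using Finset.induction_on with
  | empty => simpa using NLDef.verum
  | insert a s ha ih =>
    have := (h a (by simp)).and (ih fun j hj => h j (by simp [hj]))
    simpa using this

theorem NLDef.existsFinite {J : Type*} [Finite J] {P : J → ∀ x, (ι → U d x) → Prop}
    (h : ∀ j, NLDef d (P j)) : NLDef d (fun x v => ∃ j, P j x v) := by
  have := Fintype.ofFinite J
  simpa using NLDef.finset_or Finset.univ fun j _ => h j

theorem NLDef.forallFinite {J : Type*} [Finite J] {P : J → ∀ x, (ι → U d x) → Prop}
    (h : ∀ j, NLDef d (P j)) : NLDef d (fun x v => ∀ j, P j x v) := by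
  have := Fintype.ofFinite J
  simpa using NLDef.finset_and Finset.univ fun j _ => h j

theorem reflTransGen_succ {N : ℕ} {a b : Unit → Fin N} :
    Relation.ReflTransGen (fun a b : Unit → Fin N => (a () : ℕ) + 1 = b ()) a b ↔ a () ≤ b () := by
  constructor
  · intro h
    induction h with
    | refl => exact le_rfl
    | tail _ h ih => rw [Fin.le_def] at *; omega
  · intro h
    obtain ⟨k, hk⟩ := Nat.exists_eq_add_of_le (Fin.le_def.1 h)
    induction k generalizing b with
    | zero =>
      obtain rfl : a = b := funext fun i => Fin.ext hk.symm
      exact .refl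
    | succ k ih =>
      have hb := (b ()).2
      exact .tail (ih (b := fun _ => ⟨a () + k, by omega⟩) (Fin.le_def.2 (by simp)) rfl)
        (by simp only; omega)

theorem NLDef.le (i j : ι) : NLDef d (fun x (v : ι → U d x) => v i ≤ v j) := by
  have h := (NLDef.path (d := d) (ι := Empty) (κ := Unit)
    (Q := fun x _ a b => (a () : ℕ) + 1 = b ()) (.succ _ _)).comp (κ := ι)
    (.elim (.var Empty.elim) (.elim (.var fun _ => i) (.var fun _ => j)))
  simp only [reflTransGen_succ] at h
  exact h

theorem NLDef.lt (i j : ι) : NLDef d (fun x (v : ι → U d x) => v i < v j) := by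
  have : (fun x (v : ι → U d x) => v i < v j) =
      fun x v => ∃ u : U d x, (v i : ℕ) + 1 = u ∧ u ≤ v j := by
    funext x v
    refine propext ⟨fun h => ⟨⟨v i + 1, lt_of_le_of_lt (Fin.lt_def.1 h) (v j).2⟩, rfl, h⟩, ?_⟩
    rintro ⟨u, h1, h2⟩
    rw [Fin.lt_def, Fin.le_def] at *; omega
  rw [this]
  exact .exists₁ (.and (.succ _ _) (.le _ _))

/-- Linearity of the order expresses inequality positively. Inductive counting needs it before
closure under negation is available. -/
theorem NLDef.ne (i j : ι) : NLDef d (fun x (v : ι → U d x) => v i ≠ v j) := by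
  simpa only [ne_iff_lt_or_gt] using (NLDef.lt i j).or (.lt j i)

theorem NLDef.eqTuple [Finite μ] (f g : μ → ι) :
    NLDef d (fun x (v : ι → U d x) => (fun k => v (f k)) = fun k => v (g k)) := by
  simpa only [funext_iff] using NLDef.forallFinite fun k => .eq (f k) (g k)

theorem NLDef.neTuple [Finite μ] (f g : μ → ι) :
    NLDef d (fun x (v : ι → U d x) => (fun k => v (f k)) ≠ fun k => v (g k)) := by
  simpa only [Function.ne_iff] using NLDef.existsFinite fun k => .ne (f k) (g k)

end Basic

/-! ### Numbering of tuples -/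

section Num

variable {N : ℕ}

/-- The number with base-`N` digits `a`. -/
def digitNum : ∀ {k : ℕ}, (Fin k → Fin N) → ℕ
  | 0, _ => 0
  | _ + 1, a => a 0 + N * digitNum fun i => a i.succ

theorem digitNum_lt {k : ℕ} (a : Fin k → Fin N) : digitNum a < N ^ k := by
  induction k with
  | zero => simp [digitNum]
  | succ k ih =>
    have h1 := ih fun i => a i.succ
    have h2 := (a 0).2
    simp only [digitNum, pow_succ]
    nlinarith

theorem digitNum_inj {k : ℕ} {a b : Fin k → Fin N} (h : digitNum a = digitNum b) : a = b := by
  induction k with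
  | zero => exact funext fun i => i.elim0
  | succ k ih =>
    obtain ⟨h1, h2⟩ := (digit_ext (a 0).2 (b 0).2).1 h
    have := ih h2
    funext i
    refine Fin.cases (Fin.ext h1) (fun i => congrFun this i) i

theorem exists_digitNum {k m : ℕ} (h : m < N ^ k) : ∃ a : Fin k → Fin N, digitNum a = m := by
  induction k generalizing m with
  | zero => exact ⟨Fin.elim0, by simp [digitNum] at *; omega⟩
  | succ k ih =>
    have hN : 0 < N := Nat.pos_of_ne_zero (by rintro rfl; simp at h)
    obtain ⟨a, ha⟩ := ih (m := m / N) (by rw [Nat.div_lt_iff_lt_mul hN, ← pow_succ]; exact h)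
    exact ⟨Fin.cons ⟨m % N, Nat.mod_lt _ hN⟩ a, by
      simp only [digitNum, Fin.cons_zero, Fin.cons_succ, ha]; exact Nat.mod_add_div _ _⟩

/-- An increment either raises the lowest digit or resets it and carries. This recursion makes
successor and maximum of tuples definable. -/
theorem digit_succ {m a b a' b' : ℕ} (ha : a < m) (ha' : a' < m) :
    a + m * b + 1 = a' + m * b' ↔
      (a + 1 = a' ∧ b = b') ∨ ((a + 1 = m ∧ a' = 0) ∧ b + 1 = b') := by
  by_cases h : a + 1 < m
  · have := digit_ext (b := b) (b' := b') h ha'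
    rw [show a + m * b + 1 = a + 1 + m * b by ring, this]
    have : a + 1 ≠ m := h.ne
    tauto
  · have h1 : a + 1 = m := by omega
    have := digit_ext (b := b + 1) (b' := b') (a := 0) (m := m) (by omega) ha'
    rw [show a + m * b + 1 = 0 + m * (b + 1) by rw [Nat.mul_add]; omega, this]
    have : a + 1 ≠ a' := by omega
    simp only [h1, eq_comm (a := 0)]
    have : m ≠ a' := by omega
    tauto

/-- The number of a tuple in an enumeration of all tuples. -/
noncomputable def num {κ : Type} [Finite κ] (a : κ → Fin N) : ℕ :=
  digitNum fun i => a ((Finite.equivFin κ).symm i)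

variable {κ : Type} [Finite κ]

theorem num_lt (a : κ → Fin N) : num a < N ^ Nat.card κ := digitNum_lt _

theorem num_inj {a b : κ → Fin N} : num a = num b ↔ a = b := by
  refine ⟨fun h => ?_, congrArg _⟩
  have := digitNum_inj h
  funext i
  simpa using congrFun this (Finite.equivFin κ i)

theorem exists_num {m : ℕ} (h : m < N ^ Nat.card κ) : ∃ a : κ → Fin N, num a = m := by
  obtain ⟨a, ha⟩ := exists_digitNum h
  exact ⟨fun i => a (Finite.equivFin κ i), by simpa [num] using ha⟩

end Num

section NumDef

variable {d : ℕ} {ι κ : Type} [Finite κ]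

theorem NLDef.digitNum_succ {k : ℕ} : NLDef d (fun x (v : Fin k ⊕ Fin k → U d x) =>
    digitNum (fun i => v (.inl i)) + 1 = digitNum (fun i => v (.inr i))) := by
  induction k with
  | zero => simpa [digitNum] using NLDef.falsum
  | succ k ih =>
    have h := ih.comp (κ := Fin (k + 1) ⊕ Fin (k + 1))
      (.elim (.var fun i => .inl i.succ) (.var fun i => .inr i.succ))
    have h2 : NLDef d (fun x (v : Fin (k + 1) ⊕ Fin (k + 1) → U d x) =>
        digitNum (fun i : Fin k => v (.inl i.succ)) = digitNum (fun i : Fin k => v (.inr i.succ))) := by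
      have := NLDef.eqTuple (d := d) (fun i : Fin k => (.inl i.succ : Fin (k + 1) ⊕ Fin (k + 1)))
        (fun i => .inr i.succ)
      convert this using 3
      exact ⟨digitNum_inj, fun h => by rw [h]⟩
    have := ((NLDef.succ (d := d) (.inl 0) (.inr 0)).and h2).or
      (((NLDef.top (d := d) (.inl 0)).and (.zero (.inr 0))).and h)
    convert this using 3 with x v
    exact digit_succ (v (.inl 0)).2 (v (.inr 0)).2

theorem NLDef.digitNum_zero {k : ℕ} : NLDef d (fun x (v : Fin k → U d x) => digitNum v = 0) := by
  induction k with
  | zero => simpa [digitNum] using NLDef.verum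
  | succ k ih =>
    have := (NLDef.zero (d := d) 0).and (ih.comp (.var fun i : Fin k => i.succ))
    convert this using 3 with x v
    simp [digitNum, (bound_pos d x).ne']

theorem NLDef.digitNum_top {k : ℕ} :
    NLDef d (fun x (v : Fin k → U d x) => digitNum v + 1 = bound d x ^ k) := by
  induction k with
  | zero => simpa [digitNum] using NLDef.verum
  | succ k ih =>
    have := (NLDef.top (d := d) 0).and (ih.comp (.var fun i : Fin k => i.succ))
    convert this using 3 with x v
    have h := digit_succ (b := digitNum fun i => v i.succ) (b' := bound d x ^ k)
      (v 0).2 (bound_pos d x)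
    rw [digitNum, pow_succ, mul_comm _ (bound d x)]
    rw [zero_add] at h
    rw [h]
    simp

theorem NLDef.num_succ (f g : κ → ι) :
    NLDef d (fun x (v : ι → U d x) => num (fun i => v (f i)) + 1 = num (fun i => v (g i))) :=
  NLDef.digitNum_succ.comp (.elim (.var fun i => f ((Finite.equivFin κ).symm i))
    (.var fun i => g ((Finite.equivFin κ).symm i)))

theorem NLDef.num_zero (f : κ → ι) :
    NLDef d (fun x (v : ι → U d x) => num (fun i => v (f i)) = 0) :=
  NLDef.digitNum_zero.comp (.var fun i => f ((Finite.equivFin κ).symm i))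

theorem NLDef.num_top (f : κ → ι) : NLDef d (fun x (v : ι → U d x) =>
    num (fun i => v (f i)) + 1 = bound d x ^ Nat.card κ) :=
  NLDef.digitNum_top.comp (.var fun i => f ((Finite.equivFin κ).symm i))

end NumDef

/-! ### Counting -/

section Count

variable {N : ℕ} {κ : Type} [Finite κ]

/-- There is a set of `num c` tuples that all satisfy `A` while all other tuples satisfy `B`. -/
def Counts (A B : (κ → Fin N) → Prop) (c : κ → Fin N) : Prop :=
  ∃ S : Set (κ → Fin N), (∀ w ∈ S, A w) ∧ (∀ w ∉ S, B w) ∧ S.ncard = num c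

/-- The step relation of a procedure that runs through all tuples and counts some of them. -/
def CountStep (A B : (κ → Fin N) → Prop) (a b : κ ⊕ κ → Fin N) : Prop :=
  num (fun i => a (.inl i)) + 1 = num (fun i => b (.inl i)) ∧
    ((A (fun i => a (.inl i)) ∧ num (fun i => a (.inr i)) + 1 = num (fun i => b (.inr i))) ∨
      (B (fun i => a (.inl i)) ∧ (fun i => a (.inr i)) = fun i => b (.inr i)))

/-- The first half of a configuration is a pointer through all tuples, the second half a counter.
`S` is the set of tuples counted before the pointer. -/
theorem reach_countStep {A B : (κ → Fin N) → Prop} {z a : κ ⊕ κ → Fin N}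
    (h0 : num (fun i => z (.inl i)) = 0) (h0' : num (fun i => z (.inr i)) = 0) :
    Relation.ReflTransGen (CountStep A B) z a ↔
      ∃ S : Set (κ → Fin N), (∀ w ∈ S, A w ∧ num w < num (fun i => a (.inl i))) ∧
        (∀ w ∉ S, num w < num (fun i => a (.inl i)) → B w) ∧
        S.ncard = num (fun i => a (.inr i)) := by
  constructor
  · intro h
    induction h with
    | refl => exact ⟨∅, by simp, by simp [h0], by simp [h0']⟩
    | @tail b c _ h ih =>
      obtain ⟨S, h1, h2, h3⟩ := ih
      obtain ⟨h4, ⟨h5, h6⟩ | ⟨h5, h6⟩⟩ := h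
      · refine ⟨insert (fun i => b (.inl i)) S, ?_, ?_, ?_⟩
        · rintro w (rfl | hw)
          · exact ⟨h5, by omega⟩
          · exact ⟨(h1 w hw).1, by have := (h1 w hw).2; omega⟩
        · intro w hw hlt
          rw [Set.mem_insert_iff, not_or] at hw
          refine h2 w hw.2 (lt_of_le_of_ne (by omega) fun h => hw.1 (num_inj.1 h))
        · rw [Set.ncard_insert_of_notMem (fun h => absurd (h1 _ h).2 (lt_irrefl _)), h3, h6]
      · refine ⟨S, fun w hw => ⟨(h1 w hw).1, by have := (h1 w hw).2; omega⟩, ?_, by rw [h3, h6]⟩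
        intro w hw hlt
        by_cases hwb : w = fun i => b (.inl i)
        · exact hwb ▸ h5
        · exact h2 w hw (lt_of_le_of_ne (by omega) fun h => hwb (num_inj.1 h))
  · rintro ⟨S, h1, h2, h3⟩
    generalize hm : num (fun i => a (.inl i)) = m at *
    induction m generalizing a S with
    | zero =>
      obtain rfl : S = ∅ := Set.eq_empty_of_forall_notMem fun w hw => by simpa using (h1 w hw).2
      have e1 := num_inj.1 (h0.trans hm.symm)
      have e2 := num_inj.1 (h0'.trans (by simpa using h3))
      obtain rfl : z = a := by
        funext i
        rcases i with i | i
        exacts [congrFun e1 i, congrFun e2 i]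
      exact .refl
    | succ m ih =>
      have hml : m + 1 < N ^ Nat.card κ := hm ▸ num_lt _
      obtain ⟨w, hw⟩ := exists_num (κ := κ) (N := N) (m := m) (by omega)
      have hS : S = (S ∩ {u | num u < m}) ∪ (S ∩ {w}) := by
        ext u
        simp only [Set.mem_union, Set.mem_inter_iff, Set.mem_ofPred_eq, Set.mem_singleton_iff]
        constructor
        · intro hu
          have := (h1 u hu).2
          rcases Nat.lt_or_ge (num u) m with h | h
          · exact .inl ⟨hu, h⟩
          · exact .inr ⟨hu, num_inj.1 (by omega)⟩
        · rintro (h | h) <;> exact h.1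
      set T := S ∩ {u | num u < m} with hT
      have hTA : ∀ u ∈ T, A u ∧ num u < m := fun u hu => ⟨(h1 u hu.1).1, hu.2⟩
      have hTB : ∀ u ∉ T, num u < m → B u := fun u hu hlt =>
        h2 u (fun h => hu ⟨h, hlt⟩) (by omega)
      by_cases hwS : w ∈ S
      · have hcard : T.ncard + 1 = num fun i => a (.inr i) := by
          rw [← h3, hS, Set.inter_eq_self_of_subset_right (Set.singleton_subset_iff.2 hwS),
            Set.union_singleton, Set.ncard_insert_of_notMem]
          rintro ⟨-, h⟩
          exact absurd hw (ne_of_lt h)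
        -- The smaller count is representable because the final one is.
        obtain ⟨c, hc⟩ := exists_num (κ := κ) (N := N) (m := T.ncard)
          (by have := num_lt fun i => a (.inr i); omega)
        refine .tail (ih (a := Sum.elim w c) T hc.symm hw hTA hTB) ⟨?_, .inl ⟨?_, ?_⟩⟩
        · simp only [Sum.elim_inl, hw, hm]
        · exact (h1 w hwS).1
        · simp only [Sum.elim_inr, hc, hcard]
      · have hcard : T.ncard = num fun i => a (.inr i) := by
          rw [← h3]; congr 1
          rw [hS, Set.inter_singleton_eq_empty.2 hwS, Set.union_empty]
        refine .tail (ih (a := Sum.elim w fun i => a (.inr i)) T hcard hw hTA hTB) ⟨?_, .inr ⟨?_, ?_⟩⟩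
        · simp only [Sum.elim_inl, hw, hm]
        · exact h2 w hwS (by omega)
        · rfl

/-- The pointer cannot pass the last tuple, having no number left for it. The walk therefore stops
there, and the final disjunction treats the last tuple. -/
theorem counts_iff (hN : 0 < N) {A B : (κ → Fin N) → Prop} {c : κ → Fin N} :
    Counts A B c ↔ ∃ z a : κ ⊕ κ → Fin N,
      (num (fun i => z (.inl i)) = 0 ∧ num (fun i => z (.inr i)) = 0) ∧
      num (fun i => a (.inl i)) + 1 = N ^ Nat.card κ ∧
      Relation.ReflTransGen (CountStep A B) z a ∧
      ((A (fun i => a (.inl i)) ∧ num (fun i => a (.inr i)) + 1 = num c) ∨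
        (B (fun i => a (.inl i)) ∧ (fun i => a (.inr i)) = c)) := by
  constructor
  · rintro ⟨S, h1, h2, h3⟩
    have hpos : 0 < N ^ Nat.card κ := by positivity
    obtain ⟨z, hz⟩ := exists_num (κ := κ) (N := N) (m := 0) hpos
    obtain ⟨w, hw⟩ := exists_num (κ := κ) (N := N) (m := N ^ Nat.card κ - 1) (by omega)
    have hmax : ∀ u : κ → Fin N, u = w ∨ num u < num w := fun u => by
      have := num_lt u
      rcases Nat.lt_or_ge (num u) (num w) with h | h
      exacts [.inr h, .inl (num_inj.1 (by omega))]
    by_cases hwS : w ∈ S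
    · have hcard : (S \ {w}).ncard + 1 = num c := by rw [← h3, Set.ncard_sdiff_singleton_add_one hwS]
      obtain ⟨m, hm⟩ := exists_num (κ := κ) (N := N) (m := (S \ {w}).ncard)
        (by have := num_lt c; omega)
      refine ⟨Sum.elim z z, Sum.elim w m, ⟨hz, hz⟩, by simp only [Sum.elim_inl, hw]; omega, ?_,
        .inl ⟨h1 w hwS, by simp only [Sum.elim_inr, hm, hcard]⟩⟩
      refine (reach_countStep hz hz).2 ⟨S \ {w}, fun u hu => ⟨h1 u hu.1, ?_⟩, fun u hu hlt => ?_, hm.symm⟩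
      · exact (hmax u).resolve_left fun h => hu.2 h
      · exact h2 u fun h => hu ⟨h, fun h' => absurd hlt (by rw [Set.mem_singleton_iff.1 h']; simp)⟩
    · refine ⟨Sum.elim z z, Sum.elim w c, ⟨hz, hz⟩, by simp only [Sum.elim_inl, hw]; omega, ?_,
        .inr ⟨h2 w hwS, rfl⟩⟩
      refine (reach_countStep hz hz).2 ⟨S, fun u hu => ⟨h1 u hu, ?_⟩, fun u hu _ => h2 u hu, h3⟩
      exact (hmax u).resolve_left fun h => hwS (h ▸ hu)
  · rintro ⟨z, a, ⟨hz, hz'⟩, hw, h, h'⟩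
    obtain ⟨S, h1, h2, h3⟩ := (reach_countStep hz hz').1 h
    set w := fun i => a (.inl i) with hwdef
    have hmax : ∀ u : κ → Fin N, u = w ∨ num u < num w := fun u => by
      have := num_lt u
      rcases Nat.lt_or_ge (num u) (num w) with h | h
      exacts [.inr h, .inl (num_inj.1 (by omega))]
    rcases h' with ⟨h4, h5⟩ | ⟨h4, h5⟩
    · refine ⟨insert w S, ?_, fun u hu => ?_, ?_⟩
      · rintro u (rfl | hu)
        exacts [h4, (h1 u hu).1]
      · rw [Set.mem_insert_iff, not_or] at hu
        exact h2 u hu.2 ((hmax u).resolve_left hu.1)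
      · rw [Set.ncard_insert_of_notMem (fun h => absurd (h1 _ h).2 (lt_irrefl _)), h3, h5]
    · refine ⟨S, fun u hu => (h1 u hu).1, fun u hu => ?_, by rw [h3, h5]⟩
      rcases hmax u with rfl | h
      exacts [h4, h2 u hu h]

end Count

/-! ### Definability of counting and universal quantification. -/

section CountDef

variable {d : ℕ} {ι κ μ ν : Type} [Finite ι] [Finite κ] [Finite ν]

theorem NLDef.at {A : ∀ x, (ι → U d x) → (κ → U d x) → Prop}
    (hA : NLDef d (fun x (v : ι ⊕ κ → U d x) => A x (fun i => v (.inl i)) (fun k => v (.inr k))))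
    (f : ι → μ) (g : κ → μ) :
    NLDef d (fun x (v : μ → U d x) => A x (fun i => v (f i)) (fun k => v (g k))) :=
  hA.subst (Sum.elim f g)

theorem NLDef.at₂ {A : ∀ x, (ι → U d x) → (κ → U d x) → (ν → U d x) → Prop}
    (hA : NLDef d (fun x (v : ι ⊕ (κ ⊕ ν) → U d x) =>
      A x (fun i => v (.inl i)) (fun k => v (.inr (.inl k))) (fun k => v (.inr (.inr k)))))
    (f : ι → μ) (g : κ → μ) (h : ν → μ) :
    NLDef d (fun x (v : μ → U d x) =>
      A x (fun i => v (f i)) (fun k => v (g k)) (fun k => v (h k))) :=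
  hA.subst (Sum.elim f (Sum.elim g h))

theorem NLDef.counts {A B : ∀ x, (ι → U d x) → (κ → U d x) → Prop}
    (hA : NLDef d (fun x (v : ι ⊕ κ → U d x) => A x (fun i => v (.inl i)) (fun k => v (.inr k))))
    (hB : NLDef d (fun x (v : ι ⊕ κ → U d x) => B x (fun i => v (.inl i)) (fun k => v (.inr k)))) :
    NLDef d (fun x (v : ι ⊕ κ → U d x) =>
      Counts (A x (fun i => v (.inl i))) (B x (fun i => v (.inl i))) (fun k => v (.inr k))) := by
  have hstep : NLDef d (fun x (v : ι ⊕ ((κ ⊕ κ) ⊕ (κ ⊕ κ)) → U d x) =>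
      Relation.ReflTransGen (CountStep (A x (fun i => v (.inl i))) (B x (fun i => v (.inl i))))
        (fun k => v (.inr (.inl k))) (fun k => v (.inr (.inr k)))) :=
    .path (Q := fun x p => CountStep (A x p) (B x p)) (.and (.num_succ _ _)
      (.or (.and (hA.at _ _) (.num_succ _ _)) (.and (hB.at _ _) (.eqTuple _ _))))
  simp only [counts_iff (bound_pos d _)]
  refine .exists (.exists (.and (.and (.num_zero _) (.num_zero _)) (.and (.num_top _)
    (.and (NLDef.at₂ (A := fun x p => Relation.ReflTransGen (CountStep (A x p) (B x p))) hstep _ _ _)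
      (.or (.and (hA.at _ _) (.num_succ _ _)) (.and (hB.at _ _) (.eqTuple _ _)))))))

/-- With an unsatisfiable condition for counted tuples, counting forces every tuple to satisfy `Q`.
A sequential scan thus replaces the universal quantifier. -/
theorem NLDef.forall {Q : ∀ x, (ι → U d x) → (κ → U d x) → Prop}
    (h : NLDef d (fun x (v : ι ⊕ κ → U d x) => Q x (fun i => v (.inl i)) (fun k => v (.inr k)))) :
    NLDef d (fun x v => ∀ w, Q x v w) := by
  have key : (fun x v => ∀ w, Q x v w) =
      fun x (v : ι → U d x) => ∃ c : κ → U d x, num c = 0 ∧ Counts (fun _ => False) (Q x v) c := by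
    funext x v
    refine propext ⟨fun h => ?_, ?_⟩
    · obtain ⟨z, hz⟩ := exists_num (κ := κ) (N := bound d x) (m := 0)
        (pow_pos (bound_pos d x) _)
      exact ⟨z, hz, ∅, by simp, fun w _ => h w, by simp [hz]⟩
    · rintro ⟨c, -, S, h1, h2, -⟩ w
      exact h2 w fun h => h1 w h
  rw [key]
  exact .exists (.and (.num_zero _) (NLDef.counts (A := fun _ _ _ => False) .falsum h))

end CountDef

end RegReal

/-! ### Definable predicates are closed under negation -/

namespace RegReal

section InductiveCounting

variable {N : ℕ} {κ : Type} [Finite κ]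

/-- `t` is reachable from `s` in at most `n` steps. -/
def Within {α : Type*} (E : α → α → Prop) (s : α) : ℕ → α → Prop
  | 0, t => s = t
  | n + 1, t => ∃ w, Within E s n w ∧ (w = t ∨ E w t)

section Within

variable {α : Type*} {E : α → α → Prop} {s t : α}

theorem Within.succ {n : ℕ} (h : Within E s n t) : Within E s (n + 1) t := ⟨t, h, .inl rfl⟩

theorem Within.mono {n m : ℕ} (hnm : n ≤ m) (h : Within E s n t) : Within E s m t := by
  induction hnm with
  | refl => exact h
  | step _ ih => exact ih.succ

theorem Within.reach {n : ℕ} (h : Within E s n t) : Relation.ReflTransGen E s t := by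
  induction n generalizing t with
  | zero => exact h ▸ .refl
  | succ n ih =>
    obtain ⟨w, hw, rfl | h⟩ := h
    exacts [ih hw, (ih hw).tail h]

theorem exists_within (h : Relation.ReflTransGen E s t) : ∃ n, Within E s n t := by
  induction h with
  | refl => exact ⟨0, rfl⟩
  | tail _ h ih =>
    obtain ⟨n, hn⟩ := ih
    exact ⟨n + 1, _, hn, .inr h⟩

theorem within_of_stable {k : ℕ} (h : ∀ u, Within E s (k + 1) u → Within E s k u) {m : ℕ}
    (ht : Within E s m t) : Within E s k t := by
  induction m generalizing t with
  | zero => exact ht.mono (Nat.zero_le _)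
  | succ m ih =>
    obtain ⟨w, hw, h'⟩ := ht
    exact h t ⟨w, ih hw, h'⟩

/-- The balls around `s` grow strictly until one round adds nothing, and then they are stationary;
strict growth can last for fewer than `Nat.card α` rounds. -/
theorem within_card [Finite α] (h : Relation.ReflTransGen E s t) :
    Within E s (Nat.card α) t := by
  obtain ⟨m, hm⟩ := exists_within h
  have key : ∀ n, n + 1 ≤ {u | Within E s n u}.ncard ∨
      ∃ k < n, ∀ u, Within E s (k + 1) u → Within E s k u := by
    intro n
    induction n with
    | zero =>
      left
      rw [zero_add, Nat.one_le_iff_ne_zero, Ne, Set.ncard_eq_zero, ← Ne, ← Set.nonempty_iff_ne_empty]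
      exact ⟨s, rfl⟩
    | succ n ih =>
      rcases ih with ih | ⟨k, hk, h⟩
      · by_cases hs : ∀ u, Within E s (n + 1) u → Within E s n u
        · exact .inr ⟨n, by omega, hs⟩
        · left
          push Not at hs
          obtain ⟨u, hu, hu'⟩ := hs
          have : {u | Within E s n u} ⊂ {u | Within E s (n + 1) u} :=
            ⟨fun _ h => Within.succ h, fun h => hu' (h hu)⟩
          have := Set.ncard_lt_ncard this
          omega
      · exact .inr ⟨k, by omega, h⟩
  rcases key (Nat.card α) with h | ⟨k, hk, h⟩
  · have := Set.ncard_le_card {u | Within E s (Nat.card α) u}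
    omega
  · exact (within_of_stable h hm).mono hk.le

end Within

variable {E : (κ → Fin N) → (κ → Fin N) → Prop} {s : κ → Fin N}

/-- One step of a walk that counts its length. -/
def ClockStep (E : (κ → Fin N) → (κ → Fin N) → Prop) (a b : κ ⊕ κ → Fin N) : Prop :=
  num (fun i => a (.inl i)) + 1 = num (fun i => b (.inl i)) ∧
    ((fun i => a (.inr i)) = (fun i => b (.inr i)) ∨ E (fun i => a (.inr i)) fun i => b (.inr i))

theorem reach_clockStep {z a : κ ⊕ κ → Fin N} (hz : num (fun i => z (.inl i)) = 0) :
    Relation.ReflTransGen (ClockStep E) z a ↔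
      Within E (fun i => z (.inr i)) (num fun i => a (.inl i)) fun i => a (.inr i) := by
  constructor
  · intro h
    induction h with
    | refl => rw [hz]; rfl
    | tail _ h ih =>
      rw [← h.1]
      exact ⟨_, ih, h.2⟩
  · intro h
    generalize hn : num (fun i => a (.inl i)) = n at h
    induction n generalizing a with
    | zero =>
      have e1 := num_inj.1 (hz.trans hn.symm)
      obtain rfl : z = a := by
        funext i
        rcases i with i | i
        exacts [congrFun e1 i, congrFun h i]
      exact .refl
    | succ n ih =>
      obtain ⟨w, hw, h'⟩ := h
      obtain ⟨c, hc⟩ := exists_num (κ := κ) (N := N) (m := n)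
        (by have := num_lt fun i => a (.inl i); omega)
      exact .tail (ih (a := Sum.elim c w) hc hw) ⟨by simp only [Sum.elim_inl, hc, hn], h'⟩

/-- If `c` is the number of elements within distance `i` of `s`, then `u` is not within distance
`i + 1`. -/
def NotNext (E : (κ → Fin N) → (κ → Fin N) → Prop) (s i c u : κ → Fin N) : Prop :=
  Counts (fun w => Within E s (num i) w ∧ w ≠ u ∧ ¬ E w u) (fun _ => True) c

/-- If the inductive counting knows the number of elements within distance `i` of `s`,
then it finds the number of elements within distance `i + 1`. -/
def CensusStep (E : (κ → Fin N) → (κ → Fin N) → Prop) (s : κ → Fin N)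
    (a b : κ ⊕ κ → Fin N) : Prop :=
  num (fun i => a (.inl i)) + 1 = num (fun i => b (.inl i)) ∧
    Counts (Within E s (num fun i => b (.inl i)))
      (NotNext E s (fun i => a (.inl i)) (fun i => a (.inr i))) (fun i => b (.inr i))

/-- The heart of inductive counting: a subset of the ball having the cardinality of the ball is the
whole ball. Listing that many members, none equal or adjacent to `u`, is a positive certificate of
absence. -/
theorem notNext_iff {i c u : κ → Fin N} (hc : num c = {w | Within E s (num i) w}.ncard) :
    NotNext E s i c u ↔ ¬ Within E s (num i + 1) u := by
  constructor
  · rintro ⟨S, h1, -, h3⟩ ⟨w, hw, h⟩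
    have hS : S = {w | Within E s (num i) w} :=
      Set.eq_of_subset_of_ncard_le (fun w hw => (h1 w hw).1) (by rw [h3, hc])
    have := h1 w (hS ▸ hw)
    tauto
  · intro h
    refine ⟨{w | Within E s (num i) w}, fun w hw => ⟨hw, ?_, ?_⟩, fun _ _ => trivial, hc.symm⟩
    · rintro rfl
      exact h (Within.succ hw)
    · exact fun h' => h ⟨w, hw, .inr h'⟩

/-- A configuration of the census pairs a radius with the size of the ball of that radius. It starts
with radius zero and size one. -/
theorem not_reach_iff (hN : 0 < N) {t : κ → Fin N} :
    ¬ Relation.ReflTransGen E s t ↔ ∃ z c : κ ⊕ κ → Fin N,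
      num (fun i => z (.inl i)) = 0 ∧
      num (fun i => z (.inl i)) + 1 = num (fun i => z (.inr i)) ∧
      num (fun i => c (.inl i)) + 1 = N ^ Nat.card κ ∧
      Relation.ReflTransGen (CensusStep E s) z c ∧
      NotNext E s (fun i => c (.inl i)) (fun i => c (.inr i)) t := by
  have hone : {w | Within E s 0 w}.ncard = 1 := by
    rw [Set.ncard_eq_one]
    exact ⟨s, by ext w; exact eq_comm⟩
  have hcard : Nat.card (κ → Fin N) = N ^ Nat.card κ := by simp [Nat.card_fun]
  constructor
  · intro h
    -- Since `t` lies in no ball, every ball is proper, and its size is representable by a tuple.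
    have hlt : ∀ n, {w | Within E s n w}.ncard < N ^ Nat.card κ := fun n => by
      rw [← hcard, ← Set.ncard_univ]
      exact Set.ncard_lt_ncard ⟨Set.subset_univ _, fun h' => h (Within.reach (h' (Set.mem_univ t)))⟩
    have hpos : 0 < N ^ Nat.card κ := by positivity
    obtain ⟨z, hz⟩ := exists_num (κ := κ) (N := N) hpos
    obtain ⟨o, ho⟩ := exists_num (κ := κ) (N := N) (hlt 0)
    have key : ∀ n < N ^ Nat.card κ, ∃ c : κ ⊕ κ → Fin N, num (fun i => c (.inl i)) = n ∧
        num (fun i => c (.inr i)) = {w | Within E s n w}.ncard ∧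
        Relation.ReflTransGen (CensusStep E s) (Sum.elim z o) c := by
      intro n hn
      induction n with
      | zero => exact ⟨Sum.elim z o, hz, ho, .refl⟩
      | succ n ih =>
        obtain ⟨c, h1, h2, h3⟩ := ih (by omega)
        obtain ⟨i, hi⟩ := exists_num (κ := κ) (N := N) hn
        obtain ⟨m, hm⟩ := exists_num (κ := κ) (N := N) (hlt (n + 1))
        refine ⟨Sum.elim i m, hi, hm, h3.tail ⟨by simp only [Sum.elim_inl, h1, hi],
          {w | Within E s (n + 1) w}, fun w hw => ?_, fun w hw => ?_, hm.symm⟩⟩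
        · simp only [Sum.elim_inl, hi]; exact hw
        · rw [notNext_iff (by rw [h2, h1]), h1]; exact hw
    obtain ⟨c, h1, h2, h3⟩ := key (N ^ Nat.card κ - 1) (by omega)
    refine ⟨Sum.elim z o, c, hz, ?_, by omega, h3, ?_⟩
    · simp only [Sum.elim_inl, Sum.elim_inr, hz, ho, hone]
    · rw [notNext_iff (by rw [h2, h1])]
      exact fun h' => h h'.reach
  · rintro ⟨z, c, hz, hz', hc, hr, hn⟩ h
    have key : num (fun i => c (.inr i)) = {w | Within E s (num fun i => c (.inl i)) w}.ncard := by
      clear hn hc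
      induction hr with
      | refl => rw [hz, hone, ← hz', hz]
      | tail _ h ih =>
        obtain ⟨h1, S, h2, h3, h4⟩ := h
        rw [← h4]
        congr 1
        ext w
        refine ⟨h2 w, fun hw => by_contra fun hS => ?_⟩
        have := (notNext_iff ih).1 (h3 w hS)
        rw [h1] at this
        exact this hw
    refine (notNext_iff key).1 hn ?_
    -- The census stops at radius `N ^ Nat.card κ - 1`; the extra step of `NotNext` reaches the
    -- number of tuples, at which every reachable vertex is found.
    rw [hc, ← hcard]
    exact within_card h

end InductiveCounting

/-! ### Definability of the census and closure under negation. -/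

section Negation

variable {d : ℕ} {ι κ μ ν ξ : Type} [Finite ι] [Finite κ] [Finite ν] [Finite ξ]

theorem NLDef.at₃ {A : ∀ x, (ι → U d x) → (κ → U d x) → (ν → U d x) → (ξ → U d x) → Prop}
    (hA : NLDef d (fun x (v : ι ⊕ (κ ⊕ (ν ⊕ ξ)) → U d x) =>
      A x (fun i => v (.inl i)) (fun k => v (.inr (.inl k))) (fun k => v (.inr (.inr (.inl k))))
        (fun k => v (.inr (.inr (.inr k))))))
    (f : ι → μ) (g : κ → μ) (h : ν → μ) (k : ξ → μ) :
    NLDef d (fun x (v : μ → U d x) =>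
      A x (fun i => v (f i)) (fun k => v (g k)) (fun k => v (h k)) (fun i => v (k i))) :=
  hA.subst (Sum.elim f (Sum.elim g (Sum.elim h k)))

theorem NLDef.within {E : ∀ x, (ι → U d x) → (κ → U d x) → (κ → U d x) → Prop}
    (hE : NLDef d (fun x (v : ι ⊕ (κ ⊕ κ) → U d x) =>
      E x (fun i => v (.inl i)) (fun k => v (.inr (.inl k))) (fun k => v (.inr (.inr k)))))
    (s : κ → ι) : NLDef d (fun x (v : ι ⊕ (κ ⊕ κ) → U d x) =>
    Within (E x (fun i => v (.inl i))) (fun k => v (.inl (s k))) (num fun k => v (.inr (.inl k)))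
      (fun k => v (.inr (.inr k)))) := by
  have hstep : NLDef d (fun x (v : ι ⊕ ((κ ⊕ κ) ⊕ (κ ⊕ κ)) → U d x) =>
      Relation.ReflTransGen (ClockStep (E x (fun i => v (.inl i))))
        (fun k => v (.inr (.inl k))) (fun k => v (.inr (.inr k)))) :=
    .path (Q := fun x p => ClockStep (E x p))
      (.and (.num_succ _ _) (.or (.eqTuple _ _) (NLDef.at₂ hE _ _ _)))
  have key : ∀ x (v : ι ⊕ (κ ⊕ κ) → U d x), Within (E x (fun i => v (.inl i)))
      (fun k => v (.inl (s k))) (num fun k => v (.inr (.inl k))) (fun k => v (.inr (.inr k))) ↔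
      ∃ z : κ → U d x, num z = 0 ∧ Relation.ReflTransGen (ClockStep (E x (fun i => v (.inl i))))
        (Sum.elim z fun k => v (.inl (s k))) (fun k => v (.inr k)) := by
    intro x v
    constructor
    · intro h
      obtain ⟨z, hz⟩ := exists_num (κ := κ) (N := bound d x) (pow_pos (bound_pos d x) _)
      exact ⟨z, hz, (reach_clockStep hz).2 h⟩
    · rintro ⟨z, hz, h⟩
      exact (reach_clockStep hz).1 h
  simp only [key]
  refine .exists (.and (.num_zero _) ?_)
  have := hstep.subst (κ := (ι ⊕ (κ ⊕ κ)) ⊕ κ) (Sum.elim (fun i => Sum.inl (Sum.inl i))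
    (Sum.elim (Sum.elim (fun k => Sum.inr k) fun k => Sum.inl (Sum.inl (s k)))
      fun k => Sum.inl (Sum.inr k)))
  convert this using 3 with x v
  refine iff_of_eq (congrFun (congrArg (Relation.ReflTransGen _) (funext fun k => ?_)) _)
  rcases k with k | k <;> rfl

theorem NLDef.notNext {E : ∀ x, (ι → U d x) → (κ → U d x) → (κ → U d x) → Prop}
    (hE : NLDef d (fun x (v : ι ⊕ (κ ⊕ κ) → U d x) =>
      E x (fun i => v (.inl i)) (fun k => v (.inr (.inl k))) (fun k => v (.inr (.inr k)))))
    (hE' : NLDef d (fun x (v : ι ⊕ (κ ⊕ κ) → U d x) =>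
      ¬ E x (fun i => v (.inl i)) (fun k => v (.inr (.inl k))) (fun k => v (.inr (.inr k)))))
    (s : κ → ι) : NLDef d (fun x (v : ι ⊕ (κ ⊕ (κ ⊕ κ)) → U d x) =>
    NotNext (E x (fun i => v (.inl i))) (fun k => v (.inl (s k))) (fun k => v (.inr (.inl k)))
      (fun k => v (.inr (.inr (.inl k)))) (fun k => v (.inr (.inr (.inr k))))) := by
  have h := NLDef.counts (d := d) (ι := ι ⊕ (κ ⊕ κ)) (κ := κ)
    (A := fun x p w => Within (E x (fun i => p (.inl i))) (fun k => p (.inl (s k)))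
      (num fun k => p (.inr (.inl k))) w ∧ w ≠ (fun k => p (.inr (.inr k))) ∧
      ¬ E x (fun i => p (.inl i)) w (fun k => p (.inr (.inr k))))
    (B := fun _ _ _ => True)
    (.and (NLDef.at₂ (A := fun x p i u => Within (E x p) (fun k => p (s k)) (num i) u)
      (NLDef.within hE s) _ _ _) (.and (.neTuple _ _)
      (NLDef.at₂ (A := fun x p u w => ¬ E x p u w) hE' _ _ _))) .verum
  exact h.subst (Sum.elim (Sum.elim Sum.inl (Sum.elim (fun k => Sum.inr (Sum.inl k))
    fun k => Sum.inr (Sum.inr (Sum.inr k)))) fun k => Sum.inr (Sum.inr (Sum.inl k)))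

theorem NLDef.not_path {E : ∀ x, (ι → U d x) → (κ → U d x) → (κ → U d x) → Prop}
    (hE : NLDef d (fun x (v : ι ⊕ (κ ⊕ κ) → U d x) =>
      E x (fun i => v (.inl i)) (fun k => v (.inr (.inl k))) (fun k => v (.inr (.inr k)))))
    (hE' : NLDef d (fun x (v : ι ⊕ (κ ⊕ κ) → U d x) =>
      ¬ E x (fun i => v (.inl i)) (fun k => v (.inr (.inl k))) (fun k => v (.inr (.inr k)))))
    (s t : κ → ι) : NLDef d (fun x (v : ι → U d x) =>
    ¬ Relation.ReflTransGen (E x v) (fun k => v (s k)) (fun k => v (t k))) := by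
  have hnext : ∀ {μ : Type} (f : ι → μ) (i c u : κ → μ), NLDef d (fun x (v : μ → U d x) =>
      NotNext (E x (fun i => v (f i))) (fun k => v (f (s k))) (fun k => v (i k))
        (fun k => v (c k)) (fun k => v (u k))) :=
    NLDef.at₃ (A := fun x p i c u => NotNext (E x p) (fun k => p (s k)) i c u)
      (NLDef.notNext hE hE' s)
  have hwithin : ∀ {μ : Type} (f : ι → μ) (i u : κ → μ), NLDef d (fun x (v : μ → U d x) =>
      Within (E x (fun i => v (f i))) (fun k => v (f (s k))) (num fun k => v (i k))
        (fun k => v (u k))) :=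
    NLDef.at₂ (A := fun x p i u => Within (E x p) (fun k => p (s k)) (num i) u)
      (NLDef.within hE s)
  have hcensus : NLDef d (fun x (v : ι ⊕ ((κ ⊕ κ) ⊕ (κ ⊕ κ)) → U d x) =>
      CensusStep (E x (fun i => v (.inl i))) (fun k => v (.inl (s k)))
        (fun k => v (.inr (.inl k))) (fun k => v (.inr (.inr k)))) := by
    refine .and (.num_succ _ _) ?_
    have := NLDef.counts (d := d) (ι := ι ⊕ (κ ⊕ (κ ⊕ κ))) (κ := κ)
      (A := fun x p w => Within (E x (fun i => p (.inl i))) (fun k => p (.inl (s k)))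
        (num fun k => p (.inr (.inr (.inr k)))) w)
      (B := fun x p w => NotNext (E x (fun i => p (.inl i))) (fun k => p (.inl (s k)))
        (fun k => p (.inr (.inl k))) (fun k => p (.inr (.inr (.inl k)))) w)
      (hwithin _ _ _) (hnext _ _ _ _)
    exact this.subst (Sum.elim (Sum.elim Sum.inl (Sum.elim (fun k => Sum.inr (Sum.inl (Sum.inl k)))
      (Sum.elim (fun k => Sum.inr (Sum.inl (Sum.inr k))) fun k => Sum.inr (Sum.inr (Sum.inl k)))))
      fun k => Sum.inr (Sum.inr (Sum.inr k)))
  simp only [not_reach_iff (bound_pos d _)]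
  exact .exists (.exists (.and (.num_zero _) (.and (.num_succ _ _) (.and (.num_top _)
    (.and (NLDef.at₂ (A := fun x p => Relation.ReflTransGen (CensusStep (E x p) fun k => p (s k)))
      (NLDef.path (Q := fun x p => CensusStep (E x p) fun k => p (s k)) hcensus) _ _ _) (hnext _ _ _ _))))))

/-- Negated atoms are expressed through existence of neighbours, the order, or a different letter. A
negated quantifier is handled by `NLDef.forall`, a negated closure by `NLDef.not_path`, where the
induction hypothesis supplies the negated edge relation. -/
theorem NLDef.not {P : ∀ x, (ι → U d x) → Prop} (h : NLDef d P) :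
    NLDef d (fun x v => ¬ P x v) := by
  have hfin : Finite ι := inferInstance
  revert hfin
  induction h with
  | zero i =>
    intro _
    have : (fun x (v : _ → U d x) => ¬ (v i : ℕ) = 0) =
        fun x v => ∃ u : U d x, (u : ℕ) + 1 = v i := by
      funext x v
      refine propext ⟨fun h => ⟨⟨v i - 1, by have := (v i).2; omega⟩, by simp only; omega⟩, ?_⟩
      rintro ⟨u, hu⟩
      omega
    rw [this]
    exact .exists₁ (.succ _ _)
  | top i =>
    intro _
    have : (fun x (v : _ → U d x) => ¬ (v i : ℕ) + 1 = bound d x) =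
        fun x v => ∃ u : U d x, (v i : ℕ) + 1 = u := by
      funext x v
      refine propext ⟨fun h => ⟨⟨v i + 1, by have := (v i).2; omega⟩, rfl⟩, ?_⟩
      rintro ⟨u, hu⟩
      have := u.2
      omega
    rw [this]
    exact .exists₁ (.succ _ _)
  | eq i j => exact fun _ => .ne i j
  | succ i j =>
    intro _
    have : (fun x (v : _ → U d x) => ¬ (v i : ℕ) + 1 = v j) =
        fun x v => (v j : ℕ) = 0 ∨ ∃ u : U d x, (u : ℕ) + 1 = v j ∧ u ≠ v i := by
      funext x v
      refine propext ⟨fun h => ?_, ?_⟩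
      · by_cases hj : (v j : ℕ) = 0
        · exact .inl hj
        · refine .inr ⟨⟨v j - 1, by have := (v j).2; omega⟩, by simp only; omega, fun h' => h ?_⟩
          rw [← h']
          simp only
          omega
      · rintro (h | ⟨u, hu, hne⟩) h'
        · omega
        · exact hne (Fin.ext (by omega))
    rw [this]
    exact .or (.zero _) (.exists₁ (.and (.succ _ _) (.ne _ _)))
  | letter i s =>
    intro _
    have : (fun x (v : _ → U d x) => ¬ readInput x (v i) = s) =
        fun x v => ∃ s' : {s' // s' ≠ s}, readInput x (v i) = s' := by
      funext x v
      simp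
    rw [this]
    exact .existsFinite fun s' => .letter i s'
  | and _ _ ih₁ ih₂ =>
    intro _
    simp only [not_and_or]
    exact .or (ih₁ ‹_›) (ih₂ ‹_›)
  | or _ _ ih₁ ih₂ =>
    intro _
    simp only [not_or]
    exact .and (ih₁ ‹_›) (ih₂ ‹_›)
  | @ex ι κ _ P hP ih =>
    intro _
    simp only [not_exists]
    refine .forall ?_
    convert ih inferInstance using 5 with x v
    rw [← Sum.elim_comp_inl_inr v]
    rfl
  | @tc ι κ _ P hP ih =>
    intro h
    have := Finite.sum_left (β := κ ⊕ κ) (α := ι)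
    have e : ∀ x (v : ι ⊕ (κ ⊕ κ) → U d x), Sum.elim (fun i => v (.inl i))
        (Sum.elim (fun k => v (.inr (.inl k))) fun k => v (.inr (.inr k))) = v := by
      intro x v
      funext i
      rcases i with i | i | i <;> rfl
    refine NLDef.not_path (E := fun x p a b => P x (Sum.elim (fun i => p (Sum.inl i))
      (Sum.elim a b))) ?_ ?_ (fun k => Sum.inr (Sum.inl k)) (fun k => Sum.inr (Sum.inr k))
    · exact NLDef.at₂ (A := fun x p a b => P x (Sum.elim p (Sum.elim a b)))
        (by simpa only [e] using hP) (fun i => Sum.inl (Sum.inl i)) _ _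
    · exact NLDef.at₂ (A := fun x p a b => ¬ P x (Sum.elim p (Sum.elim a b)))
        (by simpa only [e] using ih inferInstance) (fun i => Sum.inl (Sum.inl i)) _ _
  | subst f hP ih => exact fun _ => (ih inferInstance).subst f

end Negation
end RegReal

/-! ### Definable arithmetic -/

namespace RegReal

section Arithmetic

variable {d : ℕ} {ι : Type}

theorem reach_add {N : ℕ} {a b : Bool → Fin N} (ha : (a false : ℕ) = 0) :
    Relation.ReflTransGen (fun a b : Bool → Fin N =>
      (a false : ℕ) + 1 = b false ∧ (a true : ℕ) + 1 = b true) a b ↔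
      (a true : ℕ) + b false = b true := by
  constructor
  · intro h
    induction h with
    | refl => omega
    | tail _ h ih => omega
  · intro h
    generalize hm : (b false : ℕ) = m at h
    induction m generalizing b with
    | zero =>
      obtain rfl : a = b := by
        funext i
        cases i
        exacts [Fin.ext (by omega), Fin.ext (by omega)]
      exact .refl
    | succ m ih =>
      have h1 := (b false).2
      have h2 := (b true).2
      exact .tail (ih (b := fun i => if i then ⟨a true + m, by omega⟩ else ⟨m, by omega⟩) rfl rfl)
        ⟨by simp [hm], by simp; omega⟩

theorem reach_mul {N c : ℕ} {a b : Bool → Fin N} (ha : (a false : ℕ) = 0)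
    (ha' : (a true : ℕ) = 0) :
    Relation.ReflTransGen (fun a b : Bool → Fin N =>
      (a false : ℕ) + 1 = b false ∧ (a true : ℕ) + c = b true) a b ↔
      (b false : ℕ) * c = b true := by
  constructor
  · intro h
    induction h with
    | refl => simp [ha, ha']
    | tail _ h ih => rw [← h.1, ← h.2, add_mul, ih, one_mul]
  · intro h
    generalize hm : (b false : ℕ) = m at h
    induction m generalizing b with
    | zero =>
      obtain rfl : a = b := by
        funext i
        cases i
        exacts [Fin.ext (by omega), Fin.ext (by omega)]
      exact .refl
    | succ m ih =>
      have h1 := (b false).2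
      have h2 := (b true).2
      rw [add_mul, one_mul] at h
      exact .tail (ih (b := fun i => if i then ⟨m * c, by omega⟩ else ⟨m, by omega⟩) rfl rfl)
        ⟨by simp [hm], by simp; omega⟩

/-- Addition is reachability: starting from the pair `(0, v i)`, both entries increase together
until the first is `v j`. Multiplication iterates addition in the same manner. -/
theorem NLDef.add_eq [Finite ι] (i j k : ι) :
    NLDef d (fun x (v : ι → U d x) => (v i : ℕ) + v j = v k) := by
  have hpath := NLDef.path (d := d) (ι := ι) (κ := Bool)
    (Q := fun x _ a b => (a false : ℕ) + 1 = b false ∧ (a true : ℕ) + 1 = b true)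
    (.and (.succ _ _) (.succ _ _))
  have key : ∀ x (v : ι → U d x), (v i : ℕ) + v j = v k ↔
      ∃ a b : Bool → U d x, (a false : ℕ) = 0 ∧ a true = v i ∧ b false = v j ∧ b true = v k ∧
        Relation.ReflTransGen (fun a b : Bool → U d x =>
          (a false : ℕ) + 1 = b false ∧ (a true : ℕ) + 1 = b true) a b := by
    intro x v
    constructor
    · intro h
      exact ⟨fun i' => if i' then v i else ⟨0, bound_pos d x⟩, fun i => if i then v k else v j, rfl,
        rfl, rfl, rfl, (reach_add rfl).2 h⟩
    · rintro ⟨a, b, h0, h1, h2, h3, h⟩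
      rw [← h1, ← h2, ← h3]
      exact (reach_add h0).1 h
  simp only [key]
  exact .exists (.exists (.and (.zero _) (.and (.eq _ _) (.and (.eq _ _) (.and (.eq _ _)
    (hpath.subst (Sum.elim (fun i => Sum.inl (Sum.inl i)) (Sum.elim (fun k => Sum.inl (Sum.inr k))
      fun k => Sum.inr k))))))))

theorem NLDef.mul_eq [Finite ι] (i j k : ι) :
    NLDef d (fun x (v : ι → U d x) => (v i : ℕ) * v j = v k) := by
  have hpath := NLDef.path (d := d) (ι := ι) (κ := Bool)
    (Q := fun x v a b => (a false : ℕ) + 1 = b false ∧ (a true : ℕ) + v j = b true)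
    (.and (.succ _ _) (.add_eq _ _ _))
  have key : ∀ x (v : ι → U d x), (v i : ℕ) * v j = v k ↔
      ∃ a b : Bool → U d x, (a false : ℕ) = 0 ∧ (a true : ℕ) = 0 ∧ b false = v i ∧ b true = v k ∧
        Relation.ReflTransGen (fun a b : Bool → U d x =>
          (a false : ℕ) + 1 = b false ∧ (a true : ℕ) + v j = b true) a b := by
    intro x v
    constructor
    · intro h
      exact ⟨fun _ => ⟨0, bound_pos d x⟩, fun i' => if i' then v k else v i, rfl,
        rfl, rfl, rfl, (reach_mul rfl rfl).2 h⟩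
    · rintro ⟨a, b, h0, h1, h2, h3, h⟩
      rw [← h2, ← h3]
      exact (reach_mul h0 h1).1 h
  simp only [key]
  exact .exists (.exists (.and (.zero _) (.and (.zero _) (.and (.eq _ _) (.and (.eq _ _)
    (hpath.subst (Sum.elim (fun i => Sum.inl (Sum.inl i)) (Sum.elim (fun k => Sum.inl (Sum.inr k))
      fun k => Sum.inr k))))))))

/-- The graph of `t` is definable. The values of `t` may exceed the bound. -/
def NLTerm (d : ℕ) {ι : Type} (t : ∀ x, (ι → U d x) → ℕ) : Prop :=
  NLDef d (fun x (v : ι ⊕ Unit → U d x) => (v (.inr ()) : ℕ) = t x (fun i => v (.inl i)))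

variable {s t : ∀ x, (ι → U d x) → ℕ}

theorem NLTerm.eq [Finite ι] (i : ι) (ht : NLTerm d t) :
    NLDef d (fun x (v : ι → U d x) => (v i : ℕ) = t x v) :=
  ht.subst (Sum.elim id fun _ => i)

theorem NLTerm.exists_eq (ht : NLTerm d t) {P : ∀ x, (ι → U d x) → U d x → Prop}
    (hP : NLDef d (fun x (v : ι ⊕ Unit → U d x) => P x (fun i => v (.inl i)) (v (.inr ())))) :
    NLDef d (fun x (v : ι → U d x) => ∃ u : U d x, (u : ℕ) = t x v ∧ P x v u) :=
  .exists₁ (.and ht hP)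

theorem NLTerm.subst [Finite ι] {κ : Type} (ht : NLTerm d t) (f : ι → κ) :
    NLTerm d (fun x (v : κ → U d x) => t x (fun i => v (f i))) :=
  NLDef.subst (Sum.elim (fun i => Sum.inl (f i)) Sum.inr) ht

theorem NLTerm.var (i : ι) : NLTerm d (fun x (v : ι → U d x) => (v i : ℕ)) := by
  unfold NLTerm
  simp only [← Fin.ext_iff]
  exact .eq _ _

theorem NLTerm.const [Finite ι] (n : ℕ) : NLTerm d (fun x (_ : ι → U d x) => n) := by
  unfold NLTerm
  induction n with
  | zero => exact .zero _
  | succ n ih =>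
    have : (fun x (v : ι ⊕ Unit → U d x) => (v (.inr ()) : ℕ) = n + 1) = fun x v =>
        ∃ u : U d x, (u : ℕ) = n ∧ (u : ℕ) + 1 = v (.inr ()) := by
      funext x v
      refine propext ⟨fun h => ⟨⟨n, by have := (v (.inr ())).2; omega⟩, rfl, h.symm⟩, ?_⟩
      rintro ⟨u, h1, h2⟩
      omega
    rw [this]
    exact .exists₁ (.and (NLDef.subst (κ := (ι ⊕ Unit) ⊕ Unit)
      (Sum.elim (fun i => Sum.inl (Sum.inl i)) fun _ => Sum.inr ()) ih) (.succ _ _))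

theorem NLTerm.add [Finite ι] (hs : NLTerm d s) (ht : NLTerm d t) :
    NLTerm d (fun x v => s x v + t x v) := by
  unfold NLTerm
  have : (fun x (v : ι ⊕ Unit → U d x) => (v (.inr ()) : ℕ) =
      s x (fun i => v (.inl i)) + t x (fun i => v (.inl i))) = fun x v =>
        ∃ a : U d x, (a : ℕ) = s x (fun i => v (.inl i)) ∧ ∃ b : U d x,
          (b : ℕ) = t x (fun i => v (.inl i)) ∧ (a : ℕ) + b = v (.inr ()) := by
    funext x v
    have := (v (.inr ())).2
    refine propext ⟨fun h => ⟨⟨_, by omega⟩, rfl, ⟨_, by omega⟩, rfl, h.symm⟩, ?_⟩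
    rintro ⟨a, h1, b, h2, h3⟩
    omega
  rw [this]
  exact .exists₁ (.and (hs.subst _) (.exists₁ (.and (ht.subst _) (.add_eq _ _ _))))

/-- If the product is positive, both factors are at most the product and can be quantified over. If
it is zero, the other factor may exceed the bound, which requires the second alternative. -/
theorem NLTerm.mul [Finite ι] (hs : NLTerm d s) (ht : NLTerm d t) :
    NLTerm d (fun x v => s x v * t x v) := by
  unfold NLTerm
  have : (fun x (v : ι ⊕ Unit → U d x) => (v (.inr ()) : ℕ) =
      s x (fun i => v (.inl i)) * t x (fun i => v (.inl i))) = fun x v =>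
        (∃ a : U d x, (a : ℕ) = s x (fun i => v (.inl i)) ∧ ∃ b : U d x,
          (b : ℕ) = t x (fun i => v (.inl i)) ∧ (a : ℕ) * b = v (.inr ())) ∨
        (v (.inr ()) : ℕ) = 0 ∧ ∃ z : U d x, (z : ℕ) = 0 ∧
          ((z : ℕ) = s x (fun i => v (.inl i)) ∨ (z : ℕ) = t x (fun i => v (.inl i))) := by
    funext x v
    have hv := (v (.inr ())).2
    refine propext ⟨fun h => ?_, ?_⟩
    · rcases Nat.eq_zero_or_pos (v (.inr ()) : ℕ) with h0 | h0
      · refine .inr ⟨h0, ⟨0, bound_pos d x⟩, rfl, ?_⟩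
        rw [h0, eq_comm, Nat.mul_eq_zero] at h
        exact h.imp Eq.symm Eq.symm
      · have := Nat.le_of_dvd h0 (Dvd.intro _ h.symm)
        have := Nat.le_of_dvd h0 (Dvd.intro_left _ h.symm)
        exact .inl ⟨⟨_, by omega⟩, rfl, ⟨_, by omega⟩, rfl, h.symm⟩
    · rintro (⟨a, h1, b, h2, h3⟩ | ⟨h0, z, hz, h | h⟩)
      · rw [← h1, ← h2, h3]
      · rw [h0, ← h, hz, zero_mul]
      · rw [h0, ← h, hz, mul_zero]
  rw [this]
  exact .or (.exists₁ (.and (hs.subst _) (.exists₁ (.and (ht.subst _) (.mul_eq _ _ _)))))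
    (.and (.zero _) (.exists₁ (.and (.zero _) (.or (hs.subst _) (ht.subst _)))))

theorem NLTerm.lt [Finite ι] (i : ι) (ht : NLTerm d t) :
    NLDef d (fun x (v : ι → U d x) => t x v < v i) := by
  have : (fun x (v : ι → U d x) => t x v < v i) =
      fun x v => ∃ u : U d x, (u : ℕ) = t x v ∧ u < v i := by
    funext x v
    refine propext ⟨fun h => ⟨⟨_, h.trans (v i).2⟩, rfl, h⟩, ?_⟩
    rintro ⟨u, h1, h2⟩
    rwa [← h1]
  rw [this]
  exact ht.exists_eq (.lt _ _)

theorem NLTerm.ge [Finite ι] (i : ι) (ht : NLTerm d t) :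
    NLDef d (fun x (v : ι → U d x) => (v i : ℕ) ≤ t x v) := by
  simpa only [not_lt] using (ht.lt i).not

end Arithmetic

end RegReal

/-! ### Simulating a logarithmic-space machine on a definable input word -/

namespace RegReal

section Tapes

variable {Γ : Type}

/-- The contents of a one-way infinite tape whose first cells contain `l`. -/
def padded (b : Γ) (l : List Γ) (i : ℕ) : Γ := l.getD i b

/-- A tape whose head is at cell `h`, given by the reversed list of the cells left of the head and
a list of cells from the head onwards, followed by blanks. -/
structure IsZipper (b : Γ) (h : ℕ) (f : ℕ → Γ) (L R : List Γ) : Prop where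
  length_eq : L.length = h
  content : f = padded b (L.reverse ++ R)

/-- The new zipper after writing `g` and moving the head. -/
def zipStep (g : Γ) : Move → List Γ → List Γ → List Γ × List Γ
  | .stay, L, R => (L, g :: R.tail)
  | .right, L, R => (g :: L, R.tail)
  | .left, [], R => ([], g :: R.tail)
  | .left, a :: L, R => (L, a :: g :: R.tail)

theorem IsZipper.read {b : Γ} {h : ℕ} {f : ℕ → Γ} {L R : List Γ} (hz : IsZipper b h f L R) :
    f h = R.headD b := by
  obtain ⟨rfl, rfl⟩ := hz
  rcases R with _ | ⟨a, R⟩ <;> simp [padded]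

theorem update_padded (b g : Γ) (L R : List Γ) :
    Function.update (padded b (L ++ R)) L.length g = padded b (L ++ g :: R.tail) := by
  funext i
  rcases lt_trichotomy i L.length with h | rfl | h
  · rw [Function.update_of_ne h.ne]
    simp [padded, List.getElem?_append, h]
  · simp [padded]
  · rw [Function.update_of_ne h.ne']
    simp only [padded, List.getD_eq_getElem?_getD, List.getElem?_append, not_lt.2 h.le, if_false]
    obtain ⟨j, rfl⟩ := Nat.exists_eq_add_of_lt h
    rw [show L.length + j + 1 - L.length = j + 1 by omega]
    cases R <;> simp

theorem IsZipper.step {b : Γ} {h : ℕ} {f : ℕ → Γ} {L R : List Γ} (hz : IsZipper b h f L R)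
    (g : Γ) (m : Move) :
    IsZipper b (m.apply h) (Function.update f h g) (zipStep g m L R).1 (zipStep g m L R).2 := by
  obtain ⟨rfl, rfl⟩ := hz
  have := update_padded b g L.reverse R
  rw [List.length_reverse] at this
  rw [this]
  rcases m with _ | _ | _
  · rcases L with _ | ⟨a, L⟩
    · exact ⟨rfl, rfl⟩
    · exact ⟨by simp [zipStep, Move.apply], by simp [zipStep]⟩
  · exact ⟨rfl, rfl⟩
  · exact ⟨rfl, by simp [zipStep]⟩

/-- The total length grows only when the head stands on the first unrecorded cell, and then it does
not exceed the head position plus one. So a bound on head positions bounds the stacks. -/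
theorem length_zipStep (g : Γ) (m : Move) (L R : List Γ) :
    (zipStep g m L R).1.length + (zipStep g m L R).2.length ≤
      max (L.length + R.length) (L.length + 1) := by
  rcases m with _ | _ | _
  · rcases L with _ | ⟨a, L⟩ <;> simp [zipStep] <;> omega
  · simp [zipStep]; omega
  · simp [zipStep]; omega

variable [Finite Γ]

/-- The number that represents a list of symbols. -/
noncomputable def listNum : List Γ → ℕ
  | [] => 0
  | a :: l => Finite.equivFin Γ a + 1 + (Nat.card Γ + 1) * listNum l

theorem listNum_lt (l : List Γ) : listNum l < (Nat.card Γ + 1) ^ l.length := by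
  induction l with
  | nil => simp [listNum]
  | cons a l ih =>
    have h := (Finite.equivFin Γ a).2
    simp only [listNum, List.length_cons, pow_succ]
    nlinarith

/-- Symbols are digits from `1` to `Nat.card Γ`; as the digit zero is never used, the empty list is
distinguishable and pushing is invertible. -/
theorem listNum_cons_eq {a b : Γ} {l : List Γ} {n : ℕ} :
    listNum (a :: l) = Finite.equivFin Γ b + 1 + (Nat.card Γ + 1) * n ↔ a = b ∧ listNum l = n := by
  have h := (Finite.equivFin Γ a).2
  have h' := (Finite.equivFin Γ b).2
  rw [listNum, digit_ext (by omega) (by omega), Nat.add_right_cancel_iff, Fin.val_inj,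
    (Finite.equivFin Γ).injective.eq_iff]

/-- `r` represents a list with head `g` (blank if the list is empty) and tail represented by
`r'`. -/
def NumPop (b g : Γ) (r r' : ℕ) : Prop :=
  (r = Finite.equivFin Γ g + 1 + (Nat.card Γ + 1) * r') ∨ (r = 0 ∧ r' = 0 ∧ g = b)

theorem numPop_iff {b g : Γ} {R : List Γ} {r' : ℕ} :
    NumPop b g (listNum R) r' ↔ R.headD b = g ∧ r' = listNum R.tail := by
  rcases R with _ | ⟨a, R⟩
  · simp only [NumPop, listNum, List.headD_nil, List.tail_nil]
    constructor
    · rintro (h | ⟨-, h, h'⟩)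
      · omega
      · exact ⟨h'.symm, h⟩
    · rintro ⟨rfl, h⟩
      exact .inr ⟨trivial, h, rfl⟩
  · rw [NumPop, listNum_cons_eq]
    simp only [List.headD_cons, List.tail_cons]
    constructor
    · rintro (⟨h, h'⟩ | ⟨h, -⟩)
      · exact ⟨h, h'.symm⟩
      · simp [listNum] at h
    · rintro ⟨h, h'⟩
      exact .inl ⟨h, h'.symm⟩

/-- The effect of `zipStep` on the numbers that represent the two lists. -/
def NumStep (g' : Γ) (m : Move) (l r₀ l' r' : ℕ) : Prop :=
  match m with
  | .stay => l' = l ∧ r' = Finite.equivFin Γ g' + 1 + (Nat.card Γ + 1) * r₀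
  | .right => l' = Finite.equivFin Γ g' + 1 + (Nat.card Γ + 1) * l ∧ r' = r₀
  | .left => (l = 0 ∧ l' = 0 ∧ r' = Finite.equivFin Γ g' + 1 + (Nat.card Γ + 1) * r₀) ∨
      ∃ a : Γ, l = Finite.equivFin Γ a + 1 + (Nat.card Γ + 1) * l' ∧
        r' = Finite.equivFin Γ a + 1 + (Nat.card Γ + 1) *
          (Finite.equivFin Γ g' + 1 + (Nat.card Γ + 1) * r₀)

theorem numStep_iff {g' : Γ} {m : Move} {L R : List Γ} {l' r' : ℕ} :
    NumStep g' m (listNum L) (listNum R.tail) l' r' ↔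
      l' = listNum (zipStep g' m L R).1 ∧ r' = listNum (zipStep g' m L R).2 := by
  rcases m with _ | _ | _
  · rcases L with _ | ⟨a, L⟩
    · simp only [NumStep, zipStep, listNum]
      constructor
      · rintro (⟨-, h⟩ | ⟨_, h, -⟩)
        · exact h
        · omega
      · exact fun h => .inl ⟨trivial, h⟩
    · simp only [NumStep, listNum_cons_eq]
      simp only [zipStep, listNum]
      constructor
      · rintro (⟨h, -⟩ | ⟨_, ⟨rfl, rfl⟩, h⟩)
        · omega
        · exact ⟨rfl, h⟩
      · rintro ⟨rfl, h⟩
        exact .inr ⟨a, ⟨rfl, rfl⟩, h⟩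
  · rfl
  · rfl

end Tapes

/-! ### Machine configurations as tuples of numbers. -/

section Simulation

variable {M : NTM Bool} {N : ℕ}

/-- The registers that describe a configuration. -/
inductive Reg (k : ℕ) : Type
  | state : Reg k
  | pos : Reg k
  | left (t : Fin k) : Reg k
  | right (t : Fin k) : Reg k

instance (k : ℕ) : Finite (Reg k) :=
  .of_injective (β := (Unit ⊕ Unit) ⊕ (Fin k ⊕ Fin k)) (fun r => match r with
    | .state => .inl (.inl ())
    | .pos => .inl (.inr ())
    | .left t => .inr (.inl t)
    | .right t => .inr (.inr t)) (by rintro (_ | _ | _ | _) (_ | _ | _ | _) <;> simp)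

instance (M : NTM Bool) : Finite M.State := M.finite_state

instance (M : NTM Bool) : Finite M.Sym := M.finite_sym

/-- The registers `a` describe a configuration whose tapes have lengths at most `ℓ`. -/
def Describes (ℓ : ℕ) (a : Reg M.tapes → Fin N) (c : M.Cfg) : Prop :=
  (a .state : ℕ) = Finite.equivFin M.State c.state ∧ (a .pos : ℕ) = c.inHead ∧
    ∀ t, ∃ L R : List M.Sym, (a (.left t) : ℕ) = listNum L ∧ (a (.right t) : ℕ) = listNum R ∧
      IsZipper M.blank (c.head t) (c.tape t) L R ∧ L.length + R.length ≤ ℓ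

/-- The new position of the input head in terms of the scanned cell. -/
def PosStep (s : InputCell Bool) (m : Move) (p p' : ℕ) : Prop :=
  match m with
  | .stay => p' = p
  | .right => (s = .rightEnd ∧ p' = p) ∨ (s ≠ .rightEnd ∧ p' = p + 1)
  | .left => p' + 1 = p ∨ (p = 0 ∧ p' = 0)

/-- Clipping at the right end occurs exactly when the right marker is scanned, so the length of `y`
need not be consulted. -/
theorem posStep_iff {y : List Bool} {m : Move} {p p' : ℕ} (hp : p ≤ y.length + 1) :
    PosStep (readInput y p) m p p' ↔ p' = min (m.apply p) (y.length + 1) := by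
  rcases m with _ | _ | _
  · simp only [PosStep, Move.apply]; omega
  · simp only [PosStep, Move.apply]; omega
  · simp only [PosStep, Move.apply, ne_eq, readInput_eq_rightEnd]; omega

/-- The step relation on registers. -/
def RegStep (M : NTM Bool) (y : List Bool) (a b : Reg M.tapes → Fin N) : Prop :=
  ∃ (q q' : M.State) (s : InputCell Bool) (g g' : Fin M.tapes → M.Sym) (m : Move)
    (e : Fin M.tapes → Move), M.trans q s g q' m g' e ∧
    (a .state : ℕ) = Finite.equivFin M.State q ∧ (b .state : ℕ) = Finite.equivFin M.State q' ∧
    readInput y (a .pos) = s ∧ PosStep s m (a .pos) (b .pos) ∧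
    ∀ t, ∃ r₀ : Fin N, NumPop M.blank (g t) (a (.right t)) r₀ ∧
      NumStep (g' t) (e t) (a (.left t)) r₀ (b (.left t)) (b (.right t))

variable {y : List Bool} {ℓ : ℕ} {c c' : M.Cfg} {a b : Reg M.tapes → Fin N}

theorem listNum_lt_of_le (hN : (Nat.card M.Sym + 1) ^ ℓ ≤ N) {l : List M.Sym}
    (hl : l.length ≤ ℓ) : listNum l < N :=
  (listNum_lt l).trans_le ((Nat.pow_le_pow_right (Nat.succ_pos _) hl).trans hN)

theorem Describes.step_of_regStep (h : Describes ℓ a c) (hp : c.inHead ≤ y.length + 1)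
    (hhead : ∀ t, c.head t < ℓ) (hab : RegStep M y a b) :
    ∃ c', M.Step y c c' ∧ Describes ℓ b c' := by
  obtain ⟨h1, h2, h3⟩ := h
  obtain ⟨q, q', s, g, g', m, e, htr, hq, hq', hs, hm, ht⟩ := hab
  choose L R hL hR hz hℓ using h3
  choose r₀ hpop hstep using ht
  rw [hq, Fin.val_inj, (Finite.equivFin M.State).injective.eq_iff] at h1
  rw [h2] at hs hm
  subst hs h1
  have hg : (fun t => c.tape t (c.head t)) = g := by
    funext t
    rw [(hz t).read]
    exact (numPop_iff.1 (hR t ▸ hpop t)).1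
  refine ⟨_, ⟨q', m, g', e, ?_, rfl⟩, hq', (posStep_iff hp).1 hm, fun t => ?_⟩
  · rw [hg]; exact htr
  · have h4 := numPop_iff.1 (hR t ▸ hpop t)
    have h5 := hstep t
    rw [hL, h4.2, numStep_iff] at h5
    refine ⟨_, _, h5.1, h5.2, (hz t).step _ _, (length_zipStep _ _ _ _).trans (max_le (hℓ t) ?_)⟩
    rw [(hz t).length_eq]
    exact hhead t

theorem Describes.regStep_of_step (hN : (Nat.card M.Sym + 1) ^ ℓ ≤ N)
    (hN' : Nat.card M.State ≤ N) (hy : y.length + 2 ≤ N) (h : Describes ℓ a c)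
    (hp : c.inHead ≤ y.length + 1) (hhead : ∀ t, c.head t < ℓ) (hc : M.Step y c c') :
    ∃ b : Reg M.tapes → Fin N, RegStep M y a b ∧ Describes ℓ b c' := by
  obtain ⟨h1, h2, h3⟩ := h
  obtain ⟨q', m, g', e, htr, rfl⟩ := hc
  choose L R hL hR hz hℓ using h3
  have hlen : ∀ t, (zipStep (g' t) (e t) (L t) (R t)).1.length +
      (zipStep (g' t) (e t) (L t) (R t)).2.length ≤ ℓ := fun t =>
    (length_zipStep _ _ _ _).trans (max_le (hℓ t) (by rw [(hz t).length_eq]; exact hhead t))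
  refine ⟨fun r => match r with
    | .state => ⟨Finite.equivFin M.State q', (Finite.equivFin M.State q').2.trans_le hN'⟩
    | .pos => ⟨min (m.apply c.inHead) (y.length + 1), by omega⟩
    | .left t => ⟨listNum (zipStep (g' t) (e t) (L t) (R t)).1,
        listNum_lt_of_le hN (by have := hlen t; omega)⟩
    | .right t => ⟨listNum (zipStep (g' t) (e t) (L t) (R t)).2,
        listNum_lt_of_le hN (by have := hlen t; omega)⟩, ?_, ?_⟩
  · refine ⟨c.state, q', _, _, g', m, e, htr, h1, rfl, by rw [h2], ?_, fun t => ?_⟩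
    · rw [h2]
      exact (posStep_iff hp).2 rfl
    · refine ⟨⟨listNum (R t).tail, listNum_lt_of_le hN ?_⟩, ?_, ?_⟩
      · have := hℓ t
        rw [List.length_tail]
        omega
      · rw [hR, numPop_iff]
        exact ⟨(hz t).read.symm, rfl⟩
      · rw [hL, numStep_iff]
        exact ⟨rfl, rfl⟩
  · exact ⟨rfl, rfl, fun t => ⟨_, _, rfl, rfl, (hz t).step _ _, hlen t⟩⟩

theorem reachable_inHead_le (h : M.Reachable y c) : c.inHead ≤ y.length + 1 := by
  induction h with
  | refl => exact Nat.zero_le _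
  | tail _ h _ =>
    obtain ⟨q, m, g, d, -, rfl⟩ := h
    exact min_le_right _ _

/-- The three numerical hypotheses ensure that stack codes, states and input positions all fit below
`N`; with `hℓ`, machine steps and register steps then match in both directions. -/
theorem accepts_iff_registers (hN : (Nat.card M.Sym + 1) ^ ℓ ≤ N)
    (hN' : Nat.card M.State ≤ N) (hy : y.length + 2 ≤ N)
    (hℓ : ∀ c, M.Reachable y c → ∀ t, c.head t < ℓ) :
    M.Accepts y ↔ ∃ z a : Reg M.tapes → Fin N,
      (z .state : ℕ) = Finite.equivFin M.State M.start ∧ (z .pos : ℕ) = 0 ∧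
      (∀ t, (z (.left t) : ℕ) = 0 ∧ (z (.right t) : ℕ) = 0) ∧
      (a .state : ℕ) = Finite.equivFin M.State M.accept ∧
      Relation.ReflTransGen (RegStep M y) z a := by
  have hinit : ∀ z : Reg M.tapes → Fin N, (z .state : ℕ) = Finite.equivFin M.State M.start →
      (z .pos : ℕ) = 0 → (∀ t, (z (.left t) : ℕ) = 0 ∧ (z (.right t) : ℕ) = 0) →
      Describes ℓ z M.init := fun z h1 h2 h3 => ⟨h1, h2, fun t => ⟨[], [], (h3 t).1, (h3 t).2,
        ⟨rfl, by funext i; simp [padded, NTM.init]⟩, Nat.zero_le _⟩⟩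
  constructor
  · rintro ⟨c, hc, hacc⟩
    have hpos : 0 < N := by omega
    let z : Reg M.tapes → Fin N := fun r => match r with
      | .state => ⟨Finite.equivFin M.State M.start, (Finite.equivFin M.State M.start).2.trans_le hN'⟩
      | _ => ⟨0, hpos⟩
    have key : ∃ a : Reg M.tapes → Fin N, Relation.ReflTransGen (RegStep M y) z a ∧
        Describes ℓ a c := by
      clear hacc
      induction hc with
      | refl => exact ⟨z, .refl, hinit z rfl rfl fun _ => ⟨rfl, rfl⟩⟩
      | tail hr h ih =>
        obtain ⟨a, ha, had⟩ := ih
        obtain ⟨b, hb, hbd⟩ := had.regStep_of_step hN hN' hy (reachable_inHead_le hr) (hℓ _ hr) h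
        exact ⟨b, ha.tail hb, hbd⟩
    obtain ⟨a, ha, had⟩ := key
    exact ⟨z, a, rfl, rfl, fun _ => ⟨rfl, rfl⟩, hacc ▸ had.1, ha⟩
  · rintro ⟨z, a, h1, h2, h3, h4, h⟩
    have key : ∃ c, M.Reachable y c ∧ Describes ℓ a c := by
      clear h4
      induction h with
      | refl => exact ⟨M.init, .refl, hinit z h1 h2 h3⟩
      | tail _ h ih =>
        obtain ⟨c, hc, hcd⟩ := ih
        obtain ⟨c', hc', hcd'⟩ := hcd.step_of_regStep (reachable_inHead_le hc) (hℓ _ hc) h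
        exact ⟨c', hc.tail hc', hcd'⟩
    obtain ⟨c, hc, hcd⟩ := key
    refine ⟨c, hc, ?_⟩
    have := hcd.1
    rwa [h4, Fin.val_inj, (Finite.equivFin M.State).injective.eq_iff, eq_comm] at this

end Simulation

/-! ### Definability of acceptance. -/

section Definable

variable {d : ℕ} {ι : Type}

theorem NLDef.val_eq (i j : ι) : NLDef d (fun x (v : ι → U d x) => (v i : ℕ) = v j) := by
  simpa only [Fin.val_inj] using NLDef.eq i j

/-- The letters of the word `y x v` are definable from `v` and their positions. -/
def DefWord (d : ℕ) {ι : Type} (y : ∀ x, (ι → U d x) → List Bool) : Prop :=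
  ∀ s, NLDef d (fun x (v : ι ⊕ Unit → U d x) =>
    readInput (y x (fun i => v (.inl i))) (v (.inr ())) = s)

theorem NLDef.posStep (s : InputCell Bool) (m : Move) (i j : ι) :
    NLDef d (fun x (v : ι → U d x) => PosStep s m (v i) (v j)) := by
  rcases m with _ | _ | _
  · exact .or (.succ _ _) (.and (.zero _) (.zero _))
  · exact .val_eq _ _
  · refine .or (.and (.const _) (.val_eq _ _)) (.and (.const _) ?_)
    simp only [eq_comm (a := ((_ : Fin _) : ℕ)) (b := _ + 1)]
    exact .succ _ _

variable [Finite ι]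

section

variable {Γ : Type} [Finite Γ]

theorem NLTerm.push (a : Γ) {t : ∀ x, (ι → U d x) → ℕ} (ht : NLTerm d t) :
    NLTerm d (fun x v => Finite.equivFin Γ a + 1 + (Nat.card Γ + 1) * t x v) :=
  .add (.const _) (.mul (.const _) ht)

theorem NLDef.numPop (b g : Γ) (i j : ι) :
    NLDef d (fun x (v : ι → U d x) => NumPop b g (v i) (v j)) :=
  .or ((NLTerm.push g (.var j)).eq i) (.and (.zero _) (.and (.zero _) (.const _)))

theorem NLDef.numStep (g : Γ) (m : Move) (i j i' j' : ι) :
    NLDef d (fun x (v : ι → U d x) => NumStep g m (v i) (v j) (v i') (v j')) := by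
  rcases m with _ | _ | _
  · exact .or (.and (.zero _) (.and (.zero _) ((NLTerm.push g (.var j)).eq j')))
      (.existsFinite fun a => .and ((NLTerm.push a (.var i')).eq i)
        ((NLTerm.push a (.push g (.var j))).eq j'))
  · exact .and (.val_eq _ _) ((NLTerm.push g (.var j)).eq j')
  · exact .and ((NLTerm.push g (.var i)).eq i') (.val_eq _ _)

end

variable {y : ∀ x, (ι → U d x) → List Bool}

theorem DefWord.regStep (hy : DefWord d y) (M : NTM Bool) :
    NLDef d (fun x (v : ι ⊕ (Reg M.tapes ⊕ Reg M.tapes) → U d x) =>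
      RegStep M (y x (fun i => v (.inl i))) (fun r => v (.inr (.inl r)))
        (fun r => v (.inr (.inr r)))) := by
  refine .existsFinite fun q => .existsFinite fun q' => .existsFinite fun s => .existsFinite fun g =>
    .existsFinite fun g' => .existsFinite fun m => .existsFinite fun e => .and (.const _)
    (.and ((NLTerm.const _).eq _) (.and ((NLTerm.const _).eq _) (.and ?_ (.and (.posStep _ _ _ _)
      (.forallFinite fun t => .exists₁ (.and (.numPop _ _ _ _) (.numStep _ _ _ _ _ _)))))))
  exact (hy s).subst (Sum.elim Sum.inl fun _ => Sum.inr (Sum.inl Reg.pos))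

theorem pow_log_le (B C n : ℕ) : B ^ (C * (Nat.log 2 n + 1)) ≤ (n + 2) ^ (2 * B * C) := by
  have h1 : 2 ^ (Nat.log 2 n + 1) ≤ (n + 2) ^ 2 := by
    rcases Nat.eq_zero_or_pos n with rfl | hn
    · simp
    · have := Nat.pow_log_le_self 2 hn.ne'
      rw [pow_succ]
      nlinarith
  calc B ^ (C * (Nat.log 2 n + 1)) ≤ (2 ^ B) ^ (C * (Nat.log 2 n + 1)) :=
        Nat.pow_le_pow_left (Nat.lt_two_pow_self).le _
    _ = (2 ^ (Nat.log 2 n + 1)) ^ (B * C) := by rw [← pow_mul, ← pow_mul]; congr 1; ring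
    _ ≤ ((n + 2) ^ 2) ^ (B * C) := Nat.pow_le_pow_left h1 _
    _ = (n + 2) ^ (2 * B * C) := by rw [← pow_mul]; congr 1; ring

theorem exists_nlDef_accepts (M : NTM Bool) (hM : M.IsLogSpace) :
    ∃ k : ℕ, ∀ (d : ℕ) {ι : Type} [Finite ι] (y : ∀ x, (ι → U d x) → List Bool), DefWord d y →
      (∀ x v, ((y x v).length + 2) ^ k ≤ bound d x) →
      NLDef d (fun x v => M.Accepts (y x v)) := by
  obtain ⟨C, hC⟩ := hM
  -- The three summands pay for the stack codes (`pow_log_le`), the state numbers and the input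
  -- positions. The exponent depends on the machine alone, so `d` can be chosen afterwards.
  refine ⟨2 * (Nat.card M.Sym + 1) * C + Nat.card M.State + 1, fun d ι _ y hy hb => ?_⟩
  have key : ∀ x v, M.Accepts (y x v) ↔ ∃ z a : Reg M.tapes → U d x,
      (z .state : ℕ) = Finite.equivFin M.State M.start ∧ (z .pos : ℕ) = 0 ∧
      (∀ t, (z (.left t) : ℕ) = 0 ∧ (z (.right t) : ℕ) = 0) ∧
      (a .state : ℕ) = Finite.equivFin M.State M.accept ∧
      Relation.ReflTransGen (RegStep M (y x v)) z a := by
    intro x v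
    have h := hb x v
    have hle : ∀ m ≤ 2 * (Nat.card M.Sym + 1) * C + Nat.card M.State + 1,
        ((y x v).length + 2) ^ m ≤ bound d x := fun m hm =>
      (Nat.pow_le_pow_right (by omega) hm).trans h
    refine accepts_iff_registers (ℓ := C * (Nat.log 2 (y x v).length + 1))
      ((pow_log_le _ _ _).trans (hle _ (by omega))) ?_ ?_ fun c hc t => hC _ c hc t
    · calc Nat.card M.State ≤ 2 ^ Nat.card M.State := Nat.lt_two_pow_self.le
        _ ≤ ((y x v).length + 2) ^ Nat.card M.State := Nat.pow_le_pow_left (by omega) _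
        _ ≤ _ := hle _ (by omega)
    · simpa using hle 1 (by omega)
  simp only [key]
  have hpath : NLDef d (fun x (v : ι ⊕ (Reg M.tapes ⊕ Reg M.tapes) → U d x) =>
      Relation.ReflTransGen (RegStep M (y x (fun i => v (.inl i)))) (fun r => v (.inr (.inl r)))
        (fun r => v (.inr (.inr r)))) :=
    NLDef.path (Q := fun x p => RegStep M (y x p)) (hy.regStep M)
  exact .exists (.exists (.and ((NLTerm.const _).eq _) (.and (.zero _)
    (.and (.forallFinite fun t => .and (.zero _) (.zero _)) (.and ((NLTerm.const _).eq _)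
      (NLDef.at₂ (A := fun x p => Relation.ReflTransGen (RegStep M (y x p))) hpath _ _ _))))))

end Definable

end RegReal

/-! ### Encodings of automata -/

namespace RegReal

section Lists

theorem getElem?_append_eq_some {α : Type*} {l₁ l₂ : List α} {i : ℕ} {b : α} :
    (l₁ ++ l₂)[i]? = some b ↔ l₁[i]? = some b ∨ ∃ j, i = l₁.length + j ∧ l₂[j]? = some b := by
  rw [List.getElem?_append]
  split
  · constructor
    · exact .inl
    · rintro (h | ⟨j, rfl, -⟩)
      exacts [h, absurd ‹_› (by omega)]
  · rename_i h
    constructor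
    · exact fun h' => .inr ⟨i - l₁.length, by omega, h'⟩
    · rintro (h' | ⟨j, rfl, h'⟩)
      · have := (List.getElem?_eq_some_iff.1 h').1
        omega
      · simpa using h'

theorem getElem?_map_finRange_eq_some {α : Type*} {n i : ℕ} {f : Fin n → α} {b : α} :
    ((List.finRange n).map f)[i]? = some b ↔ ∃ q : Fin n, i = q ∧ f q = b := by
  rw [List.getElem?_map, Option.map_eq_some_iff]
  constructor
  · rintro ⟨q, hq, rfl⟩
    obtain ⟨h, rfl⟩ := List.getElem?_eq_some_iff.1 hq
    exact ⟨_, by simp, rfl⟩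
  · rintro ⟨q, rfl, rfl⟩
    exact ⟨q, by simp, rfl⟩

theorem getElem?_flatMap_finRange_eq_some {α : Type*} {n m i : ℕ} {f : Fin n → List α}
    (hf : ∀ q, (f q).length = m) {b : α} :
    ((List.finRange n).flatMap f)[i]? = some b ↔
      ∃ (q : Fin n) (j : ℕ), i = j + m * q ∧ (f q)[j]? = some b := by
  induction n generalizing i with
  | zero => simp
  | succ n ih =>
    rw [List.finRange_succ, List.flatMap_cons, List.flatMap_map, getElem?_append_eq_some, hf]
    simp only [ih (f := fun q => f q.succ) (fun q => hf _)]
    constructor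
    · rintro (h | ⟨_, rfl, q, j, rfl, h⟩)
      · exact ⟨0, i, by simp, h⟩
      · exact ⟨q.succ, j, by rw [Fin.val_succ]; ring, h⟩
    · rintro ⟨q, j, rfl, h⟩
      refine Fin.cases (fun h => .inl (by simpa using h)) (fun q h => .inr ?_) q h
      exact ⟨j + m * q, by rw [Fin.val_succ]; ring, q, j, rfl, h⟩

theorem length_flatMap_finRange {α : Type*} {n m : ℕ} {f : Fin n → List α}
    (hf : ∀ q, (f q).length = m) : ((List.finRange n).flatMap f).length = n * m := by
  simp [List.length_flatMap, hf]

theorem getElem?_table_eq_some {α : Type*} {n k m i : ℕ} {f : Fin n → Fin k → Fin m → α} {b : α} :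
    ((List.finRange n).flatMap fun q => (List.finRange k).flatMap fun j =>
      (List.finRange m).map (f q j))[i]? = some b ↔
        ∃ (q : Fin n) (j : Fin k) (q' : Fin m), i = q' + m * (j + k * q) ∧ f q j q' = b := by
  rw [getElem?_flatMap_finRange_eq_some (m := k * m)
    fun q => length_flatMap_finRange fun j => by simp]
  refine exists_congr fun q => ?_
  simp only [getElem?_flatMap_finRange_eq_some (m := m) (f := fun j => (List.finRange m).map (f q j))
    (fun j => by simp), getElem?_map_finRange_eq_some]
  constructor
  · rintro ⟨_, rfl, j, _, rfl, q', rfl, h⟩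
    exact ⟨j, q', by ring, h⟩
  · rintro ⟨j, q', rfl, h⟩
    exact ⟨q' + m * j, by ring, j, q', rfl, q', rfl, h⟩

/-- The cell at position `p` contains a one. -/
def Bit (x : List Bool) (p : ℕ) : Prop := readInput x p = .letter true

theorem bit_iff {x : List Bool} {p : ℕ} : Bit x p ↔ ∃ i, p = i + 1 ∧ x[i]? = some true := by
  rcases p with _ | p
  · simp [Bit, readInput]
  · simp only [Bit, readInput, Nat.add_right_cancel_iff, exists_eq_left']
    rcases x[p]? with _ | b <;> simp

end Lists

/-! ### Layout of the encoding and its decoding. -/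

section Encoding

variable {A : Type*} [Finite A] {n : ℕ}

theorem length_encodeNFA (M : NFA A (Fin n)) :
    (encodeNFA M).length = 3 * n + 1 + n * (Nat.card A * n) := by
  rw [encodeNFA, List.length_append, List.length_append, List.length_append, List.length_append,
    length_flatMap_finRange (m := Nat.card A * n)
      fun q => length_flatMap_finRange fun i => by simp]
  simp
  ring

/-- Position `0` holds the left marker, so all offsets are one larger than list indices, and the
separator after the unary block sits at `n + 1`. -/
theorem bit_encodeNFA {M : NFA A (Fin n)} {p : ℕ} : Bit (encodeNFA M) p ↔
    (p ≠ 0 ∧ p ≤ n) ∨ (∃ q : Fin n, p = n + 2 + q ∧ q ∈ M.start) ∨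
    (∃ q : Fin n, p = 2 * n + 2 + q ∧ q ∈ M.accept) ∨
    ∃ (q : Fin n) (j : Fin (Nat.card A)) (q' : Fin n),
      p = 3 * n + 2 + (q' + n * (j + Nat.card A * q)) ∧
        q' ∈ M.step q ((Finite.equivFin A).symm j) := by
  rw [bit_iff]
  simp only [encodeNFA, List.append_assoc, getElem?_append_eq_some, getElem?_map_finRange_eq_some,
    getElem?_table_eq_some, decide_eq_true_eq,
    List.length_replicate, List.length_singleton, List.length_map, List.length_finRange]
  constructor
  · rintro ⟨i, rfl, h | ⟨j, rfl, h | ⟨j, rfl, ⟨q, rfl, h⟩ | ⟨j, rfl, ⟨q, rfl, h⟩ |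
      ⟨_, rfl, q, j, q', rfl, h⟩⟩⟩⟩⟩
    · have := (List.getElem?_eq_some_iff.1 h).1
      rw [List.length_replicate] at this
      exact .inl (by omega)
    · rcases j with _ | j <;> simp at h
    · exact .inr (.inl ⟨q, by omega, h⟩)
    · exact .inr (.inr (.inl ⟨q, by omega, h⟩))
    · exact .inr (.inr (.inr ⟨q, j, q', by omega, h⟩))
  · rintro (⟨h, h'⟩ | ⟨q, rfl, h⟩ | ⟨q, rfl, h⟩ | ⟨q, j, q', rfl, h⟩)
    · exact ⟨p - 1, by omega, .inl (by rw [List.getElem?_replicate, if_pos (by omega)])⟩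
    · exact ⟨n + 1 + q, by omega, .inr ⟨1 + q, by omega, .inr ⟨q, rfl, .inl ⟨q, rfl, h⟩⟩⟩⟩
    · exact ⟨2 * n + 1 + q, by omega, .inr ⟨1 + n + q, by omega, .inr ⟨n + q, by omega,
        .inr ⟨q, rfl, .inl ⟨q, rfl, h⟩⟩⟩⟩⟩
    · generalize hs : (q' : ℕ) + n * (j + Nat.card A * q) = s
      exact ⟨3 * n + 1 + s, by omega, .inr ⟨1 + n + n + s, by omega, .inr ⟨n + n + s, by omega,
        .inr ⟨n + s, by omega, .inr ⟨s, rfl, q, j, q', hs.symm, h⟩⟩⟩⟩⟩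

theorem exists_not_bit (x : List Bool) : ∃ n, ¬ Bit x (n + 1) :=
  ⟨x.length, by rw [Bit, readInput_eq_rightEnd.2 (by omega)]; simp⟩

open Classical in
/-- The number of states of the automaton that `x` describes. -/
noncomputable def numStates (x : List Bool) : ℕ := Nat.find (exists_not_bit x)

theorem numStates_le (x : List Bool) : numStates x ≤ x.length := by
  classical
  exact Nat.find_min' _ (by rw [Bit, readInput_eq_rightEnd.2 (by omega)]; simp)

theorem eq_numStates_iff {x : List Bool} {n : ℕ} :
    n = numStates x ↔ ¬ Bit x (n + 1) ∧ ∀ i < n, Bit x (i + 1) := by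
  classical
  rw [eq_comm, numStates, Nat.find_eq_iff]
  simp

theorem numStates_encodeNFA (M : NFA A (Fin n)) : numStates (encodeNFA M) = n := by
  refine (eq_numStates_iff.2 ⟨?_, fun i hi => bit_encodeNFA.2 (.inl (by omega))⟩).symm
  rw [bit_encodeNFA]
  rintro (h | ⟨q, h, -⟩ | ⟨q, h, -⟩ | ⟨q, j, q', h, -⟩) <;> omega

/-- The automaton with states `0, …, n - 1` given by predicates on natural numbers. -/
def natNFA (n : ℕ) (S F : ℕ → Prop) (T : A → ℕ → ℕ → Prop) : NFA A (Fin n) where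
  start := {q | S q}
  accept := {q | F q}
  step q a := {q' | T a q q'}

/-- The transitions of the automaton that `x` describes. -/
def decodeStep (A : Type*) [Finite A] (n : ℕ) (x : List Bool) (a : A) (q q' : ℕ) : Prop :=
  Bit x (3 * n + 2 + (q' + n * (Finite.equivFin A a + Nat.card A * q)))

/-- The automaton with `n` states that `x` describes. -/
def decodeNFA (A : Type*) [Finite A] (n : ℕ) (x : List Bool) : NFA A (Fin n) :=
  natNFA n (fun q => Bit x (n + 2 + q)) (fun q => Bit x (2 * n + 2 + q)) (decodeStep A n x)

theorem decodeNFA_encodeNFA (M : NFA A (Fin n)) : decodeNFA A n (encodeNFA M) = M := by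
  obtain ⟨step, start, accept⟩ := M
  simp only [decodeNFA, natNFA, decodeStep, NFA.mk.injEq]
  refine ⟨?_, ?_, ?_⟩
  · funext q a
    ext q'
    rw [Set.mem_ofPred_eq, bit_encodeNFA]
    constructor
    · rintro (⟨-, h⟩ | ⟨q₁, h, -⟩ | ⟨q₁, h, -⟩ | ⟨q₁, j, q₁', h, h'⟩)
      · omega
      · omega
      · omega
      · rw [Nat.add_left_cancel_iff, digit_ext q'.2 q₁'.2, digit_ext (Fin.is_lt _) j.2] at h
        simp only [Fin.val_inj] at h
        obtain ⟨rfl, rfl, rfl⟩ := h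
        simpa using h'
    · exact fun h => .inr (.inr (.inr ⟨q, Finite.equivFin A a, q', rfl, by simpa using h⟩))
  · ext q
    rw [Set.mem_ofPred_eq, bit_encodeNFA]
    constructor
    · rintro (⟨-, h⟩ | ⟨q₁, h, h'⟩ | ⟨q₁, h, -⟩ | ⟨q₁, j, q₁', h, -⟩)
      · omega
      · rw [Nat.add_left_cancel_iff, Fin.val_inj] at h
        exact h ▸ h'
      · omega
      · omega
    · exact fun h => .inr (.inl ⟨q, rfl, h⟩)
  · ext q
    rw [Set.mem_ofPred_eq, bit_encodeNFA]
    constructor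
    · rintro (⟨-, h⟩ | ⟨q₁, h, -⟩ | ⟨q₁, h, h'⟩ | ⟨q₁, j, q₁', h, -⟩)
      · omega
      · omega
      · rw [Nat.add_left_cancel_iff, Fin.val_inj] at h
        exact h ▸ h'
      · omega
    · exact fun h => .inr (.inr (.inl ⟨q, rfl, h⟩))

/-- Any word can be decoded; the valid encodings are those recovered by encoding again. Validity
thus becomes an equality of two words with definable letters. -/
theorem mem_NRR_iff {L : Language A} {x : List Bool} :
    x ∈ NRR L ↔ x = encodeNFA (decodeNFA A (numStates x) x) ∧
      ∃ u ∈ (decodeNFA A (numStates x) x).accepts, u ∈ L := by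
  constructor
  · rintro ⟨n, M, rfl, h⟩
    rw [numStates_encodeNFA, decodeNFA_encodeNFA]
    exact ⟨rfl, h⟩
  · rintro ⟨h, h'⟩
    exact ⟨_, _, h, h'⟩

theorem encodeNFA_mem_NRR {L : Language A} {M : NFA A (Fin n)} :
    encodeNFA M ∈ NRR L ↔ ∃ u ∈ M.accepts, u ∈ L := by
  rw [mem_NRR_iff, numStates_encodeNFA, decodeNFA_encodeNFA]
  simp

theorem ext_readInput {x y : List Bool} {N : ℕ} (hx : x.length < N) (hy : y.length < N)
    (h : ∀ p < N, readInput x p = readInput y p) : x = y := by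
  refine List.ext_getElem? fun i => ?_
  by_cases hi : i + 1 < N
  · have := h _ hi
    simp only [readInput] at this
    rcases hx : x[i]? with _ | a <;> rcases hy : y[i]? with _ | b <;> simp_all
  · rw [List.getElem?_eq_none (by omega), List.getElem?_eq_none (by omega)]

end Encoding

section Definable

variable {A : Type*} [Finite A] {d : ℕ} {ι : Type}

theorem length_add_lt_bound (d : ℕ) (x : List Bool) : x.length + 2 < bound d x :=
  (Nat.lt_size_self _).trans_le (Nat.pow_le_pow_left (by omega) _)

theorem NLTerm.gt [Finite ι] {t : ∀ x, (ι → U d x) → ℕ} (i : ι) (ht : NLTerm d t) :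
    NLDef d (fun x (v : ι → U d x) => (v i : ℕ) < t x v) := by
  simpa only [lt_iff_le_and_ne] using (ht.ge i).and (ht.eq i).not

end Definable

end RegReal

/-! ### Definable automata -/

namespace RegReal

section DefinableAutomata

variable {A : Type*} [Finite A] {d : ℕ} {ι : Type}

theorem NLDef.bit (i : ι) : NLDef d (fun x (v : ι → U d x) => Bit x (v i)) := .letter i _

/-- A term may exceed the register bound, but such positions lie beyond the input and hold no one.
-/
theorem NLTerm.bit {t : ∀ x, (ι → U d x) → ℕ} (ht : NLTerm d t) :
    NLDef d (fun x (v : ι → U d x) => Bit x (t x v)) := by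
  have : ∀ x (v : ι → U d x), Bit x (t x v) ↔ ∃ u : U d x, (u : ℕ) = t x v ∧ Bit x u := by
    intro x v
    constructor
    · intro h
      refine ⟨⟨t x v, ?_⟩, rfl, h⟩
      by_contra hlt
      have := length_add_lt_bound d x
      rw [Bit, readInput_eq_rightEnd.2 (by omega)] at h
      simp at h
    · rintro ⟨u, h, h'⟩
      rwa [← h]
  simp only [this]
  exact ht.exists_eq (.bit _)

theorem bit_encode_natNFA {n N : ℕ} (hn : n < N) {S F : ℕ → Prop} {T : A → ℕ → ℕ → Prop} {p : ℕ} :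
    Bit (encodeNFA (natNFA n S F T)) p ↔ (¬ p = 0 ∧ p ≤ n) ∨
      (∃ q : Fin N, (q : ℕ) < n ∧ p = n + 2 + q ∧ S q) ∨
      (∃ q : Fin N, (q : ℕ) < n ∧ p = 2 * n + 2 + q ∧ F q) ∨
      ∃ (j : Fin (Nat.card A)) (q : Fin N), (q : ℕ) < n ∧ ∃ q' : Fin N, (q' : ℕ) < n ∧
        p = 3 * n + 2 + (q' + n * (j + Nat.card A * q)) ∧
          T ((Finite.equivFin A).symm j) q q' := by
  rw [bit_encodeNFA]
  refine or_congr Iff.rfl (or_congr ?_ (or_congr ?_ ?_))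
  · constructor
    · rintro ⟨q, h, h'⟩
      exact ⟨⟨q, q.2.trans hn⟩, q.2, h, h'⟩
    · rintro ⟨q, hq, h, h'⟩
      exact ⟨⟨q, hq⟩, h, h'⟩
  · constructor
    · rintro ⟨q, h, h'⟩
      exact ⟨⟨q, q.2.trans hn⟩, q.2, h, h'⟩
    · rintro ⟨q, hq, h, h'⟩
      exact ⟨⟨q, hq⟩, h, h'⟩
  · constructor
    · rintro ⟨q, j, q', h, h'⟩
      exact ⟨j, ⟨q, q.2.trans hn⟩, q.2, ⟨q', q'.2.trans hn⟩, q'.2, h, h'⟩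
    · rintro ⟨j, q, hq, q', hq', h, h'⟩
      exact ⟨⟨q, hq⟩, j, ⟨q', hq'⟩, h, h'⟩

variable [Finite ι]

/-- A zero is a position that holds neither a one nor a marker. Here closure under negation becomes
essential for the composition. -/
theorem DefWord.of_bit {y : ∀ x, (ι → U d x) → List Bool}
    (hb : NLDef d (fun x (v : ι ⊕ Unit → U d x) => Bit (y x (fun i => v (.inl i))) (v (.inr ()))))
    (hlen : NLTerm d (fun x v => (y x v).length)) : DefWord d y := by
  have hl : NLDef d (fun x (v : ι ⊕ Unit → U d x) =>
      readInput (y x (fun i => v (.inl i))) (v (.inr ())) = .leftEnd) := by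
    simpa only [readInput_eq_leftEnd] using NLDef.zero _
  have hr : NLDef d (fun x (v : ι ⊕ Unit → U d x) =>
      readInput (y x (fun i => v (.inl i))) (v (.inr ())) = .rightEnd) := by
    simpa only [readInput_eq_rightEnd] using (hlen.subst _).lt _
  rintro (_ | (_ | _) | _)
  · exact hl
  · have := hb.not.and (hl.not.and hr.not)
    convert this using 3 with x v
    rcases h : readInput (y x fun i => v (.inl i)) (v (.inr ())) with _ | (_ | _) | _ <;>
      simp [Bit, h]
  · exact hb
  · exact hr

theorem NLTerm.length_encodeNFA {n : ∀ x, (ι → U d x) → ℕ} (hn : NLTerm d n)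
    (M : ∀ x (v : ι → U d x), NFA A (Fin (n x v))) :
    NLTerm d (fun x v => (encodeNFA (M x v)).length) := by
  simp only [RegReal.length_encodeNFA]
  exact .add (.add (.mul (.const _) hn) (.const _)) (.mul hn (.mul (.const _) hn))

theorem defWord_encodeNFA {n : ∀ x, (ι → U d x) → ℕ} (hn : NLTerm d n)
    (hlt : ∀ x v, n x v < bound d x)
    {S F : ∀ x, (ι → U d x) → ℕ → Prop} {T : A → ∀ x, (ι → U d x) → ℕ → ℕ → Prop}
    (hS : NLDef d (fun x (v : ι ⊕ Unit → U d x) => S x (fun i => v (.inl i)) (v (.inr ()))))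
    (hF : NLDef d (fun x (v : ι ⊕ Unit → U d x) => F x (fun i => v (.inl i)) (v (.inr ()))))
    (hT : ∀ a, NLDef d (fun x (v : (ι ⊕ Unit) ⊕ Unit → U d x) =>
      T a x (fun i => v (.inl (.inl i))) (v (.inl (.inr ()))) (v (.inr ())))) :
    DefWord d (fun x v =>
      encodeNFA (natNFA (n x v) (S x v) (F x v) fun a => T a x v)) := by
  refine .of_bit ?_ (hn.length_encodeNFA _)
  simp only [bit_encode_natNFA (hlt _ _)]
  refine .or (.and (NLDef.zero _).not ((hn.subst _).ge _)) (.or ?_ (.or ?_ ?_))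
  · exact .exists₁ (.and ((hn.subst _).gt _) (.and
      (NLTerm.eq _ (.add (.add (hn.subst _) (.const _)) (.var _)))
      (hS.subst (Sum.elim (fun i => Sum.inl (Sum.inl i)) fun _ => Sum.inr ()))))
  · exact .exists₁ (.and ((hn.subst _).gt _) (.and
      (NLTerm.eq _ (.add (.add (.mul (.const _) (hn.subst _)) (.const _)) (.var _)))
      (hF.subst (Sum.elim (fun i => Sum.inl (Sum.inl i)) fun _ => Sum.inr ()))))
  · exact .existsFinite fun j => .exists₁ (.and ((hn.subst _).gt _) (.exists₁ (.and
      ((hn.subst _).gt _) (.and (NLTerm.eq _ (.add (.add (.mul (.const _) (hn.subst _)) (.const _))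
        (.add (.var _) (.mul (hn.subst _) (.add (.const _) (.mul (.const _) (.var _)))))))
      ((hT _).subst (Sum.elim (Sum.elim (fun i => Sum.inl (Sum.inl (Sum.inl i)))
        fun _ => Sum.inl (Sum.inr ())) fun _ => Sum.inr ()))))))

theorem NLTerm.numStates : NLTerm d (fun x (_ : ι → U d x) => RegReal.numStates x) := by
  unfold NLTerm
  have : ∀ x (v : ι ⊕ Unit → U d x), (v (.inr ()) : ℕ) = RegReal.numStates x ↔
      (∃ w : U d x, (v (.inr ()) : ℕ) + 1 = w ∧ ¬ Bit x w) ∧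
        ¬ ∃ i : U d x, (i < v (.inr ()) ∧ ∃ w : U d x, (i : ℕ) + 1 = w ∧ ¬ Bit x w) := by
    intro x v
    constructor
    · intro h
      obtain ⟨h1, h2⟩ := eq_numStates_iff.1 h
      refine ⟨⟨⟨v (.inr ()) + 1, ?_⟩, rfl, h1⟩, ?_⟩
      · have := length_add_lt_bound d x
        have := numStates_le x
        omega
      · rintro ⟨i, hi, w, hw, h⟩
        exact h (hw ▸ h2 i hi)
    · rintro ⟨⟨w, hw, h1⟩, h2⟩
      refine eq_numStates_iff.2 ⟨hw ▸ h1, fun i hi => by_contra fun h => h2 ?_⟩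
      have := (v (.inr ())).2
      exact ⟨⟨i, by omega⟩, hi, ⟨i + 1, by omega⟩, rfl, h⟩
  simp only [this]
  exact .and (.exists₁ (.and (.succ _ _) (NLDef.bit _).not)) (NLDef.not (.exists₁ (.and (.lt _ _)
    (.exists₁ (.and (.succ _ _) (NLDef.bit _).not)))))

/-- The described automaton has transitions `q → q'` labelled `a`. -/
theorem NLDef.decodeStep (a : A) (i j : ι) : NLDef d (fun x (v : ι → U d x) =>
    RegReal.decodeStep A (RegReal.numStates x) x a (v i) (v j)) :=
  NLTerm.bit (.add (.add (.mul (.const _) .numStates) (.const _))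
    (.add (.var _) (.mul .numStates (.add (.const _) (.mul (.const _) (.var _))))))

theorem NLDef.decodeStart (i : ι) : NLDef d (fun x (v : ι → U d x) =>
    Bit x (RegReal.numStates x + 2 + v i)) :=
  NLTerm.bit (.add (.add .numStates (.const _)) (.var _))

theorem NLDef.decodeAccept (i : ι) : NLDef d (fun x (v : ι → U d x) =>
    Bit x (2 * RegReal.numStates x + 2 + v i)) :=
  NLTerm.bit (.add (.add (.mul (.const _) .numStates) (.const _)) (.var _))

theorem numStates_lt_bound (d : ℕ) (x : List Bool) : numStates x < bound d x := by
  have := length_add_lt_bound d x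
  have := numStates_le x
  omega

theorem DefWord.eq_input {y : ∀ x, (ι → U d x) → List Bool} (hy : DefWord d y)
    (hlt : ∀ x v, (y x v).length < bound d x) : NLDef d (fun x v => x = y x v) := by
  have : ∀ x (v : ι → U d x), x = y x v ↔ ¬ ∃ p : U d x, ∃ s, readInput x p = s ∧
      ¬ readInput (y x v) p = s := by
    intro x v
    constructor
    · rintro h ⟨p, s, hs, hs'⟩
      rw [← h] at hs'
      exact hs' hs
    · intro h
      refine ext_readInput (N := bound d x) (by have := length_add_lt_bound d x; omega) (hlt x v)
        fun p hp => by_contra fun hne => h ⟨⟨p, hp⟩, _, rfl, fun h' => hne h'.symm⟩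
  simp only [this]
  exact NLDef.not (.exists₁ (.existsFinite fun s => .and (.letter _ _) (hy s).not))

/-- Encodings of automata with at most `x.length` states have polynomial length; the
alphabet-dependent factor is absorbed into the exponent. -/
theorem numStates_pow_le (A : Type*) [Finite A] {n : ℕ} (M : NFA A (Fin n)) {x : List Bool}
    (hn : n ≤ x.length) : (encodeNFA M).length + 2 ≤ (x.length + 2) ^ (Nat.card A + 3) := by
  rw [length_encodeNFA]
  have h : 2 ^ (Nat.card A + 1) ≤ (x.length + 2) ^ (Nat.card A + 1) :=
    Nat.pow_le_pow_left (by omega) _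
  have h2 : Nat.card A + 2 ≤ 2 ^ (Nat.card A + 1) := Nat.lt_two_pow_self
  calc 3 * n + 1 + n * (Nat.card A * n) + 2
      ≤ (Nat.card A + 2) * (x.length + 2) ^ 2 := by
        have : n * (Nat.card A * n) ≤ Nat.card A * (x.length + 2) ^ 2 := by
          rw [show n * (Nat.card A * n) = Nat.card A * n ^ 2 by ring]
          exact Nat.mul_le_mul_left _ (Nat.pow_le_pow_left (by omega) _)
        nlinarith
    _ ≤ (x.length + 2) ^ (Nat.card A + 1) * (x.length + 2) ^ 2 :=
        Nat.mul_le_mul_right _ (h2.trans h)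
    _ = _ := by rw [← pow_add]

theorem le_bound (k : ℕ) (x : List Bool) {K : ℕ} (hk : k ≤ K + 1) :
    (x.length + 2) ^ k ≤ bound (2 ^ (K + 1) - 2) x := by
  have h : 2 ≤ 2 ^ (K + 1) := Nat.le_self_pow (Nat.succ_ne_zero _) 2
  calc (x.length + 2) ^ k ≤ (x.length + 2) ^ (K + 1) := Nat.pow_le_pow_right (by omega) hk
    _ ≤ (2 ^ (x.length + 2).size) ^ (K + 1) := Nat.pow_le_pow_left (Nat.lt_size_self _).le _
    _ = bound (2 ^ (K + 1) - 2) x := by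
      rw [bound, Nat.sub_add_cancel h, ← pow_mul, ← pow_mul, mul_comm]

end DefinableAutomata

end RegReal

/-! ### Context-free languages are closed under substitution -/

namespace RegReal

section Grammar

variable {A B : Type*} {m : ℕ}

section Symbols

variable (e : A ≃ Fin m) (g : ContextFreeGrammar A) (gs : Fin m → ContextFreeGrammar B)

/-- The embedding of the symbols of the outer grammar. -/
def outerSymbol : Symbol A g.NT → Symbol B (g.NT ⊕ Σ i, (gs i).NT)
  | .terminal a => .nonterminal (.inr ⟨e a, (gs (e a)).initial⟩)
  | .nonterminal X => .nonterminal (.inl X)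

/-- The embedding of the symbols of an inner grammar. -/
def innerSymbol (i : Fin m) : Symbol B (gs i).NT → Symbol B (g.NT ⊕ Σ i, (gs i).NT)
  | .terminal b => .terminal b
  | .nonterminal X => .nonterminal (.inr ⟨i, X⟩)

open Classical in
/-- A grammar for the image of the language of `g` under the substitution that maps the letter `a`
to the language of `gs (e a)`. -/
noncomputable abbrev substGrammar : ContextFreeGrammar B where
  NT := g.NT ⊕ Σ i, (gs i).NT
  initial := .inl g.initial
  rules := g.rules.image (fun r => ⟨.inl r.input, r.output.map (outerSymbol e g gs)⟩) ∪
    Finset.univ.biUnion fun i => (gs i).rules.image fun r =>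
      ⟨.inr ⟨i, r.input⟩, r.output.map (innerSymbol g gs i)⟩

theorem mem_substGrammar_rules {r : ContextFreeRule B (g.NT ⊕ Σ i, (gs i).NT)} :
    r ∈ (substGrammar e g gs).rules ↔
      (∃ r' ∈ g.rules, ⟨.inl r'.input, r'.output.map (outerSymbol e g gs)⟩ = r) ∨
      ∃ i, ∃ r' ∈ (gs i).rules, ⟨.inr ⟨i, r'.input⟩, r'.output.map (innerSymbol g gs i)⟩ = r := by
  classical
  refine Finset.mem_union.trans (or_congr Finset.mem_image (Finset.mem_biUnion.trans ?_))
  simp only [Finset.mem_image, Finset.mem_univ, true_and]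

end Symbols

theorem derives_append {T : Type*} {g : ContextFreeGrammar T} {s s' t t' : List (Symbol T g.NT)}
    (h : g.Derives s s') (h' : g.Derives t t') : g.Derives (s ++ t) (s' ++ t') :=
  (h.append_right t).trans (h'.append_left s')

/-- Both the outer and the inner grammars embed in the substitution grammar by this simulation of
derivations. -/
theorem derives_map {T T' : Type*} {g : ContextFreeGrammar T} {g' : ContextFreeGrammar T'}
    (f : Symbol T g.NT → Symbol T' g'.NT)
    (hf : ∀ r ∈ g.rules, g'.Derives [f (.nonterminal r.input)] (r.output.map f))
    {s t : List (Symbol T g.NT)} (h : g.Derives s t) : g'.Derives (s.map f) (t.map f) := by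
  induction h with
  | refl => rfl
  | tail _ h ih =>
    refine ih.trans ?_
    obtain ⟨r, hr, h⟩ := h
    obtain ⟨p, q, rfl, rfl⟩ := h.exists_parts
    simp only [List.map_append, List.map_singleton]
    exact derives_append (derives_append (.refl _) (hf r hr)) (.refl _)

theorem derives_of_mem {g : ContextFreeGrammar B} {r : ContextFreeRule B g.NT} (h : r ∈ g.rules) :
    g.Derives [.nonterminal r.input] r.output :=
  .single ⟨r, h, .input_output⟩

theorem mem_substWord_cons {σ : A → Language B} {a : A} {w : List A} {u : List B} :
    u ∈ substWord σ (a :: w) ↔ ∃ u₁ ∈ σ a, ∃ u₂ ∈ substWord σ w, u₁ ++ u₂ = u := by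
  rw [substWord, List.map_cons, List.prod_cons, Language.mem_mul]
  rfl

theorem mem_substWord_nil {σ : A → Language B} {u : List B} : u ∈ substWord σ [] ↔ u = [] := by
  rw [substWord, List.map_nil, List.prod_nil]
  exact Language.mem_one u

variable {e : A ≃ Fin m} {g : ContextFreeGrammar A} {gs : Fin m → ContextFreeGrammar B}

theorem derives_of_mem_substWord {w : List A} {u : List B}
    (h : u ∈ substWord (fun a => (gs (e a)).language) w) : (substGrammar e g gs).Derives
      ((w.map Symbol.terminal).map (outerSymbol e g gs)) (u.map .terminal) := by
  induction w generalizing u with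
  | nil =>
    rw [mem_substWord_nil.1 h]
    rfl
  | cons a w ih =>
    obtain ⟨u₁, h₁, u₂, h₂, rfl⟩ := mem_substWord_cons.1 h
    rw [List.map_append]
    refine derives_append (s := [_]) ?_ (ih h₂)
    have := derives_map (g' := substGrammar e g gs) (innerSymbol g gs (e a))
      (fun r hr => derives_of_mem ((mem_substGrammar_rules e g gs).2 (.inr ⟨e a, r, hr, rfl⟩))) h₁
    rw [List.map_map] at this
    exact this

/-- The language that a symbol is meant to generate. -/
def symbolLanguage (e : A ≃ Fin m) (g : ContextFreeGrammar A) (gs : Fin m → ContextFreeGrammar B) :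
    Symbol B (g.NT ⊕ Σ i, (gs i).NT) → Language B
  | .terminal b => {[b]}
  | .nonterminal (.inl X) => {u | ∃ w : List A, g.Derives [.nonterminal X] (w.map .terminal) ∧
      u ∈ substWord (fun a => (gs (e a)).language) w}
  | .nonterminal (.inr ⟨i, X⟩) => {u | (gs i).Derives [.nonterminal X] (u.map .terminal)}

theorem derives_of_mem_inner {i : Fin m} {s : List (Symbol B (gs i).NT)} {u : List B}
    (h : u ∈ ((s.map (innerSymbol g gs i)).map (symbolLanguage e g gs)).prod) :
    (gs i).Derives s (u.map .terminal) := by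
  induction s generalizing u with
  | nil =>
    rw [show u = [] from h]
    rfl
  | cons x s ih =>
    rw [List.map_cons, List.map_cons, List.prod_cons, Language.mem_mul] at h
    obtain ⟨u₁, h₁, u₂, h₂, rfl⟩ := h
    rw [List.map_append]
    refine derives_append (s := [_]) ?_ (ih h₂)
    rcases x with b | X
    · rw [show u₁ = [b] from h₁]
      rfl
    · exact h₁

theorem derives_of_mem_outer {s : List (Symbol A g.NT)} {u : List B}
    (h : u ∈ ((s.map (outerSymbol e g gs)).map (symbolLanguage e g gs)).prod) :
    ∃ w : List A, g.Derives s (w.map .terminal) ∧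
      u ∈ substWord (fun a => (gs (e a)).language) w := by
  induction s generalizing u with
  | nil => exact ⟨[], .refl _, h⟩
  | cons x s ih =>
    rw [List.map_cons, List.map_cons, List.prod_cons, Language.mem_mul] at h
    obtain ⟨u₁, h₁, u₂, h₂, rfl⟩ := h
    obtain ⟨w, hw, hu⟩ := ih h₂
    rcases x with a | X
    · exact ⟨a :: w, derives_append (s := [_]) (s' := [_]) (.refl _) hw,
        mem_substWord_cons.2 ⟨u₁, h₁, u₂, hu, rfl⟩⟩
    · obtain ⟨w', hw', hu'⟩ := h₁
      refine ⟨w' ++ w, ?_, ?_⟩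
      · rw [List.map_append]
        exact derives_append (s := [_]) hw' hw
      · rw [substWord, List.map_append, List.prod_append]
        exact Language.append_mem_mul hu' hu

/-- The intended languages satisfy the inclusion of each rule, so rewriting can only shrink the
language of a sentential form. Along a derivation this gives soundness of the grammar. -/
theorem symbolLanguage_of_produces {s t : List (Symbol B (substGrammar e g gs).NT)}
    (h : (substGrammar e g gs).Produces s t) :
    (t.map (symbolLanguage e g gs)).prod ≤ (s.map (symbolLanguage e g gs)).prod := by
  obtain ⟨r, hr, h⟩ := h
  obtain ⟨p, q, rfl, rfl⟩ := h.exists_parts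
  simp only [List.map_append, List.prod_append, List.map_singleton, List.prod_singleton]
  refine mul_le_mul' (mul_le_mul' le_rfl ?_) le_rfl
  rcases (mem_substGrammar_rules e g gs).1 hr with ⟨r', hr', rfl⟩ | ⟨i, r', hr', rfl⟩
  · intro u hu
    obtain ⟨w, hw, hu⟩ := derives_of_mem_outer hu
    exact ⟨w, (derives_of_mem hr').trans hw, hu⟩
  · exact fun u hu => (derives_of_mem hr').trans (derives_of_mem_inner hu)

theorem language_substGrammar : (substGrammar e g gs).language =
    substLanguage (fun a => (gs (e a)).language) g.language := by
  ext u
  constructor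
  · intro h
    have key : ∀ {s t : List (Symbol B (substGrammar e g gs).NT)},
        (substGrammar e g gs).Derives s t →
          (t.map (symbolLanguage e g gs)).prod ≤ (s.map (symbolLanguage e g gs)).prod := by
      intro s t h
      induction h with
      | refl => exact le_rfl
      | tail _ h ih => exact (symbolLanguage_of_produces h).trans ih
    have hu : ∀ u : List B, u ∈ (((u.map Symbol.terminal).map
        (symbolLanguage e g gs)).prod) := by
      intro u
      induction u with
      | nil => exact Language.nil_mem_one
      | cons b u ih =>
        rw [List.map_cons, List.map_cons, List.prod_cons]
        exact Language.append_mem_mul (a := [b]) rfl ih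
    have := key h (hu u)
    rw [List.map_singleton, List.prod_singleton] at this
    exact this
  · rintro ⟨w, hw, hu⟩
    have := derives_map (g' := substGrammar e g gs) (outerSymbol e g gs)
      (fun r hr => derives_of_mem ((mem_substGrammar_rules e g gs).2 (.inl ⟨r, hr, rfl⟩))) hw
    exact this.trans (derives_of_mem_substWord hu)

end Grammar

theorem isContextFree_substLanguage {A B : Type*} [Finite A] {L : Language A} {σ : A → Language B}
    (hL : L.IsContextFree) (hσ : ∀ a, (σ a).IsContextFree) :
    (substLanguage σ L).IsContextFree := by
  obtain ⟨g, rfl⟩ := hL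
  choose gs hgs using hσ
  refine ⟨substGrammar (Finite.equivFin A) g fun i => gs ((Finite.equivFin A).symm i), ?_⟩
  rw [language_substGrammar]
  simp [hgs]

end RegReal

/-! ### Substitution preserves easy languages -/

namespace RegReal

section Automata

variable {A B : Type*} {Q : Type*} {σ : A → Language B} {M : NFA B Q} {M' : NFA A Q}

/-- A run on a word of `σ a` followed by a word for the remaining letters is cut at the intermediate
state; the first piece is one edge labelled `a`. -/
theorem mem_evalFrom_subst
    (h : ∀ q a q', q' ∈ M'.step q a ↔ ∃ u ∈ σ a, q' ∈ M.evalFrom {q} u) {S : Set Q} {w : List A}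
    {q' : Q} : q' ∈ M'.evalFrom S w ↔ ∃ u ∈ substWord σ w, q' ∈ M.evalFrom S u := by
  induction w generalizing S with
  | nil => simp [mem_substWord_nil]
  | cons a w ih =>
    rw [NFA.evalFrom_cons, ih]
    constructor
    · rintro ⟨u₂, hu₂, hq⟩
      obtain ⟨q₁, hq₁, hq⟩ := NFA.mem_evalFrom_iff_exists.1 hq
      obtain ⟨q, hq₀, hq₁⟩ := NFA.mem_stepSet.1 hq₁
      obtain ⟨u₁, hu₁, hq₁⟩ := (h _ _ _).1 hq₁
      refine ⟨u₁ ++ u₂, mem_substWord_cons.2 ⟨u₁, hu₁, u₂, hu₂, rfl⟩, ?_⟩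
      rw [NFA.evalFrom_append]
      exact NFA.mem_evalFrom_iff_exists.2 ⟨q₁, NFA.mem_evalFrom_iff_exists.2 ⟨q, hq₀, hq₁⟩, hq⟩
    · rintro ⟨u, hu, hq⟩
      obtain ⟨u₁, hu₁, u₂, hu₂, rfl⟩ := mem_substWord_cons.1 hu
      rw [NFA.evalFrom_append] at hq
      obtain ⟨q₁, hq₁, hq⟩ := NFA.mem_evalFrom_iff_exists.1 hq
      obtain ⟨q, hq₀, hq₁⟩ := NFA.mem_evalFrom_iff_exists.1 hq₁
      exact ⟨u₂, hu₂, NFA.mem_evalFrom_iff_exists.2 ⟨q₁,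
        NFA.mem_stepSet.2 ⟨q, hq₀, (h _ _ _).2 ⟨u₁, hu₁, hq₁⟩⟩, hq⟩⟩

theorem exists_accepts_subst (hS : M'.start = M.start) (hF : M'.accept = M.accept)
    (h : ∀ q a q', q' ∈ M'.step q a ↔ ∃ u ∈ σ a, q' ∈ M.evalFrom {q} u) {L : Language A} :
    (∃ u ∈ M.accepts, u ∈ substLanguage σ L) ↔ ∃ w ∈ M'.accepts, w ∈ L := by
  constructor
  · rintro ⟨u, hu, w, hw, huw⟩
    obtain ⟨q, hq, hu⟩ := NFA.mem_accepts.1 hu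
    exact ⟨w, NFA.mem_accepts.2 ⟨q, hF ▸ hq, (mem_evalFrom_subst h).2 ⟨u, huw, hS ▸ hu⟩⟩, hw⟩
  · rintro ⟨w, hw, hwL⟩
    obtain ⟨q, hq, hw⟩ := NFA.mem_accepts.1 hw
    obtain ⟨u, huw, hu⟩ := (mem_evalFrom_subst h).1 hw
    exact ⟨u, NFA.mem_accepts.2 ⟨q, hF ▸ hq, hS ▸ hu⟩, w, hwL, huw⟩

end Automata

section Main

variable {A B : Type*} [Finite B]

/-- The automaton described by `x`, with `q` as the only initial state and `q'` as the only
accepting state. -/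
noncomputable def pointedNFA (B : Type*) [Finite B] (x : List Bool) (q q' : ℕ) : NFA B (Fin (numStates x)) :=
  natNFA (numStates x) (· = q) (· = q') (decodeStep B (numStates x) x)

theorem mem_accepts_pointedNFA {x : List Bool} {q q' : Fin (numStates x)} {u : List B} :
    u ∈ (pointedNFA B x q q').accepts ↔ q' ∈ (decodeNFA B (numStates x) x).evalFrom {q} u := by
  have hs : (pointedNFA B x q q').start = {q} := by
    ext p
    exact Fin.val_inj
  rw [NFA.mem_accepts, hs]
  constructor
  · rintro ⟨p, hp, h⟩
    obtain rfl : p = q' := Fin.val_inj.1 hp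
    exact h
  · exact fun h => ⟨q', rfl, h⟩

/-- The automaton over `A` whose transitions are labelled by the letters `a` such that some word of
the language assigned to `a` leads from one state to the other in the automaton described by
`x`. Membership in these languages' realizability problems is decided by the machines `M a`. -/
noncomputable def outerNFA (B : Type*) [Finite B] (M : A → NTM Bool) (x : List Bool) :
    NFA A (Fin (numStates x)) :=
  natNFA (numStates x) (fun q => Bit x (numStates x + 2 + q))
    (fun q => Bit x (2 * numStates x + 2 + q))
    (fun a q q' => (M a).Accepts (encodeNFA (pointedNFA B x q q')))

theorem inNL_NRR_substLanguage [Finite A] {L : Language A} {σ : A → Language B}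
    (hL : InNL (NRR L)) (hσ : ∀ a, InNL (NRR (σ a))) : InNL (NRR (substLanguage σ L)) := by
  obtain ⟨M, hM, hML⟩ := hL
  choose Ms hMs hMσ using hσ
  obtain ⟨k, hk⟩ := exists_nlDef_accepts M hM
  choose ks hks using fun a => exists_nlDef_accepts (Ms a) (hMs a)
  obtain ⟨K, hK⟩ : ∃ K, ∀ a, ks a ≤ K := by
    obtain ⟨K, hK⟩ := (Set.finite_range ks).bddAbove
    exact ⟨K, fun a => hK ⟨a, rfl⟩⟩
  have key : ∀ x, x ∈ NRR (substLanguage σ L) ↔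
      x = encodeNFA (decodeNFA B (numStates x) x) ∧ M.Accepts (encodeNFA (outerNFA B Ms x)) := by
    -- On valid encodings the question passes to the outer automaton, whose edges are by definition
    -- answers of the machines for the languages `σ a`.
    intro x
    rw [mem_NRR_iff, ← hML, encodeNFA_mem_NRR]
    refine and_congr_right fun _ => exists_accepts_subst
      (M := decodeNFA B (numStates x) x) (M' := outerNFA B Ms x) rfl rfl fun q a q' => ?_
    have : q' ∈ (outerNFA B Ms x).step q a ↔ (Ms a).Accepts (encodeNFA (pointedNFA B x q q')) :=
      Iff.rfl
    rw [this, ← hMσ, encodeNFA_mem_NRR]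
    simp only [mem_accepts_pointedNFA, and_comm]
  -- Encodings over `B` and `A` have length at most the powers `Nat.card B + 3` and `Nat.card A + 3`
  -- of the input size, and the machines raise this to `ks a ≤ K` and `k`. One exponent serves all;
  -- `2 ^ (K' + 1) - 2` makes the digit base equal to `2 ^ (K' + 1)`.
  set K' := (Nat.card B + 3) * (K + 1) + (Nat.card A + 3) * (k + 1) with hK'
  have hbound : ∀ (x y : List Bool) (c k : ℕ), y.length + 2 ≤ (x.length + 2) ^ c →
      c * k ≤ K' + 1 → (y.length + 2) ^ k ≤ bound (2 ^ (K' + 1) - 2) x := by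
    intro x y c k h h'
    calc (y.length + 2) ^ k ≤ ((x.length + 2) ^ c) ^ k := Nat.pow_le_pow_left h _
      _ = (x.length + 2) ^ (c * k) := by rw [pow_mul]
      _ ≤ _ := le_bound _ _ h'
  have hcB : Nat.card B + 3 ≤ K' + 1 := by nlinarith
  have hcK : ∀ a, (Nat.card B + 3) * ks a ≤ K' + 1 := fun a => by
    have := Nat.mul_le_mul_left (Nat.card B + 3) (hK a)
    nlinarith
  have hck : (Nat.card A + 3) * k ≤ K' + 1 := by nlinarith
  refine inNL_of_nlDef (2 ^ (K' + 1) - 2) _ ?_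
  simp only [key]
  have hn : ∀ {ι : Type} [Finite ι],
      NLTerm (2 ^ (K' + 1) - 2) (fun x (_ : ι → U _ x) => numStates x) := .numStates
  refine .and (DefWord.eq_input ?_ fun x _ => ?_) (hk _ _ ?_ fun x _ =>
    hbound _ _ _ _ (numStates_pow_le A _ (numStates_le x)) hck)
  · exact defWord_encodeNFA hn (fun x _ => numStates_lt_bound _ x) (.decodeStart _)
      (.decodeAccept _) fun a => .decodeStep a _ _
  · have := hbound x _ _ 1 (numStates_pow_le B (decodeNFA B (numStates x) x) (numStates_le x))
      (by simpa using hcB)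
    rw [pow_one] at this
    omega
  · refine defWord_encodeNFA (T := fun a x _ q q' => (Ms a).Accepts (encodeNFA (pointedNFA B x q q')))
      hn (fun x _ => numStates_lt_bound _ x) (.decodeStart _) (.decodeAccept _) fun a => ?_
    -- The inner use of the simulation: the two states are variables, and the word fed to the
    -- machine for `σ a` depends definably on them.
    refine hks a _ (fun x (v : (Unit ⊕ Unit) ⊕ Unit → U _ x) =>
      encodeNFA (pointedNFA B x (v (.inl (.inr ()))) (v (.inr ())))) ?_ fun x _ =>
        hbound _ _ _ _ (numStates_pow_le B _ (numStates_le x)) (hcK a)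
    exact defWord_encodeNFA hn (fun x _ => numStates_lt_bound _ x) (.val_eq _ _) (.val_eq _ _)
      fun b => .decodeStep b _ _

end Main

end RegReal

theorem mainTheorem8 {A B : Type*} [Finite A] [Finite B]
    (L : Language A) (σ : A → Language B)
    (hL : RegReal.IsEasy L) (hσ : ∀ a : A, RegReal.IsEasy (σ a)) :
    RegReal.IsEasy (RegReal.substLanguage σ L) :=
  ⟨RegReal.isContextFree_substLanguage hL.1 fun a => (hσ a).1,
    RegReal.inNL_NRR_substLanguage hL.2 fun a => (hσ a).2⟩
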